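/- Let $N\ge 1$, $m=N+1$, $q\in\mathbb C\setminus\{0\}$, and put $$f(u,v)=\frac{qu-q^{-1}v}{u-v},\quad g(u,v)=\frac{q-q^{-1}}{u-v},\quad g^{(l)}(u,v)=u\,g(u,v),\quad g^{(r)}(u,v)=v\,g(u,v),$$ $$R(u,v)=f(u,v)\sum_{i}E_{ii}\otimes E_{ii}+\sum_{i<j}(E_{ii}\otimes E_{jj}+E_{jj}\otimes E_{ii})+\sum_{i<j}g(u,v)\,(u\,E_{ij}\otimes E_{ji}+v\,E_{ji}\otimes E_{ij}),\qquad 1\le i,j\le m.$$ Let $\mathcal H$ be a complex vector space and let $T(u)=(T_{i,j}(u))_{1\le i,j\le m}$ be a matrix of linear operators on $\mathcal H$ which, for distinct $u,v$ in a set $D\subseteq\mathbb C$ of regular points, satisfies $R(u,v)(T(u)\otimes \mathbf 1)(\mathbf 1\otimes T(v))=(\mathbf 1\otimes T(v))(T(u)\otimes \mathbf 1)R(u,v)$. Let $\langle 0|\in\mathcal H^*$ be a dual pseudovacuum: for $u\in D$, $\langle0|T_{i,i}(u)=\lambda_i(u)\langle0|$ and $\langle0|T_{i,j}(u)=0$ for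 $i<j$, with scalar functions $\lambda_i$. Put $\alpha_i=\lambda_i/\lambda_{i+1}$. Products over sets: $f(\bar a,\bar b)=\prod_{x\in\bar a}\prod_{y\in\bar b}f(x,y)$ and $\lambda_i(\bar a)=\prod_{x\in\bar a}\lambda_i(x)$; empty products are $1$. **Bethe vectors.** For a monodromy matrix $T$ of size $m=N+1$ with vacuum vector $|0\rangle$ and vacuum eigenvalues $\lambda_i$, the Bethe vector $\mathbb B_q(\bar t^1;\dots;\bar t^N\,|\,T)$ is defined by the nested algebraic Bethe ansatz: it is $|0\rangle$ if $N=0$, and for $N\ge1$, with $\bar t^1=\{t_1,\dots,t_r\}$ and $\bar t^{N+1}=\emptyset$, $$\mathbb B_q(\bar t\,|\,T)=\frac{1}{\lambda_2(\bar t^1)\,f(\bar t^2,\bar t^1)}\sum_{k_1,\dots,k_r=2}^{m}T_{1,k_1}(t_1)\cdots T_{1,k_r}(t_r)\,\bigl[\mathbb B_q(\bar t^2;\dots;\bar t^N\,|\,\widetilde T)\bigr]_{k_1,\dots,k_r},$$ where $\widetilde T(u)=D(u)\,\mathsf r_{0,r}(u,t_r)\cdots \mathsf r_{0,1}(u,t_1)$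 acts in $\mathcal H\otimes(\mathbb C^{m-1})^{\otimes r}$, $D(u)=(T_{i,j}(u))_{i,j\ge2}$, $\mathsf r$ is the $R$-matrix above on $\mathbb C^{m-1}\otimes\mathbb C^{m-1}$ (indices $2,\dots,m$), the vacuum vector of $\widetilde T$ is $|0\rangle\otimes \mathsf e_2^{\otimes r}$ and its vacuum eigenvalues are $\lambda_2(u)f(u,\bar t^1),\lambda_3(u),\dots,\lambda_m(u)$. **Dual Bethe vectors.** $\mathbb C(\bar s)=\mathbb C_q(\bar s^1;\dots;\bar s^N)\in\mathcal H^*$ is the image of the Bethe vector $\mathbb B_{q^{-1}}(1/\bar s^1;\dots;1/\bar s^N)$ under the antimorphism $\Psi:\ T_{a,b}(u)\mapsto T_{b,a}(u^{-1})$, $\lambda_i(u)\mapsto\lambda_i(u^{-1})$, $|0\rangle\mapsto\langle0|$; that is, it is $\mathbb B_{q^{-1}}(1/\bar s\,|\,\widehat T)$, where $\widehat T_{a,b}(u)$ is the operator on $\mathcal H^*$ given by right multiplication by $T_{b,a}(u^{-1})$, with vacuum vector $\langle0|$ and vacuum eigenvalues $\lambda_i(u^{-1})$. Let $z\in\mathbb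 C$ and finite sets $\bar s^1,\dots,\bar s^N\subset\mathbb C$ be generic in the following sense: $z$ and all elements of the sets $\bar s^\nu$ lie in $D\setminus\{0\}$, they are pairwise distinct (also across different sets), $qx\neq q^{-1}y$ for any two distinct ones $x,y$ of them, and $\lambda_{\nu+1}(x)\ne0$ for all $x\in\bar s^\nu$. Put $\bar s^0=\bar s^{N+1}=\emptyset$. 1. If $\lambda_2(z)\neq0$, then $$\mathbb C(\{z,\bar s^1\};\{\bar s^k\}_2^N)=\sum_{j=2}^{N+1}\ \sum_{\mathrm{part}(\bar s^2,\dots,\bar s^{j-1})}\mathbb C(\bar s^1;\{\bar s^k_{II}\}_2^{j-1};\{\bar s^k\}_j^N)\,\frac{T_{j,1}(z)}{\lambda_2(z)}\ \frac{\prod_{\nu=2}^{j-1}\alpha_\nu(\bar s^\nu_I)\,g^{(r)}(\bar s^\nu_I,\bar s^{\nu-1}_I)\,f(\bar s^\nu_{II},\bar s^\nu_I)}{\prod_{\nu=1}^{j-1}f(\bar s^{\nu+1},\bar s^\nu_I)},$$ where $\bar s^1_I=\{z\}$. 2. If $\lambda_{N+1}(z)\ne0$, then $$\mathbb C(\{\bar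 s^k\}_1^{N-1};\{z,\bar s^N\})=\sum_{j=1}^{N}\ \sum_{\mathrm{part}(\bar s^j,\dots,\bar s^{N-1})}\mathbb C(\{\bar s^k\}_1^{j-1};\{\bar s^k_{II}\}_j^{N-1};\bar s^N)\,\frac{T_{N+1,j}(z)}{\lambda_{N+1}(z)}\ \frac{\prod_{\nu=j}^{N-1}g^{(l)}(\bar s^{\nu+1}_I,\bar s^\nu_I)\,f(\bar s^\nu_I,\bar s^\nu_{II})}{\prod_{\nu=j}^{N}f(\bar s^\nu_I,\bar s^{\nu-1})},$$ where $\bar s^N_I=\{z\}$. The inner sums run over all partitions of each of the indicated sets $\bar s^\nu$ into disjoint subsets $\bar s^\nu_I,\bar s^\nu_{II}$ with $\#\bar s^\nu_I=1$; such a sum is zero if one of these sets is empty. The sets of Bethe parameters may be enumerated in any order in the definition of the dual Bethe vectors: both identities hold for every choice of enumerations. -/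

import Mathlib

noncomputable section

namespace UqAffine

/-! ### Rational functions and the `R`-matrix -/

/-- `f(u,v) = (q u - q⁻¹ v) / (u - v)`. -/
def fRat (q u v : ℂ) : ℂ := (q * u - q⁻¹ * v) / (u - v)

/-- `g(u,v) = (q - q⁻¹) / (u - v)`. -/
def gRat (q u v : ℂ) : ℂ := (q - q⁻¹) / (u - v)

/-- `g⁽ˡ⁾(u,v) = u g(u,v)`. -/
def gLeft (q u v : ℂ) : ℂ := u * gRat q u v

/-- `g⁽ʳ⁾(u,v) = v g(u,v)`. -/
def gRight (q u v : ℂ) : ℂ := v * gRat q u v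

/-- Shorthand `f(ā, b̄)`: the double product of `f(x,y)` over `x` in `ā` and `y` in `b̄`. -/
def fProd (q : ℂ) (a b : List ℂ) : ℂ :=
  (a.map fun x => (b.map fun y => fRat q x y).prod).prod

/-- The coefficient of `E_{ij} ⊗ E_{kl}` in
`R(u,v) = f ∑ᵢ Eᵢᵢ⊗Eᵢᵢ + ∑_{i<j} (Eᵢᵢ⊗Eⱼⱼ + Eⱼⱼ⊗Eᵢᵢ) + ∑_{i<j} g (u Eᵢⱼ⊗Eⱼᵢ + v Eⱼᵢ⊗Eᵢⱼ)`. -/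
def rCoeff (q : ℂ) {m : ℕ} (u v : ℂ) (i j k l : Fin m) : ℂ :=
  if i = j ∧ k = l then (if i = k then fRat q u v else 1)
  else if i = l ∧ j = k then (if i < j then u * gRat q u v else v * gRat q u v)
  else 0

/-! ### Monodromy matrices -/

section Model

variable {H : Type*} [AddCommGroup H] [Module ℂ H]

/-- The relation `R(u,v) (T(u) ⊗ 1) (1 ⊗ T(v)) = (1 ⊗ T(v)) (T(u) ⊗ 1) R(u,v)`, for distinct `u, v`
in the set `D` of points at which `T` is regular, written out in the entries
`E_{ij} ⊗ E_{kl}`. -/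
def RTTRelation (q : ℂ) (D : Set ℂ) {m : ℕ} (T : Fin m → Fin m → ℂ → Module.End ℂ H) : Prop :=
  ∀ u ∈ D, ∀ v ∈ D, u ≠ v → ∀ i j k l : Fin m,
    ∑ a, ∑ b, rCoeff q u v i a k b • (T a j u * T b l v) =
      ∑ a, ∑ b, rCoeff q u v a j b l • (T k b v * T i a u)

/-- `⟨0| T_{ii}(u) = λ_i(u) ⟨0|`, and `⟨0| T_{ij}(u) = 0` for `i < j`. An operator acts on a linear
functional from the right by composition. -/
def IsDualPseudovacuum (D : Set ℂ) {m : ℕ} (T : Fin m → Fin m → ℂ → Module.End ℂ H)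
    (lam : Fin m → ℂ → ℂ) (dvac : Module.Dual ℂ H) : Prop :=
  ∀ u ∈ D, (∀ i, dvac ∘ₗ T i i u = lam i u • dvac) ∧ ∀ i j, i < j → dvac ∘ₗ T i j u = 0

/-! ### The nested Bethe vectors

`SiteSpace r k H` is `H ⊗ (ℂᵏ)^{⊗ r}`: a vector is given by its components in `H` along the standard
basis `e_{κ 0} ⊗ ⋯ ⊗ e_{κ (r-1)}` of `(ℂᵏ)^{⊗ r}`. -/

/-- `H ⊗ (ℂᵏ)^{⊗ r}`, in components. -/
abbrev SiteSpace (r k : ℕ) (H : Type*) : Type _ := (Fin r → Fin k) → H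

/-- The operator `A ⊗ 1` on `H ⊗ (ℂᵏ)^{⊗ r}`. -/
def liftOp (r k : ℕ) (A : Module.End ℂ H) : Module.End ℂ (SiteSpace r k H) :=
  LinearMap.pi fun κ => A ∘ₗ LinearMap.proj κ

/-- The operator on `H ⊗ (ℂᵏ)^{⊗ r}` that acts by the matrix `M` in the tensor factor number `p`,
and trivially elsewhere. -/
def siteOp (r k : ℕ) (p : Fin r) (M : Matrix (Fin k) (Fin k) ℂ) :
    Module.End ℂ (SiteSpace r k H) :=
  LinearMap.pi fun κ => ∑ b, M (κ p) b • LinearMap.proj (Function.update κ p b)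

/-- `R_{0,p}(u,ξ)`, where `0` labels the auxiliary space `ℂᵏ` and `p` the tensor factor number `p`
of `(ℂᵏ)^{⊗ r}`, as a matrix in the auxiliary space with operator entries. -/
def siteR (q : ℂ) (r k : ℕ) (u ξ : ℂ) (p : Fin r) :
    Matrix (Fin k) (Fin k) (Module.End ℂ (SiteSpace r k H)) :=
  Matrix.of fun i j => siteOp r k p (Matrix.of fun a b => rCoeff q u ξ i j a b)

/-- The monodromy matrix `D(u) R_{0,r}(u,t_r) ⋯ R_{0,1}(u,t_1)` of the next level of nesting, acting
in `H ⊗ (ℂᵏ)^{⊗ r}`. Here `D(u)` is the lower right `k × k` block of `T(u)`, and `t_1, …, t_r` are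
the members of the list `t`. -/
def nestedMonodromy (q : ℂ) {k : ℕ} (T : Fin (k + 1) → Fin (k + 1) → ℂ → Module.End ℂ H)
    (t : List ℂ) (i j : Fin k) (u : ℂ) : Module.End ℂ (SiteSpace t.length k H) :=
  ((Matrix.of fun a b : Fin k => liftOp t.length k (T a.succ b.succ u)) *
    ((List.ofFn fun p : Fin t.length => siteR (H := H) q t.length k u (t.get p) p).reverse).prod) i j

/-- Vacuum eigenvalues of the nested monodromy matrix: `λ_2(u) f(u, t̄), λ_3(u), λ_4(u), …`. -/
def nestedEigenvalue (q : ℂ) {k : ℕ} (lam : Fin (k + 1) → ℂ → ℂ) (t : List ℂ) (i : Fin k) (u : ℂ) :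
    ℂ :=
  if i.val = 0 then lam i.succ u * fProd q [u] t else lam i.succ u

/-- The vector `v ⊗ e_1 ⊗ ⋯ ⊗ e_1` of `H ⊗ (ℂᵏ)^{⊗ r}`, for `k ≥ 1`. -/
def nestedVacuum (r k : ℕ) (v : H) : SiteSpace r (k + 1) H :=
  Pi.single (fun _ => 0) v

end Model

/-- The Bethe vector `𝔹(t̄¹; …; t̄ᴺ)` with `N` colours of an `(N+1) × (N+1)` monodromy matrix `T`
with vacuum eigenvalues `lam` and pseudovacuum `vac`, by the nested algebraic Bethe ansatz:
`𝔹 = |0⟩` for `N = 0`, and for `N ≥ 1`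
`𝔹(t̄) = ∑_{k_1,…,k_r} T_{1,k_1}(t¹_1) ⋯ T_{1,k_r}(t¹_r) [𝔹(t̄²; …; t̄ᴺ | T̃)]_{k_1,…,k_r}`
`         / (λ_2(t̄¹) f(t̄², t̄¹))`,
where `r` is the number of parameters in `t̄¹` and `T̃` is the nested monodromy matrix.
Indices and colours are counted from `0`: `T 0 1` is `T_{12}`, and `t 0` is `t̄¹`. -/
def betheVector (q : ℂ) : (N : ℕ) → {H : Type*} → [AddCommGroup H] → [Module ℂ H] →
    (Fin (N + 1) → Fin (N + 1) → ℂ → Module.End ℂ H) → (Fin (N + 1) → ℂ → ℂ) → H →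
    (Fin N → List ℂ) → H
  | 0, _, _, _, _, _, vac, _ => vac
  | N + 1, _, _, _, T, lam, vac, t =>
    (((t 0).map fun x => lam 1 x).prod *
        (if h : 1 < N + 1 then fProd q (t ⟨1, h⟩) (t 0) else 1))⁻¹ •
      ∑ κ : Fin (t 0).length → Fin (N + 1),
        (List.ofFn fun p => T 0 (κ p).succ ((t 0).get p)).prod
          (betheVector q N (nestedMonodromy q T (t 0)) (nestedEigenvalue q lam (t 0))
            (nestedVacuum (t 0).length N vac) (fun ν => t ν.succ) κ)

/-- The dual Bethe vector `ℂ_q(s̄¹; …; s̄ᴺ) = Ψ(𝔹_{q⁻¹}(1/s̄¹; …; 1/s̄ᴺ))`, a linear functional on `H`.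
The antimorphism `Ψ` replaces `T_{ab}(u)` by `T_{ba}(u⁻¹)` acting from the right (on functionals,
by transposition), `λ_i(u)` by `λ_i(u⁻¹)`, and `|0⟩` by `⟨0|`. -/
def dualBetheVector (q : ℂ) {N : ℕ} {H : Type*} [AddCommGroup H] [Module ℂ H]
    (T : Fin (N + 1) → Fin (N + 1) → ℂ → Module.End ℂ H) (lam : Fin (N + 1) → ℂ → ℂ)
    (dvac : Module.Dual ℂ H) (s : Fin N → List ℂ) : Module.Dual ℂ H :=
  betheVector q⁻¹ N (H := Module.Dual ℂ H) (fun a b u => (T b a u⁻¹).dualMap)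
    (fun i u => lam i u⁻¹) dvac (fun ν => (s ν).map fun x => x⁻¹)

/-- `α_ν(u) = λ_ν(u) / λ_{ν+1}(u)`, with colours counted from `0`. -/
def alpha {N : ℕ} (lam : Fin (N + 1) → ℂ → ℂ) (ν : Fin N) (u : ℂ) : ℂ :=
  lam ν.castSucc u / lam ν.succ u

/-- Genericity of `z` together with all the parameters `s`: they are nonzero regular points,
pairwise distinct, and no ratio of two of them equals `q^{±2}`. -/
def Generic (q : ℂ) (D : Set ℂ) {N : ℕ} (z : ℂ) (s : Fin N → List ℂ) : Prop :=
  (∀ x ∈ z :: (List.ofFn s).flatten, x ∈ D ∧ x ≠ 0) ∧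
  (z :: (List.ofFn s).flatten).Pairwise fun x y => x ≠ y ∧ q * x ≠ q⁻¹ * y ∧ q * y ≠ q⁻¹ * x

/-! ### Partitions

A partition of the sets `s̄^ν` with `ν ∈ A` into a one-element subset `s̄^ν_I = {x ν}` and its
complement `s̄^ν_II` is coded by `x`; for `ν ∉ A` nothing is removed from `s̄^ν`, and `x ν` is set
to `z`. -/

/-- The partitions of the sets `s̄^ν`, `ν ∈ A`. There is none if one of these sets is empty. -/
def partitions {N : ℕ} (A : Finset (Fin N)) (z : ℂ) (s : Fin N → List ℂ) : Finset (Fin N → ℂ) :=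
  Fintype.piFinset fun ν => if ν ∈ A then (s ν).toFinset else {z}

/-- `s̄^ν_II` for `ν ∈ A`, and `s̄^ν` for `ν ∉ A`. -/
def remaining {N : ℕ} (A : Finset (Fin N)) (s : Fin N → List ℂ) (x : Fin N → ℂ) (ν : Fin N) :
    List ℂ :=
  if ν ∈ A then (s ν).erase (x ν) else s ν

/-- The coefficient
`∏_{ν=2}^{j-1} α_ν(s^ν_I) g⁽ʳ⁾(s^ν_I, s^{ν-1}_I) f(s̄^ν_II, s^ν_I) / ∏_{ν=1}^{j-1} f(s̄^{ν+1}, s^ν_I)`.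
The colours are `0, …, n`, the parameter `j` below stands for `j - 2`, and `μ` for the pair of colours
`(μ.castSucc, μ.succ)`, that is `(ν-1, ν)` in the numerator and `(ν, ν+1)` in the denominator. The
factor with `s̄^{ν+1} = ∅` for the last colour `ν` equals `1` and is absent. -/
def coeffFirst (q : ℂ) {n : ℕ} (lam : Fin (n + 2) → ℂ → ℂ) (j : Fin (n + 1))
    (s sII : Fin (n + 1) → List ℂ) (x : Fin (n + 1) → ℂ) : ℂ :=
  (∏ μ : Fin n with μ.succ ≤ j, alpha lam μ.succ (x μ.succ) *
      gRight q (x μ.succ) (x μ.castSucc) * fProd q (sII μ.succ) [x μ.succ]) /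
    ∏ μ : Fin n with μ.castSucc ≤ j, fProd q (s μ.succ) [x μ.castSucc]

/-- The coefficient
`∏_{ν=j}^{N-1} g⁽ˡ⁾(s^{ν+1}_I, s^ν_I) f(s^ν_I, s̄^ν_II) / ∏_{ν=j}^{N} f(s^ν_I, s̄^{ν-1})`.
The colours are `0, …, n`, the parameter `j` below stands for `j - 1`, and `μ` for the pair of colours
`(μ.castSucc, μ.succ)`, that is `(ν, ν+1)` in the numerator and `(ν-1, ν)` in the denominator. The
factor with `s̄^{ν-1} = ∅` for the first colour `ν` equals `1` and is absent. -/
def coeffSecond (q : ℂ) {n : ℕ} (j : Fin (n + 1))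
    (s sII : Fin (n + 1) → List ℂ) (x : Fin (n + 1) → ℂ) : ℂ :=
  (∏ μ : Fin n with j ≤ μ.castSucc,
      gLeft q (x μ.succ) (x μ.castSucc) * fProd q [x μ.castSucc] (sII μ.castSucc)) /
    ∏ μ : Fin n with j ≤ μ.succ, fProd q [x μ.succ] (s μ.castSucc)

end UqAffine

end

open UqAffine

/-! By definition a dual Bethe vector is an ordinary Bethe vector, over q⁻¹, of the transposed
monodromy matrix T_{ba}(u⁻¹) acting on functionals. This matrix again satisfies the RTT relation,
with q⁻¹, and ⟨0| is a pseudovacuum for it (`Exchange.dualMonodromy`,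
`IsDualPseudovacuum.isVacuum`). Inverting q, u and v fixes f and interchanges g⁽ˡ⁾ and g⁽ʳ⁾. The
theorem therefore reduces to two recursions for ordinary Bethe vectors, `betheVector_first` and
`betheVector_last`. Most of the work concerns the unnormalized vectors `preBethe`; the normalization
is restored at the end.

First colour. With z at the head of the first set, the nested monodromy matrix is the one without z
with one more tensor site attached. Hence the Bethe vector is a sum of T_{1,j}(z) applied to row
products of the components, along that site, of a Bethe vector of the enlarged nested chain.
`preBethe_addSite` finds such components by induction on the number of colours. The component along
the vacuum direction is the Bethe vector of the chain without the site. In the other components the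
site has been excited by one of the row operators; moving the diagonal entry T_{11} through the row
(`Exchange.zero_rowProd`, `Exchange.rowProd_addSite_succ`) gives a sum over the parameter x that is
used up, with its own site pulled to the front. What is left is the same problem with one colour
fewer and x in the role of z. Iteration produces chains of parameters from consecutive colours,
which are the partitions in the theorem.

Last colour. The reflection T_{ij} ↦ T_{j'i'} with q ↦ q⁻¹ reverses the order of the colours. The
nested construction starts from the first colour, so its invariance under this reflection,
`preBethe_flip`, needs proof. Stripping a parameter z off the first colour expresses the Bethe
vector by Bethe vectors of T(u)R(u,z); stripping it off the last colour, by Bethe vectors of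
R(z,u)T(u). The reflection interchanges these two expansions, and induction on the size of the last
set and on the number of colours concludes.

Independence of the enumeration (`preBethe_perm`): interchanging neighbouring parameters acts on two
sites by an R-matrix, and the same nonzero factor f appears in the vacuum and in the row product. -/

noncomputable section
namespace UqAffine

/-! ### Coefficients of the R-matrix and the Yang–Baxter equation. -/

section Basic

variable {H : Type*} [AddCommGroup H] [Module ℂ H]

/-- The coefficients of `R - 1`, where `R - 1 = ∑ W_{ij} E_{ij} ⊗ E_{ji}`. -/
def exchCoeff (q u v : ℂ) {m : ℕ} (i k : Fin m) : ℂ :=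
  if i = k then fRat q u v - 1 else if i < k then u * gRat q u v else v * gRat q u v

theorem exchCoeff_self (q u v : ℂ) {m : ℕ} (i : Fin m) :
    exchCoeff q u v i i = fRat q u v - 1 := by simp [exchCoeff]

theorem exchCoeff_of_lt (q u v : ℂ) {m : ℕ} {i k : Fin m} (h : i < k) :
    exchCoeff q u v i k = u * gRat q u v := by simp [exchCoeff, h, h.ne]

theorem exchCoeff_of_gt (q u v : ℂ) {m : ℕ} {i k : Fin m} (h : k < i) :
    exchCoeff q u v i k = v * gRat q u v := by simp [exchCoeff, h.ne', h.not_gt]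

theorem exchCoeff_succ (q u v : ℂ) {m : ℕ} (i k : Fin m) :
    exchCoeff q u v i.succ k.succ = exchCoeff q u v i k := by
  simp [exchCoeff]

theorem exchCoeff_castSucc (q u v : ℂ) {m : ℕ} (i k : Fin m) :
    exchCoeff q u v i.castSucc k.castSucc = exchCoeff q u v i k := by
  simp [exchCoeff]

theorem exchCoeff_zero_succ (q u v : ℂ) {m : ℕ} (k : Fin m) :
    exchCoeff q u v 0 k.succ = u * gRat q u v := by
  simp [exchCoeff, (Fin.succ_ne_zero k).symm]

theorem rCoeff_eq (q u v : ℂ) {m : ℕ} (i j k l : Fin m) :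
    rCoeff q u v i j k l = (if i = j then if k = l then 1 else 0 else 0) +
      (if i = l then if j = k then exchCoeff q u v i j else 0 else 0) := by
  unfold rCoeff exchCoeff
  by_cases h1 : i = j
  · subst h1
    by_cases h2 : k = l
    · subst h2
      by_cases h3 : i = k <;> simp [h3]
    · have : ¬ (i = l ∧ i = k) := fun h => h2 (h.2.symm.trans h.1)
      by_cases h3 : i = l
      · have h4 : ¬ i = k := fun h => this ⟨h3, h⟩
        simp [h2, h3 ▸ h4, h3]
      · simp [h2, h3]
  · simp only [h1, false_and, if_false, zero_add]
    by_cases h2 : i = l <;> by_cases h3 : j = k <;> simp only [h2, h3, and_self, and_true, and_false,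
      if_true, if_false]

theorem fRat_inv_swap (q u v : ℂ) : fRat q⁻¹ u v = fRat q v u := by
  unfold fRat
  rw [inv_inv, ← neg_sub v u, div_neg, ← neg_div]
  congr 1; ring

theorem gRat_inv_swap (q u v : ℂ) : gRat q⁻¹ u v = gRat q v u := by
  unfold gRat
  rw [inv_inv, ← neg_sub v u, div_neg, ← neg_div]
  congr 1; ring

/-- Replacing q by q⁻¹ interchanges the arguments of f and g, while reversing the basis interchanges
the two triangular halves of R. This is the scalar source of the symmetry `flip`. -/
theorem exchCoeff_inv_rev (q u v : ℂ) {m : ℕ} (i k : Fin m) :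
    exchCoeff q⁻¹ u v i.rev k.rev = exchCoeff q v u i k := by
  unfold exchCoeff
  simp only [Fin.rev_inj, Fin.rev_lt_rev, fRat_inv_swap, gRat_inv_swap]
  rcases lt_trichotomy i k with h | h | h
  · simp [h, h.ne, h.not_gt]
  · simp [h]
  · simp [h, h.ne', h.not_gt]

theorem fRat_eq_one_add (q u v : ℂ) {m : ℕ} (i : Fin m) :
    fRat q u v = 1 + exchCoeff q u v i i := by
  rw [exchCoeff_self]; ring

/-- The partial fraction identity behind the commutation of `T_{11}` with a row. -/
theorem exchCoeff_three_term (q : ℂ) {u a x : ℂ} (hau : a ≠ u) (hxu : x ≠ u) (hxa : x ≠ a)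
    {m : ℕ} (i k : Fin m) :
    x * gRat q x u * exchCoeff q a u i k - a * gRat q a u * (x * gRat q x a) =
      x * gRat q x u * exchCoeff q a x i k := by
  have h1 := sub_ne_zero.2 hau
  have h2 := sub_ne_zero.2 hxu
  have h3 := sub_ne_zero.2 hxa
  have h4 := sub_ne_zero.2 hxa.symm
  unfold exchCoeff gRat fRat
  generalize q⁻¹ = p
  split_ifs <;> field_simp <;> ring

/-- The Yang–Baxter equation, in components. -/
theorem yangBaxter_apply {q : ℂ} (hq : q ≠ 0) {u v w : ℂ} (huv : u ≠ v) (huw : u ≠ w) (hvw : v ≠ w) {m : ℕ}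
    (X : Fin m → Fin m → Fin m → H) (i j k : Fin m) :
    X i j k + exchCoeff q v w j k • X i k j
      + exchCoeff q u w i k • (X k j i + exchCoeff q v w j i • X k i j)
      + exchCoeff q u v i j • ((X j i k + exchCoeff q v w i k • X j k i)
        + exchCoeff q u w j k • (X k i j + exchCoeff q v w i j • X k j i)) =
    (X i j k + exchCoeff q u v i j • X j i k)
      + exchCoeff q u w i k • (X k j i + exchCoeff q u v k j • X j k i)
      + exchCoeff q v w j k • ((X i k j + exchCoeff q u v i k • X k i j)
        + exchCoeff q u w i j • (X j k i + exchCoeff q u v j k • X k j i)) := by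
  have h1 := sub_ne_zero.2 huv
  have h2 := sub_ne_zero.2 huw
  have h3 := sub_ne_zero.2 hvw
  -- The coefficients depend only on the relative order of i, j, k, so every order type leaves a
  -- rational identity in u, v, w.
  rcases lt_trichotomy i j with hij | hij | hij <;> rcases lt_trichotomy j k with hjk | hjk | hjk <;>
    rcases lt_trichotomy i k with hik | hik | hik <;> (try subst hij) <;> (try subst hjk) <;>
    (try subst hik) <;> (try (exfalso; omega)) <;>
    simp only [exchCoeff_self, exchCoeff_of_lt, exchCoeff_of_gt, *] <;>
    simp only [fRat, gRat] <;> match_scalars <;> field_simp <;> ring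

end Basic

/-! ### Tensor sites and the nested monodromy matrix. -/

section Sites

variable {H : Type*} [AddCommGroup H] [Module ℂ H] {k : ℕ}

/-- The splitting off of the first tensor factor. -/
def splitSite (r k : ℕ) (H : Type*) [AddCommGroup H] [Module ℂ H] :
    SiteSpace (r + 1) k H ≃ₗ[ℂ] (Fin k → SiteSpace r k H) where
  toFun Y b κ := Y (Fin.cons b κ)
  invFun y κ := y (κ 0) (fun p => κ p.succ)
  map_add' _ _ := rfl
  map_smul' _ _ := rfl
  left_inv Y := by
    funext κ
    exact congrArg Y (Fin.cons_self_tail κ)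
  right_inv y := by
    funext b κ
    simp

theorem splitSite_apply (r : ℕ) (Y : SiteSpace (r + 1) k H) (b : Fin k) (κ : Fin r → Fin k) :
    splitSite r k H Y b κ = Y (Fin.cons b κ) := rfl

/-- The monodromy matrix `T(u) R_{0,1}(u,a)`, acting in `H ⊗ ℂᵏ`. -/
def addSite (q : ℂ) (T : Fin k → Fin k → ℂ → Module.End ℂ H) (a : ℂ) (i j : Fin k) (u : ℂ) :
    Module.End ℂ (Fin k → H) :=
  LinearMap.pi fun s => T i j u ∘ₗ LinearMap.proj s +
    if s = j then ∑ c, exchCoeff q u a c j • (T i c u ∘ₗ LinearMap.proj c) else 0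

theorem addSite_apply (q : ℂ) (T : Fin k → Fin k → ℂ → Module.End ℂ H) (a : ℂ) (i j : Fin k)
    (u : ℂ) (y : Fin k → H) (s : Fin k) :
    addSite q T a i j u y s = T i j u (y s) +
      if s = j then ∑ c, exchCoeff q u a c j • T i c u (y c) else 0 := by
  simp only [addSite, LinearMap.pi_apply, LinearMap.add_apply]
  split_ifs <;> simp

/-- The lower right block of a monodromy matrix. -/
def lowerBlock (T : Fin (k + 1) → Fin (k + 1) → ℂ → Module.End ℂ H) (i j : Fin k) (u : ℂ) :
    Module.End ℂ H := T i.succ j.succ u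

/-- An operator acting on all but the first tensor factor. -/
def tailOp (r k : ℕ) (H : Type*) [AddCommGroup H] [Module ℂ H] :
    Module.End ℂ (SiteSpace r k H) →+* Module.End ℂ (SiteSpace (r + 1) k H) where
  toFun A := (splitSite r k H).symm.toLinearMap ∘ₗ
    LinearMap.pi (fun b => A ∘ₗ LinearMap.proj b) ∘ₗ (splitSite r k H).toLinearMap
  map_one' := by
    refine LinearMap.ext fun Y => ?_
    exact (splitSite r k H).symm_apply_apply Y
  map_mul' A B := by
    refine LinearMap.ext fun Y => ?_
    simp only [LinearMap.comp_apply, Module.End.mul_apply, LinearEquiv.coe_coe,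
      LinearEquiv.apply_symm_apply]
    rfl
  map_zero' := LinearMap.ext fun _ => rfl
  map_add' A B := LinearMap.ext fun _ => rfl

theorem splitSite_tailOp (r : ℕ) (A : Module.End ℂ (SiteSpace r k H)) (Y : SiteSpace (r + 1) k H)
    (b : Fin k) : splitSite r k H (tailOp r k H A Y) b = A (splitSite r k H Y b) := by
  change splitSite r k H ((splitSite r k H).symm _) b = _
  rw [LinearEquiv.apply_symm_apply]; rfl

theorem tailOp_liftOp (r : ℕ) (A : Module.End ℂ H) :
    tailOp r k H (liftOp r k A) = liftOp (r + 1) k A := by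
  refine LinearMap.ext fun Y => ?_
  apply (splitSite r k H).injective
  funext b
  rw [splitSite_tailOp]; rfl

theorem tailOp_siteOp (r : ℕ) (p : Fin r) (M : Matrix (Fin k) (Fin k) ℂ) :
    tailOp r k H (siteOp r k p M) = siteOp (r + 1) k p.succ M := by
  refine LinearMap.ext fun Y => ?_
  apply (splitSite r k H).injective
  funext b κ
  rw [splitSite_tailOp]
  simp [siteOp, splitSite_apply, Fin.cons_update]

theorem siteOp_zero_apply (r : ℕ) (M : Matrix (Fin k) (Fin k) ℂ) (Y : SiteSpace (r + 1) k H)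
    (s : Fin k) :
    splitSite r k H (siteOp (r + 1) k 0 M Y) s = ∑ b, M s b • splitSite r k H Y b := by
  funext κ
  simp [siteOp, splitSite_apply, Fin.update_cons_zero]

/-- Adding a parameter in front amounts to adding one site. -/
theorem splitSite_nestedMonodromy (q : ℂ) (T : Fin (k + 1) → Fin (k + 1) → ℂ → Module.End ℂ H)
    (a : ℂ) (t : List ℂ) (i j : Fin k) (u : ℂ) (Y : SiteSpace (a :: t).length k H) :
    splitSite t.length k H (nestedMonodromy q T (a :: t) i j u Y) =
      addSite q (nestedMonodromy q T t) a i j u (splitSite t.length k H Y) := by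
  -- The product of R-matrices is reversed, so the factor of the head parameter a is the rightmost
  -- one, and the remaining factors act on the tail sites only.
  have key : nestedMonodromy q T (a :: t) i j u =
      ∑ c, tailOp t.length k H (nestedMonodromy q T t i c u) *
        siteR (H := H) q (t.length + 1) k u a 0 c j := by
    unfold nestedMonodromy
    have h1 : (List.ofFn fun p : Fin (a :: t).length =>
        siteR (H := H) q (a :: t).length k u ((a :: t).get p) p).reverse.prod =
        (tailOp t.length k H).mapMatrix ((List.ofFn fun p : Fin t.length =>
          siteR (H := H) q t.length k u (t.get p) p).reverse.prod) *
          siteR (H := H) q (t.length + 1) k u a 0 := by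
      change (List.ofFn (n := t.length + 1) _).reverse.prod = _
      rw [List.ofFn_succ, List.reverse_cons, List.prod_append, List.prod_singleton]
      congr 1
      rw [map_list_prod, List.map_reverse, List.map_ofFn]
      congr 3
      funext p
      ext i j : 1
      simp only [Function.comp_apply, RingHom.mapMatrix_apply, Matrix.map_apply, siteR,
        Matrix.of_apply, tailOp_siteOp]
      rfl
    have h2 : (Matrix.of fun a' b' : Fin k =>
        liftOp (a :: t).length k (T a'.succ b'.succ u)) =
        (tailOp t.length k H).mapMatrix (Matrix.of fun a' b' : Fin k =>
          liftOp t.length k (T a'.succ b'.succ u)) := by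
      ext i j : 1
      simp only [RingHom.mapMatrix_apply, Matrix.map_apply, Matrix.of_apply, tailOp_liftOp]
      rfl
    rw [h1, h2, ← mul_assoc, ← map_mul]
    rfl
  rw [key]
  funext s
  have h3 : ∀ c, splitSite t.length k H ((tailOp t.length k H (nestedMonodromy q T t i c u) *
      siteR (H := H) q (t.length + 1) k u a 0 c j) Y) s =
      (if c = j then nestedMonodromy q T t i c u (splitSite t.length k H Y s) else 0) +
      if s = j then exchCoeff q u a c j • nestedMonodromy q T t i c u (splitSite t.length k H Y c)
        else 0 := by
    intro c
    simp only [Module.End.mul_apply, splitSite_tailOp, siteR, Matrix.of_apply, siteOp_zero_apply,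
      rCoeff_eq, add_smul, Finset.sum_add_distrib, map_add]
    congr 1
    · by_cases h : c = j <;> simp [h]
    · by_cases h : s = j
      · simp [h]
      · simp [h, Ne.symm h]
  rw [LinearMap.sum_apply, map_sum, Finset.sum_apply, Finset.sum_congr rfl fun c _ => h3 c,
    Finset.sum_add_distrib, addSite_apply]
  congr 1
  · simp
  · by_cases h : s = j <;> simp [h]

theorem nestedMonodromy_nil (q : ℂ) (T : Fin (k + 1) → Fin (k + 1) → ℂ → Module.End ℂ H)
    (i j : Fin k) (u : ℂ) (Y : SiteSpace ([] : List ℂ).length k H)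
    (κ : Fin ([] : List ℂ).length → Fin k) :
    nestedMonodromy q T [] i j u Y κ = T i.succ j.succ u (Y κ) := by
  simp [nestedMonodromy, liftOp]

/-- The operator `∑ T_{1,k_1}(t_1) ⋯ T_{1,k_r}(t_r) [·]_{k_1,…,k_r}`. -/
def rowProd (T : Fin (k + 1) → Fin (k + 1) → ℂ → Module.End ℂ H) (t : List ℂ) :
    SiteSpace t.length k H →ₗ[ℂ] H :=
  ∑ κ : Fin t.length → Fin k,
    (List.ofFn fun p => T 0 (κ p).succ (t.get p)).prod ∘ₗ LinearMap.proj κ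

theorem rowProd_nil (T : Fin (k + 1) → Fin (k + 1) → ℂ → Module.End ℂ H)
    (Y : SiteSpace ([] : List ℂ).length k H) (κ : Fin ([] : List ℂ).length → Fin k) :
    rowProd T [] Y = Y κ := by
  have : Unique (Fin ([] : List ℂ).length → Fin k) :=
    (inferInstance : Unique (Fin 0 → Fin k))
  simp only [rowProd, LinearMap.sum_apply, LinearMap.comp_apply, LinearMap.proj_apply]
  rw [Fintype.sum_unique, Subsingleton.elim κ default]
  simp

theorem rowProd_cons (T : Fin (k + 1) → Fin (k + 1) → ℂ → Module.End ℂ H) (a : ℂ) (t : List ℂ)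
    (Y : SiteSpace (a :: t).length k H) :
    rowProd T (a :: t) Y =
      ∑ l : Fin k, T 0 l.succ a (rowProd T t (splitSite t.length k H Y l)) := by
  simp only [rowProd, LinearMap.sum_apply, LinearMap.comp_apply, LinearMap.proj_apply, map_sum]
  rw [← Fintype.sum_prod_type']
  refine (Fintype.sum_equiv (Fin.consEquiv (fun _ : Fin (t.length + 1) => Fin k)) _ _ ?_).symm
  rintro ⟨l, κ⟩
  simp only [splitSite_apply]
  rw [show (List.ofFn fun p : Fin (a :: t).length => T 0 ((Fin.consEquiv
      (fun _ : Fin (t.length + 1) => Fin k)) (l, κ) p).succ ((a :: t).get p)) =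
      T 0 l.succ a :: List.ofFn fun p => T 0 (κ p).succ (t.get p) from List.ofFn_succ ..]
  simp only [List.prod_cons, Module.End.mul_apply]
  rfl

end Sites

/-- The Bethe vector without its normalization factor. -/
def preBethe (q : ℂ) : (N : ℕ) → {H : Type*} → [AddCommGroup H] → [Module ℂ H] →
    (Fin (N + 1) → Fin (N + 1) → ℂ → Module.End ℂ H) → H → (Fin N → List ℂ) → H
  | 0, _, _, _, _, vac, _ => vac
  | N + 1, _, _, _, T, vac, t =>
    rowProd T (t 0) (preBethe q N (nestedMonodromy q T (t 0))
      (nestedVacuum (t 0).length N vac) (fun ν => t ν.succ))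

end UqAffine
end

noncomputable section
namespace UqAffine

/-! ### The exchange relation and the operations that preserve it. -/

section RTT

variable {H : Type*} [AddCommGroup H] [Module ℂ H] {k : ℕ}

theorem sum_rCoeff_left (q u v : ℂ) (F : Fin k → Fin k → Module.End ℂ H) (i l : Fin k) :
    ∑ a, ∑ b, rCoeff q u v i a l b • F a b = F i l + exchCoeff q u v i l • F l i := by
  simp only [rCoeff_eq, add_smul, Finset.sum_add_distrib, ite_smul, zero_smul, one_smul]
  congr 1
  · simp
  · rw [Finset.sum_comm]
    simp

theorem sum_rCoeff_right (q u v : ℂ) (F : Fin k → Fin k → Module.End ℂ H) (j l : Fin k) :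
    ∑ a, ∑ b, rCoeff q u v a j b l • F a b = F j l + exchCoeff q u v l j • F l j := by
  simp only [rCoeff_eq, add_smul, Finset.sum_add_distrib, ite_smul, zero_smul, one_smul]
  congr 1
  · simp
  · simp

/-- The exchange relation for the entries of a monodromy matrix. -/
def Exchange (q : ℂ) (P : Set ℂ) (T : Fin k → Fin k → ℂ → Module.End ℂ H) : Prop :=
  ∀ u ∈ P, ∀ v ∈ P, u ≠ v → ∀ i j a b : Fin k,
    T i j u * T a b v + exchCoeff q u v i a • (T a j u * T i b v) =
      T a b v * T i j u + exchCoeff q u v b j • (T a j v * T i b u)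

/-- R is the identity plus terms E_{ij} ⊗ E_{ji}; on one side of the relation these interchange row
indices, on the other side column indices. -/
theorem rttRelation_iff_exchange (q : ℂ) (P : Set ℂ) (T : Fin k → Fin k → ℂ → Module.End ℂ H) :
    RTTRelation q P T ↔ Exchange q P T := by
  unfold RTTRelation Exchange
  simp only [sum_rCoeff_left q _ _ (fun a b => T a _ _ * T b _ _),
    sum_rCoeff_right q _ _ (fun a b => T _ b _ * T _ a _)]

theorem Exchange.mono {q : ℂ} {P Q : Set ℂ} {T : Fin k → Fin k → ℂ → Module.End ℂ H}
    (h : Exchange q P T) (hQ : Q ⊆ P) : Exchange q Q T :=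
  fun u hu v hv => h u (hQ hu) v (hQ hv)

theorem Exchange.apply {q : ℂ} {P : Set ℂ} {T : Fin k → Fin k → ℂ → Module.End ℂ H}
    (h : Exchange q P T) {u v : ℂ} (hu : u ∈ P) (hv : v ∈ P) (huv : u ≠ v) (i j a b : Fin k)
    (y : H) :
    T i j u (T a b v y) + exchCoeff q u v i a • T a j u (T i b v y) =
      T a b v (T i j u y) + exchCoeff q u v b j • T a j v (T i b u y) :=
  LinearMap.congr_fun (h u hu v hv huv i j a b) y

/-- The matrix `R_{0,1}(u,a)` in the auxiliary space, with entries acting in `H ⊗ ℂᵏ`. -/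
def siteEntry (H : Type*) [AddCommGroup H] [Module ℂ H] (q a u : ℂ) (i j : Fin k) :
    Module.End ℂ (Fin k → H) :=
  LinearMap.pi fun s => (if i = j then (LinearMap.proj s : (Fin k → H) →ₗ[ℂ] H) else 0) +
    if s = j then exchCoeff q u a i j • (LinearMap.proj i : (Fin k → H) →ₗ[ℂ] H) else 0

theorem siteEntry_apply (q a u : ℂ) (i j : Fin k) (y : Fin k → H) (s : Fin k) :
    siteEntry H q a u i j y s = (if i = j then y s else 0) +
      if s = j then exchCoeff q u a i j • y i else 0 := by
  simp only [siteEntry, LinearMap.pi_apply, LinearMap.add_apply]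
  split_ifs <;> simp

/-- An operator on `H` as an operator on `H ⊗ ℂᵏ`. -/
def headOp (k : ℕ) (A : Module.End ℂ H) : Module.End ℂ (Fin k → H) :=
  LinearMap.pi fun s => A ∘ₗ LinearMap.proj s

theorem headOp_apply (A : Module.End ℂ H) (y : Fin k → H) (s : Fin k) :
    headOp k A y s = A (y s) := rfl

theorem addSite_eq_sum (q : ℂ) (T : Fin k → Fin k → ℂ → Module.End ℂ H) (a : ℂ) (i j : Fin k)
    (u : ℂ) : addSite q T a i j u = ∑ c, headOp k (T i c u) * siteEntry H q a u c j := by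
  refine LinearMap.ext fun y => funext fun s => ?_
  simp only [LinearMap.sum_apply, Finset.sum_apply, Module.End.mul_apply, headOp_apply,
    siteEntry_apply, map_add, Finset.sum_add_distrib, addSite_apply]
  congr 1
  · simp [apply_ite]
  · by_cases h : s = j <;> simp [h]

theorem headOp_commute_siteEntry (q a u : ℂ) (A : Module.End ℂ H) (i j : Fin k) :
    Commute (headOp k A) (siteEntry H q a u i j) := by
  refine LinearMap.ext fun y => funext fun s => ?_
  simp only [Module.End.mul_apply, headOp_apply, siteEntry_apply, map_add]
  split_ifs <;> simp

/-- The R-matrix is itself a monodromy matrix: this is the Yang–Baxter equation with the third space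
read as the quantum space, evaluated on tensors supported at the column indices j and d. -/
theorem siteEntry_exchange {q : ℂ} (hq : q ≠ 0) {a u v : ℂ} (huv : u ≠ v) (hua : u ≠ a)
    (hva : v ≠ a) (i j c d : Fin k) :
    siteEntry H q a u i j * siteEntry H q a v c d +
        exchCoeff q u v i c • (siteEntry H q a u c j * siteEntry H q a v i d) =
      siteEntry H q a v c d * siteEntry H q a u i j +
        exchCoeff q u v d j • (siteEntry H q a v c j * siteEntry H q a u i d) := by
  refine LinearMap.ext fun y => funext fun s => ?_
  have h := yangBaxter_apply (H := H) hq huv hua hva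
    (fun p r t => if p = j then if r = d then y t else 0 else 0) i c s
  have e1 : ∀ i c, (siteEntry H q a u i j * siteEntry H q a v c d) y s =
      ((if i = j then if c = d then y s else 0 else 0) +
        exchCoeff q v a c s • if i = j then if s = d then y c else 0 else 0) +
      exchCoeff q u a i s • ((if s = j then if c = d then y i else 0 else 0) +
        exchCoeff q v a c i • if s = j then if i = d then y c else 0 else 0) := by
    intro i c
    simp only [Module.End.mul_apply, siteEntry_apply]
    by_cases h1 : i = j <;> by_cases h2 : s = j <;> by_cases h3 : s = d <;> by_cases h4 : i = d <;>
      simp_all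
  have e2 : ∀ j d, (siteEntry H q a v c d * siteEntry H q a u i j) y s =
      ((if i = j then if c = d then y s else 0 else 0) +
        exchCoeff q u a i s • if s = j then if c = d then y i else 0 else 0) +
      exchCoeff q v a c s • ((if i = j then if s = d then y c else 0 else 0) +
        exchCoeff q u a i c • if c = j then if s = d then y i else 0 else 0) := by
    intro j d
    simp only [Module.End.mul_apply, siteEntry_apply]
    by_cases h1 : c = d <;> by_cases h2 : s = j <;> by_cases h3 : s = d <;> by_cases h4 : c = j <;>
      simp_all
  simp only [LinearMap.add_apply, LinearMap.smul_apply, Pi.add_apply, Pi.smul_apply, e1, e2]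
  have e3 : ∀ p r t, exchCoeff q u v p r • (if r = j then if p = d then y t else 0 else 0) =
      exchCoeff q u v d j • (if p = d then if r = j then y t else 0 else 0) := by
    intro p r t
    by_cases h1 : r = j <;> by_cases h2 : p = d <;> simp [h1, h2]
  simp only [e3] at h
  linear_combination (norm := module) h

/-- The coproduct property: a product of two monodromy matrices whose entries commute with each
other is a monodromy matrix. Only the shape of the relation matters, so the coefficients W are
arbitrary. -/
theorem exchange_mul {A : Type*} [Ring A] [Algebra ℂ A] (W : Fin k → Fin k → ℂ)
    (t₁ t₂ r₁ r₂ : Fin k → Fin k → A)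
    (ht : ∀ i j a b, t₁ i j * t₂ a b + W i a • (t₁ a j * t₂ i b) =
      t₂ a b * t₁ i j + W b j • (t₂ a j * t₁ i b))
    (hr : ∀ i j a b, r₁ i j * r₂ a b + W i a • (r₁ a j * r₂ i b) =
      r₂ a b * r₁ i j + W b j • (r₂ a j * r₁ i b))
    (h₁ : ∀ i j a b, Commute (t₂ i j) (r₁ a b)) (h₂ : ∀ i j a b, Commute (t₁ i j) (r₂ a b))
    (i j a b : Fin k) :
    (∑ c, t₁ i c * r₁ c j) * (∑ d, t₂ a d * r₂ d b) +
        W i a • ((∑ c, t₁ a c * r₁ c j) * (∑ d, t₂ i d * r₂ d b)) =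
      (∑ d, t₂ a d * r₂ d b) * (∑ c, t₁ i c * r₁ c j) +
        W b j • ((∑ d, t₂ a d * r₂ d j) * (∑ c, t₁ i c * r₁ c b)) := by
  have e₁ : ∀ i j a b, (∑ c, t₁ i c * r₁ c j) * (∑ d, t₂ a d * r₂ d b) =
      ∑ c, ∑ d, (t₁ i c * t₂ a d) * (r₁ c j * r₂ d b) := by
    intro i j a b
    rw [Finset.sum_mul_sum]
    refine Finset.sum_congr rfl fun c _ => Finset.sum_congr rfl fun d _ => ?_
    rw [mul_assoc, ← mul_assoc (r₁ c j), ← (h₁ a d c j).eq]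
    simp only [mul_assoc]
  have e₂ : ∀ i j a b, (∑ d, t₂ a d * r₂ d b) * (∑ c, t₁ i c * r₁ c j) =
      ∑ c, ∑ d, (t₂ a d * t₁ i c) * (r₂ d b * r₁ c j) := by
    intro i j a b
    rw [Finset.sum_mul_sum, Finset.sum_comm]
    refine Finset.sum_congr rfl fun c _ => Finset.sum_congr rfl fun d _ => ?_
    rw [mul_assoc, ← mul_assoc (r₂ d b), ← (h₂ i c d b).eq]
    simp only [mul_assoc]
  rw [e₁, e₁, e₂, e₂]
  have e₀ : ∀ c d, (t₁ i c * t₂ a d) * (r₁ c j * r₂ d b) +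
      W i a • ((t₁ a c * t₂ i d) * (r₁ c j * r₂ d b)) =
      (t₂ a d * t₁ i c) * (r₁ c j * r₂ d b) +
        W d c • ((t₂ a c * t₁ i d) * (r₁ c j * r₂ d b)) := by
    intro c d
    rw [← smul_mul_assoc, ← add_mul, ht, add_mul, smul_mul_assoc]
  -- Renaming the summation indices moves the exchange term produced by `ht` onto the second
  -- factors, where it is the exchange term consumed by `hr`.
  have e₃ : ∑ c, ∑ d, W d c • ((t₂ a c * t₁ i d) * (r₁ c j * r₂ d b)) =
      ∑ c, ∑ d, (t₂ a d * t₁ i c) * (W c d • (r₁ d j * r₂ c b)) := by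
    rw [Finset.sum_comm]
    simp only [mul_smul_comm]
  have e₄ : ∀ c d, (t₂ a d * t₁ i c) * (r₂ d b * r₁ c j) +
      W b j • ((t₂ a d * t₁ i c) * (r₂ d j * r₁ c b)) =
      (t₂ a d * t₁ i c) * (r₁ c j * r₂ d b) + (t₂ a d * t₁ i c) * (W c d • (r₁ d j * r₂ c b)) := by
    intro c d
    rw [← mul_smul_comm, ← mul_add, ← mul_add, hr]
  simp only [Finset.smul_sum, ← Finset.sum_add_distrib, e₀, e₄]
  simp only [Finset.sum_add_distrib, e₃]

/-- The point a leaves the set P because R(u,a) has its pole there. -/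
theorem Exchange.addSite {q : ℂ} (hq : q ≠ 0) {P : Set ℂ}
    {T : Fin k → Fin k → ℂ → Module.End ℂ H} (h : Exchange q P T) (a : ℂ) :
    Exchange q (P \ {a}) (addSite q T a) := by
  intro u hu v hv huv i j c d
  simp only [addSite_eq_sum]
  refine exchange_mul (exchCoeff q u v) (fun i j => headOp k (T i j u))
    (fun i j => headOp k (T i j v)) (siteEntry H q a u) (siteEntry H q a v) ?_ (siteEntry_exchange hq huv hu.2 hv.2)
    (fun _ _ _ _ => headOp_commute_siteEntry ..) (fun _ _ _ _ => headOp_commute_siteEntry ..) i j c d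
  intro i j a b
  exact LinearMap.ext fun y => funext fun s => h.apply hu.1 hv.1 huv i j a b (y s)

theorem Exchange.lowerBlock {q : ℂ} {P : Set ℂ}
    {T : Fin (k + 1) → Fin (k + 1) → ℂ → Module.End ℂ H} (h : Exchange q P T) :
    Exchange q P (lowerBlock T) := by
  intro u hu v hv huv i j a b
  have := h u hu v hv huv i.succ j.succ a.succ b.succ
  simpa only [exchCoeff_succ, UqAffine.lowerBlock] using this

/-- Transport of the exchange relation along injective intertwiners. -/
theorem Exchange.of_injective {H' : Type*} [AddCommGroup H'] [Module ℂ H'] {q : ℂ} {P : Set ℂ}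
    {T : Fin k → Fin k → ℂ → Module.End ℂ H} {T' : Fin k → Fin k → ℂ → Module.End ℂ H'}
    (φ : H →ₗ[ℂ] H') (hφ : Function.Injective φ)
    (hT : ∀ i j u y, φ (T i j u y) = T' i j u (φ y)) (h : Exchange q P T') : Exchange q P T := by
  intro u hu v hv huv i j a b
  refine LinearMap.ext fun y => hφ ?_
  have := h.apply hu hv huv i j a b (φ y)
  simpa only [LinearMap.add_apply, LinearMap.smul_apply, Module.End.mul_apply, map_add, map_smul,
    hT] using this

theorem Exchange.nestedMonodromy {q : ℂ} (hq : q ≠ 0) {P : Set ℂ}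
    {T : Fin (k + 1) → Fin (k + 1) → ℂ → Module.End ℂ H} (h : Exchange q P T) (t : List ℂ) :
    Exchange q (P \ {x | x ∈ t}) (nestedMonodromy q T t) := by
  induction t with
  | nil =>
    refine Exchange.of_injective (T' := UqAffine.lowerBlock T) (P := _)
      (LinearMap.proj (Fin.elim0 : Fin 0 → Fin k)) ?_ ?_ (h.lowerBlock.mono Set.sdiff_subset)
    · intro Y Y' hY
      funext κ
      rw [show κ = (Fin.elim0 : Fin 0 → Fin k) from funext fun p => p.elim0]
      exact hY
    · intro i j u y
      exact nestedMonodromy_nil ..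
  | cons a t ih =>
    refine Exchange.of_injective (splitSite t.length k H).toLinearMap
      (splitSite t.length k H).injective
      (fun i j u Y => splitSite_nestedMonodromy q T a t i j u Y) ((ih.addSite hq a).mono ?_)
    intro x hx
    simp only [Set.mem_sdiff, Set.mem_ofPred_eq, List.mem_cons, not_or, Set.mem_singleton_iff] at hx ⊢
    tauto

/-- The reflection `T_{ij} ↦ T_{j'i'}` with `i' = N + 2 - i`. -/
def flip (T : Fin k → Fin k → ℂ → Module.End ℂ H) (i j : Fin k) (u : ℂ) : Module.End ℂ H :=
  T j.rev i.rev u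

theorem flip_flip (T : Fin k → Fin k → ℂ → Module.End ℂ H) : flip (flip T) = T := by
  funext i j u
  simp [flip]

/-- The relation at (v,u) with reversed, transposed indices has the two sides of the required
relation interchanged. The order of the operators is kept, so both matrices act on the same space.
-/
theorem Exchange.flip {q : ℂ} {P : Set ℂ} {T : Fin k → Fin k → ℂ → Module.End ℂ H}
    (h : Exchange q P T) : Exchange q⁻¹ P (flip T) := by
  intro u hu v hv huv i j a b
  have := h v hv u hu huv.symm b.rev a.rev j.rev i.rev
  rw [← exchCoeff_inv_rev q u v b.rev, ← exchCoeff_inv_rev q u v i.rev, Fin.rev_rev, Fin.rev_rev,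
    Fin.rev_rev, Fin.rev_rev] at this
  exact this.symm

end RTT

/-! ### Nested entries as scalar combinations of the original entries. -/

section Coefficients

variable {k : ℕ}

/-- The entries of `R_{0,r}(u,t_r) ⋯ R_{0,1}(u,t_1)`. -/
def siteCoeff (q u : ℂ) : (t : List ℂ) → Fin k → Fin k → (Fin t.length → Fin k) →
    (Fin t.length → Fin k) → ℂ
  | [], c, j, _, _ => if c = j then 1 else 0
  | a :: t, c, j, κ, κ' =>
    (if κ 0 = κ' 0 then siteCoeff q u t c j (fun p => κ p.succ) (fun p => κ' p.succ) else 0) +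
      if κ 0 = j then exchCoeff q u a (κ' 0) j *
        siteCoeff q u t c (κ' 0) (fun p => κ p.succ) (fun p => κ' p.succ) else 0

/-- Whatever is stable under linear combinations, such as invariant subspaces and intertwining maps,
passes componentwise from the entries of T to those of the nested matrix. The actual value of the
coefficients is irrelevant for this. -/
theorem nestedMonodromy_apply {H : Type*} [AddCommGroup H] [Module ℂ H] (q : ℂ)
    (T : Fin (k + 1) → Fin (k + 1) → ℂ → Module.End ℂ H) (t : List ℂ) (i j : Fin k) (u : ℂ)
    (Y : SiteSpace t.length k H) (κ : Fin t.length → Fin k) :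
    nestedMonodromy q T t i j u Y κ =
      ∑ c, ∑ κ', siteCoeff q u t c j κ κ' • T i.succ c.succ u (Y κ') := by
  induction t generalizing j with
  | nil =>
    have : Unique (Fin ([] : List ℂ).length → Fin k) :=
      (inferInstance : Unique (Fin 0 → Fin k))
    rw [nestedMonodromy_nil, Subsingleton.elim κ default]
    simp [siteCoeff]
  | cons a t ih =>
    have hκ : κ = Fin.cons (κ 0) (fun p : Fin t.length => κ p.succ) := (Fin.cons_self_tail κ).symm
    have h1 : ∀ F : (Fin (t.length + 1) → Fin k) → H, ∑ κ', F κ' =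
        ∑ l : Fin k, ∑ κ' : Fin t.length → Fin k, F (Fin.cons l κ') := by
      intro F
      rw [← Fintype.sum_prod_type']
      exact (Fintype.sum_equiv (Fin.consEquiv (fun _ : Fin (t.length + 1) => Fin k)) _ _
        fun _ => rfl).symm
    conv_lhs => rw [hκ]
    change splitSite t.length k H (nestedMonodromy q T (a :: t) i j u Y) (κ 0)
      (fun p => κ p.succ) = _
    rw [splitSite_nestedMonodromy, addSite_apply]
    simp only [Pi.add_apply, ih]
    simp only [siteCoeff, add_smul, Finset.sum_add_distrib]
    congr 1
    · refine Finset.sum_congr rfl fun c _ => ?_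
      refine Eq.trans ?_ (h1 _).symm
      simp [splitSite_apply, ite_smul]
    · by_cases h : κ 0 = j
      · simp only [h, if_true, Finset.sum_apply, Pi.smul_apply, ih, Finset.smul_sum, smul_smul]
        rw [Finset.sum_comm]
        refine Finset.sum_congr rfl fun c _ => ?_
        refine Eq.trans ?_ (h1 _).symm
        simp [splitSite_apply]
      · simp [h]

end Coefficients

end UqAffine
end

noncomputable section
namespace UqAffine

/-! ### Functoriality of Bethe vectors. -/

section Intertwiners

/-- The lists `t ν` have no common and no repeated members, and all members are in `P`. -/
def Separated (P : Set ℂ) {N : ℕ} (t : Fin N → List ℂ) : Prop :=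
  (∀ ν, ∀ x ∈ t ν, x ∈ P) ∧ (∀ ν, (t ν).Nodup) ∧ ∀ ν μ, ν ≠ μ → ∀ x ∈ t ν, x ∉ t μ

theorem Separated.tail {P : Set ℂ} {N : ℕ} {t : Fin (N + 1) → List ℂ} (h : Separated P t) :
    Separated (P \ {x | x ∈ t 0}) (fun ν : Fin N => t ν.succ) :=
  ⟨fun ν x hx => ⟨h.1 _ x hx, h.2.2 ν.succ 0 (Fin.succ_ne_zero ν) x hx⟩, fun _ => h.2.1 _,
    fun _ _ hνμ => h.2.2 _ _ (fun e => hνμ (Fin.succ_inj.1 e))⟩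

theorem Separated.mono {P Q : Set ℂ} {N : ℕ} {t : Fin N → List ℂ} (h : Separated P t)
    (hQ : ∀ ν, ∀ x ∈ t ν, x ∈ Q) : Separated Q t := ⟨hQ, h.2⟩

variable {H : Type*} [AddCommGroup H] [Module ℂ H] {H' : Type*} [AddCommGroup H'] [Module ℂ H']

/-- A linear map acting componentwise on site spaces. -/
def siteMap (r k : ℕ) (φ : H →ₗ[ℂ] H') : SiteSpace r k H →ₗ[ℂ] SiteSpace r k H' :=
  LinearMap.pi fun κ => φ ∘ₗ LinearMap.proj κ

theorem siteMap_apply (r k : ℕ) (φ : H →ₗ[ℂ] H') (Y : SiteSpace r k H) (κ : Fin r → Fin k) :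
    siteMap r k φ Y κ = φ (Y κ) := rfl

theorem siteMap_nestedVacuum (r k : ℕ) (φ : H →ₗ[ℂ] H') (v : H) :
    siteMap r (k + 1) φ (nestedVacuum r k v) = nestedVacuum r k (φ v) := by
  funext κ
  rw [siteMap_apply]
  unfold nestedVacuum
  by_cases h : κ = fun _ => 0
  · subst h; simp
  · simp [h]

/-- The index A of the filtration V is the set of points at which a condition is still in reserve.
Applying an entry at w uses up the point w, so the reserve shrinks as the operators of the row act.
-/
theorem rowProd_intertwine {k : ℕ} {P : Set ℂ} {T : Fin (k + 1) → Fin (k + 1) → ℂ → Module.End ℂ H}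
    {T' : Fin (k + 1) → Fin (k + 1) → ℂ → Module.End ℂ H'} (φ : H →ₗ[ℂ] H')
    (V : Set ℂ → Submodule ℂ H)
    (h₁ : ∀ w ∈ P, ∀ A, w ∉ A → ∀ i j, ∀ y ∈ V (insert w A), T i j w y ∈ V A)
    (h₂ : ∀ w ∈ P, ∀ A, w ∉ A → ∀ i j, ∀ y ∈ V (insert w A), φ (T i j w y) = T' i j w (φ y))
    (t : List ℂ) (htP : ∀ x ∈ t, x ∈ P) (ht : t.Nodup) (A : Set ℂ) (hA : ∀ x ∈ t, x ∉ A)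
    (Y : SiteSpace t.length k H) (hY : ∀ κ, Y κ ∈ V ({x | x ∈ t} ∪ A)) :
    rowProd T t Y ∈ V A ∧ φ (rowProd T t Y) = rowProd T' t (siteMap t.length k φ Y) := by
  induction t generalizing A with
  | nil =>
    rw [rowProd_nil T Y Fin.elim0, rowProd_nil T' _ Fin.elim0, siteMap_apply]
    exact ⟨by simpa using hY Fin.elim0, rfl⟩
  | cons a t ih =>
    simp only [List.mem_cons, forall_eq_or_imp, List.nodup_cons] at htP ht hA
    have hset : ({x | x ∈ a :: t} ∪ A : Set ℂ) = {x | x ∈ t} ∪ insert a A := by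
      ext x; simp; tauto
    rw [hset] at hY
    have ih' := fun l => ih htP.2 ht.2 (insert a A)
      (fun x hx h => h.elim (fun h => ht.1 (h ▸ hx)) (hA.2 x hx))
      (splitSite t.length k H Y l) (fun κ => hY _)
    rw [rowProd_cons, rowProd_cons, map_sum]
    refine ⟨Submodule.sum_mem _ fun l _ => h₁ a htP.1 A hA.1 _ _ _ (ih' l).1,
      Finset.sum_congr rfl fun l _ => ?_⟩
    rw [h₂ a htP.1 A hA.1 _ _ _ (ih' l).1, (ih' l).2]
    rfl

/-- A Bethe vector is obtained from the vacuum by entries of T alone, each at a different parameter.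
A map that commutes with the entries only on the filtration V, and not on all of H, therefore still
carries Bethe vectors to Bethe vectors. -/
theorem preBethe_intertwine (q : ℂ) {N : ℕ} {P : Set ℂ}
    {T : Fin (N + 1) → Fin (N + 1) → ℂ → Module.End ℂ H}
    {T' : Fin (N + 1) → Fin (N + 1) → ℂ → Module.End ℂ H'} (φ : H →ₗ[ℂ] H')
    (V : Set ℂ → Submodule ℂ H)
    (h₁ : ∀ w ∈ P, ∀ A, w ∉ A → ∀ i j, ∀ y ∈ V (insert w A), T i j w y ∈ V A)
    (h₂ : ∀ w ∈ P, ∀ A, w ∉ A → ∀ i j, ∀ y ∈ V (insert w A), φ (T i j w y) = T' i j w (φ y))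
    {t : Fin N → List ℂ} (ht : Separated P t) (A : Set ℂ) (hA : ∀ ν, ∀ x ∈ t ν, x ∉ A) (v : H)
    (hv : v ∈ V ({x | ∃ ν, x ∈ t ν} ∪ A)) :
    preBethe q N T v t ∈ V A ∧ φ (preBethe q N T v t) = preBethe q N T' (φ v) t := by
  induction N generalizing H H' P A with
  | zero => exact ⟨by simpa [preBethe] using hv, rfl⟩
  | succ N ih =>
    have hset : ({x | ∃ ν, x ∈ t ν} ∪ A : Set ℂ) =
        {x | ∃ ν : Fin N, x ∈ t ν.succ} ∪ ({x | x ∈ t 0} ∪ A) := by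
      ext x
      simp only [Set.mem_union, Set.mem_ofPred_eq, Fin.exists_fin_succ]
      tauto
    rw [hset] at hv
    obtain ⟨hm, he⟩ := ih (P := P \ {x | x ∈ t 0})
      (T := nestedMonodromy q T (t 0)) (T' := nestedMonodromy q T' (t 0))
      (siteMap (t 0).length (N + 1) φ)
      (fun A => { carrier := {Y | ∀ κ, Y κ ∈ V A}
                  add_mem' := fun h h' κ => (V A).add_mem (h κ) (h' κ)
                  zero_mem' := fun κ => (V A).zero_mem
                  smul_mem' := fun c _ h κ => (V A).smul_mem c (h κ) })
      (fun w hw A hA i j y hy κ => by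
        rw [nestedMonodromy_apply]
        exact Submodule.sum_mem _ fun c _ => Submodule.sum_mem _ fun κ' _ =>
          Submodule.smul_mem _ _ (h₁ w hw.1 A hA _ _ _ (hy κ')))
      (fun w hw A hA i j y hy => by
        funext κ
        rw [siteMap_apply, nestedMonodromy_apply, nestedMonodromy_apply]
        simp only [map_sum, map_smul, siteMap_apply]
        exact Finset.sum_congr rfl fun c _ => Finset.sum_congr rfl fun κ' _ => by
          rw [h₂ w hw.1 A hA _ _ _ (hy κ')])
      -- The nested stage acts first on the vacuum, so it must keep the first-colour points in
      -- reserve for the row product that follows.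
      ht.tail ({x | x ∈ t 0} ∪ A)
      (fun ν x hx h => h.elim (ht.2.2 _ _ (Fin.succ_ne_zero ν) x hx) (hA _ x hx))
      (nestedVacuum (t 0).length N v)
      (by
        intro κ
        unfold nestedVacuum
        by_cases h : κ = fun _ => 0
        · subst h; simpa using hv
        · simp [h])
    have := rowProd_intertwine φ V h₁ h₂ (t 0) (ht.1 0) (ht.2.1 0) A (hA 0) _ hm
    refine ⟨this.1, this.2.trans ?_⟩
    rw [he, siteMap_nestedVacuum]
    rfl

theorem preBethe_map (q : ℂ) {N : ℕ} {P : Set ℂ}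
    {T : Fin (N + 1) → Fin (N + 1) → ℂ → Module.End ℂ H}
    {T' : Fin (N + 1) → Fin (N + 1) → ℂ → Module.End ℂ H'} (φ : H →ₗ[ℂ] H')
    (h : ∀ w ∈ P, ∀ i j y, φ (T i j w y) = T' i j w (φ y))
    {t : Fin N → List ℂ} (ht : Separated P t) (v : H) :
    φ (preBethe q N T v t) = preBethe q N T' (φ v) t :=
  (preBethe_intertwine q (P := P) φ (fun _ => ⊤) (by simp) (fun w hw _ _ i j y _ => h w hw i j y) ht
    ∅ (by simp) v (by simp)).2

theorem preBethe_smul (q : ℂ) {N : ℕ} (T : Fin (N + 1) → Fin (N + 1) → ℂ → Module.End ℂ H)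
    {P : Set ℂ} {t : Fin N → List ℂ} (ht : Separated P t) (c : ℂ) (v : H) :
    preBethe q N T (c • v) t = c • preBethe q N T v t :=
  (preBethe_map q (T := T) (T' := T) (c • LinearMap.id) (fun w _ i j y => by simp) ht v).symm

end Intertwiners

/-! ### Pseudovacua of nested chains. -/

section Vacuum

variable {H : Type*} [AddCommGroup H] [Module ℂ H]

/-- `v` is a pseudovacuum with eigenvalues `lam`. -/
def IsVacuum (P : Set ℂ) {m : ℕ} (T : Fin m → Fin m → ℂ → Module.End ℂ H) (lam : Fin m → ℂ → ℂ)
    (v : H) : Prop :=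
  ∀ u ∈ P, (∀ i, T i i u v = lam i u • v) ∧ ∀ i j, j < i → T i j u v = 0

theorem IsVacuum.mono {P Q : Set ℂ} {m : ℕ} {T : Fin m → Fin m → ℂ → Module.End ℂ H}
    {lam : Fin m → ℂ → ℂ} {v : H} (h : IsVacuum P T lam v) (hQ : Q ⊆ P) : IsVacuum Q T lam v :=
  fun u hu => h u (hQ hu)

theorem IsVacuum.flip {P : Set ℂ} {m : ℕ} {T : Fin m → Fin m → ℂ → Module.End ℂ H}
    {lam : Fin m → ℂ → ℂ} {v : H} (h : IsVacuum P T lam v) :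
    IsVacuum P (flip T) (fun i => lam i.rev) v :=
  fun u hu => ⟨fun _ => (h u hu).1 _, fun _ _ hij => (h u hu).2 _ _ (Fin.rev_lt_rev.2 hij)⟩

theorem splitSite_nestedVacuum (r k : ℕ) (v : H) :
    splitSite r (k + 1) H (nestedVacuum (r + 1) k v) =
      (Pi.single 0 (nestedVacuum r k v) : Fin (k + 1) → SiteSpace r (k + 1) H) := by
  funext b κ
  rw [splitSite_apply]
  unfold nestedVacuum
  have h0 : (fun _ : Fin (r + 1) => (0 : Fin (k + 1))) = Fin.cons 0 (fun _ => 0) := by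
    funext p; refine Fin.cases ?_ (fun _ => ?_) p <;> rfl
  rw [h0]
  by_cases hb : b = 0
  · subst hb
    by_cases h : κ = fun _ => 0
    · subst h; simp
    · have : (Fin.cons (0 : Fin (k + 1)) κ : Fin (r + 1) → Fin (k + 1)) ≠ Fin.cons 0 (fun _ => 0) :=
        fun e => h (Fin.cons_right_injective (α := fun _ => Fin (k + 1)) _ e)
      simp [h, this]
  · have : (Fin.cons b κ : Fin (r + 1) → Fin (k + 1)) ≠ Fin.cons 0 (fun _ => 0) :=
      fun e => hb (by simpa using congrFun e 0)
    simp [hb, this]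

/-- On the first basis vector of the site, the exchange part of R leads to entries of the first
column of T. Of these only T_{00} survives on v, which multiplies the first eigenvalue by f(u,a) and
leaves the others unchanged. -/
theorem IsVacuum.addSite (q : ℂ) {P : Set ℂ} {m : ℕ}
    {T : Fin (m + 1) → Fin (m + 1) → ℂ → Module.End ℂ H} {lam : Fin (m + 1) → ℂ → ℂ} {v : H}
    (h : IsVacuum P T lam v) (a : ℂ) :
    IsVacuum P (addSite q T a) (fun i u => if i.val = 0 then lam i u * fRat q u a else lam i u)
      (Pi.single 0 v) := by
  intro u hu
  obtain ⟨h₁, h₂⟩ := h u hu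
  have key : ∀ i j s, UqAffine.addSite q T a i j u (Pi.single 0 v) s =
      (if s = 0 then T i j u v else 0) +
        if s = j then exchCoeff q u a 0 j • T i 0 u v else 0 := by
    intro i j s
    rw [addSite_apply, Finset.sum_eq_single 0 (fun c _ hc => by simp [hc]) (by simp)]
    congr 1
    · by_cases hs : s = 0
      · subst hs; simp
      · simp [hs]
  constructor
  · intro i
    funext s
    rw [key, Pi.smul_apply, h₁]
    by_cases hi : i = 0
    · subst hi
      by_cases hs : s = 0
      · subst hs
        simp [h₁, exchCoeff_self]
        module
      · simp [hs]
    · rw [h₂ i 0 (Fin.pos_of_ne_zero hi)]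
      by_cases hs : s = 0
      · subst hs; simp [hi]
      · simp [hs]
  · intro i j hij
    funext s
    rw [key, h₂ i j hij, h₂ i 0 ((Fin.zero_le j).trans_lt hij)]
    simp

theorem fProd_singleton_cons (q u a : ℂ) (t : List ℂ) :
    fProd q [u] (a :: t) = fRat q u a * fProd q [u] t := by simp [fProd]

theorem IsVacuum.nestedMonodromy (q : ℂ) {P : Set ℂ} {k : ℕ}
    {T : Fin (k + 2) → Fin (k + 2) → ℂ → Module.End ℂ H} {lam : Fin (k + 2) → ℂ → ℂ} {v : H}
    (h : IsVacuum P T lam v) (t : List ℂ) :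
    IsVacuum P (nestedMonodromy q T t) (nestedEigenvalue q lam t)
      (nestedVacuum t.length k v) := by
  induction t with
  | nil =>
    intro u hu
    have h0 : ∀ κ : Fin ([] : List ℂ).length → Fin (k + 1), nestedVacuum (H := H) 0 k v κ = v := by
      intro κ
      have : κ = fun _ => 0 := funext fun p => p.elim0
      subst this
      simp [nestedVacuum]
    constructor
    · intro i
      funext κ
      rw [nestedMonodromy_nil, Pi.smul_apply]
      erw [h0 κ]
      rw [(h u hu).1]
      simp [nestedEigenvalue, fProd]
    · intro i j hij
      funext κ
      rw [nestedMonodromy_nil]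
      erw [h0 κ]
      rw [(h u hu).2 _ _ (Fin.succ_lt_succ_iff.2 hij)]
      rfl
  | cons a t ih =>
    intro u hu
    obtain ⟨h₁, h₂⟩ := (ih.addSite q a) u hu
    constructor
    · intro i
      apply (splitSite t.length (k + 1) H).injective
      erw [splitSite_nestedMonodromy, map_smul, splitSite_nestedVacuum, h₁ i]
      congr 1
      unfold nestedEigenvalue
      rw [fProd_singleton_cons]
      by_cases h0 : i.val = 0
      · simp only [h0, if_true]; ring
      · simp only [h0, if_false]
    · intro i j hij
      apply (splitSite t.length (k + 1) H).injective
      erw [splitSite_nestedMonodromy, splitSite_nestedVacuum, h₂ i j hij]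
      rw [map_zero]

/-- The vectors on which the first column of `T(u)` acts as on the pseudovacuum, for `u ∈ A`. -/
def vacSpace (P : Set ℂ) {k : ℕ} (T : Fin (k + 1) → Fin (k + 1) → ℂ → Module.End ℂ H)
    (lam : Fin (k + 1) → ℂ → ℂ) (A : Set ℂ) : Submodule ℂ H where
  carrier := {y | ∀ u ∈ A, u ∈ P → T 0 0 u y = lam 0 u • y ∧ ∀ a : Fin k, T a.succ 0 u y = 0}
  add_mem' h h' u hu huP := ⟨by rw [map_add, (h u hu huP).1, (h' u hu huP).1, smul_add],
    fun a => by rw [map_add, (h u hu huP).2, (h' u hu huP).2, add_zero]⟩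
  zero_mem' u _ _ := ⟨by simp, by simp⟩
  smul_mem' c y h u hu huP := ⟨by rw [map_smul, (h u hu huP).1, smul_comm],
    fun a => by rw [map_smul, (h u hu huP).2, smul_zero]⟩

theorem IsVacuum.mem_vacSpace {P : Set ℂ} {k : ℕ}
    {T : Fin (k + 1) → Fin (k + 1) → ℂ → Module.End ℂ H} {lam : Fin (k + 1) → ℂ → ℂ} {v : H}
    (h : IsVacuum P T lam v) (A : Set ℂ) : v ∈ vacSpace P T lam A :=
  fun u _ hu => ⟨(h u hu).1 0, fun a => (h u hu).2 _ _ (Fin.succ_pos a)⟩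

/-- In the exchange relation between an entry of the lower block at w and an entry of the first
column at u, both exchange terms end with a first-column entry below the diagonal, at u or at w,
applied to y. This is why y has to satisfy the condition at w too. -/
theorem Exchange.mem_vacSpace {q : ℂ} {P : Set ℂ} {k : ℕ}
    {T : Fin (k + 1) → Fin (k + 1) → ℂ → Module.End ℂ H} (hT : Exchange q P T)
    (lam : Fin (k + 1) → ℂ → ℂ) {w : ℂ} (hw : w ∈ P) {A : Set ℂ} (hA : w ∉ A) (i j : Fin k) {y : H}
    (hy : y ∈ vacSpace P T lam (insert w A)) : T i.succ j.succ w y ∈ vacSpace P T lam A := by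
  intro u hu huP
  have hwu : w ≠ u := fun h => hA (h ▸ hu)
  have hyu := hy u (Set.mem_insert_of_mem _ hu) huP
  have hyw := hy w (Set.mem_insert _ _) hw
  constructor
  · have := hT.apply hw huP hwu i.succ j.succ 0 0 y
    rw [hyu.1, hyu.2, hyw.2, map_smul] at this
    simpa using this.symm
  · intro a
    have := hT.apply hw huP hwu i.succ j.succ a.succ 0 y
    rw [hyu.2, hyu.2, hyw.2] at this
    simpa using this.symm

end Vacuum

end UqAffine
end

noncomputable section
namespace UqAffine

/-! ### Interchange of two neighbouring sites. -/

section Braid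

variable {H : Type*} [AddCommGroup H] [Module ℂ H] {k : ℕ}

/-- The interchange of two sites with parameters `a` and `z` by the `R`-matrix. -/
def braid (H : Type*) [AddCommGroup H] [Module ℂ H] (k : ℕ) (q a z : ℂ) :
    (Fin k → Fin k → H) →ₗ[ℂ] (Fin k → Fin k → H) where
  toFun Y x y := Y y x + exchCoeff q a z y x • Y x y
  map_add' Y Y' := by funext x y; simp only [Pi.add_apply]; module
  map_smul' c Y := by funext x y; simp only [Pi.smul_apply, RingHom.id_apply]; module

theorem braid_apply (q a z : ℂ) (Y : Fin k → Fin k → H) (x y : Fin k) :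
    braid H k q a z Y x y = Y y x + exchCoeff q a z y x • Y x y := rfl

theorem map_braid {H' : Type*} [AddCommGroup H'] [Module ℂ H'] (φ : H →ₗ[ℂ] H') (q a z : ℂ)
    (Y : Fin k → Fin k → H) (x y : Fin k) :
    φ (braid H k q a z Y x y) = braid H' k q a z (fun x y => φ (Y x y)) x y := by
  simp [braid_apply]

theorem addSite_addSite_apply (q : ℂ) (T : Fin k → Fin k → ℂ → Module.End ℂ H) (a z : ℂ)
    (i j : Fin k) (u : ℂ) (Y : Fin k → Fin k → H) (x y : Fin k) :
    addSite q (addSite q T z) a i j u Y x y =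
      ∑ c, T i c u (((if c = j then Y x y else 0) +
          exchCoeff q u a c x • (if x = j then Y c y else 0)) +
        exchCoeff q u z c y • ((if y = j then Y x c else 0) +
          exchCoeff q u a y x • if x = j then Y y c else 0)) := by
  have h₁ : ∑ c, T i c u (if c = j then Y x y else 0) = T i j u (Y x y) := by
    rw [Finset.sum_eq_single j (fun c _ hc => by simp [hc]) (by simp), if_pos rfl]
  have h₃ : ∀ c, addSite q T z i c u (Y c) y = T i c u (Y c y) +
      if y = c then ∑ d, exchCoeff q u z d c • T i d u (Y c d) else 0 :=
    fun c => addSite_apply ..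
  rw [addSite_apply, Pi.add_apply, addSite_apply]
  simp only [map_add, map_smul, smul_add, Finset.sum_add_distrib, h₁, add_assoc]
  congr 1
  rw [add_left_comm]
  by_cases hx : x = j
  · simp only [hx, if_true, Finset.sum_apply, Pi.smul_apply, h₃, smul_add, Finset.sum_add_distrib,
      smul_ite, smul_zero, Finset.sum_ite_eq, Finset.mem_univ, Finset.smul_sum]
    congr 1
    · by_cases hy : y = j
      · simp only [hy, if_true]
      · simp only [hy, if_false, map_zero, smul_zero, Finset.sum_const_zero]
    · exact congrArg _ (Finset.sum_congr rfl fun d _ => smul_comm _ _ _)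
  · by_cases hy : y = j
    · simp [hx, hy]
    · simp [hx, hy]

/-- Once the entries of T are factored out, this is the Yang–Baxter equation for the auxiliary space
and the two sites. -/
theorem braid_addSite {q : ℂ} (hq : q ≠ 0) (T : Fin k → Fin k → ℂ → Module.End ℂ H) {a z u : ℂ}
    (hua : u ≠ a) (huz : u ≠ z) (haz : a ≠ z) (i j : Fin k) (Y : Fin k → Fin k → H) :
    braid H k q a z (addSite q (addSite q T z) a i j u Y) =
      addSite q (addSite q T a) z i j u (braid H k q a z Y) := by
  funext x y
  rw [braid_apply, addSite_addSite_apply, addSite_addSite_apply, addSite_addSite_apply,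
    Finset.smul_sum, ← Finset.sum_add_distrib]
  refine Finset.sum_congr rfl fun c _ => ?_
  rw [← map_smul, ← map_add]
  congr 1
  have h := yangBaxter_apply hq hua huz haz
    (fun p r t => if p = j then Y r t else 0) c y x
  simp only [braid_apply]
  have e : ∀ (P : Prop) [Decidable P] (y₁ y₂ : H) (r : ℂ), (if P then y₁ + r • y₂ else 0) =
      (if P then y₁ else 0) + r • if P then y₂ else 0 := by
    intro P _ y₁ y₂ r; split_ifs <;> simp
  simp only [e]
  linear_combination (norm := module) -h

/-- Two entries of the same row have equal row indices, so the left side of the exchange relation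
collapses to a multiple by f; the column exchange is absorbed by the braid. -/
theorem Exchange.row_row {q : ℂ} {P : Set ℂ} {T : Fin (k + 1) → Fin (k + 1) → ℂ → Module.End ℂ H}
    (hT : Exchange q P T) {a z : ℂ} (ha : a ∈ P) (hz : z ∈ P) (haz : a ≠ z)
    (Y : Fin k → Fin k → H) :
    fRat q a z • ∑ l : Fin k, T 0 l.succ a (∑ m : Fin k, T 0 m.succ z (Y l m)) =
      ∑ x : Fin k, T 0 x.succ z (∑ y : Fin k, T 0 y.succ a (braid H k q a z Y x y)) := by
  have h : ∀ (l m : Fin k) (y : H), fRat q a z • T 0 l.succ a (T 0 m.succ z y) =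
      T 0 m.succ z (T 0 l.succ a y) + exchCoeff q a z m l • T 0 l.succ z (T 0 m.succ a y) := by
    intro l m y
    have := hT.apply ha hz haz 0 l.succ 0 m.succ y
    rw [exchCoeff_self, exchCoeff_succ] at this
    rw [← this]; module
  simp only [map_sum, Finset.smul_sum, h, braid_apply, map_add, map_smul, Finset.sum_add_distrib]
  rw [Finset.sum_comm]

theorem Exchange.zero_row {q : ℂ} {P : Set ℂ} {T : Fin (k + 1) → Fin (k + 1) → ℂ → Module.End ℂ H}
    (hT : Exchange q P T) {a u : ℂ} (ha : a ∈ P) (hu : u ∈ P) (hau : a ≠ u) (l : Fin k) (y : H) :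
    T 0 0 u (T 0 l.succ a y) = fRat q a u • T 0 l.succ a (T 0 0 u y) -
      (a * gRat q a u) • T 0 l.succ u (T 0 0 a y) := by
  have := hT.apply ha hu hau 0 l.succ 0 0 y
  rw [exchCoeff_self, exchCoeff_zero_succ] at this
  rw [← sub_eq_iff_eq_add] at this
  rw [← this]; module

/-- Moving T_{00}(u) past the row entry at a yields two contributions for each further parameter x.
By partial fractions they merge into one, braided with parameters a and x, which is exactly the
braid by which `pull` takes the site of x past that of a. -/
theorem Exchange.row_row_three_term {q : ℂ} {P : Set ℂ}
    {T : Fin (k + 1) → Fin (k + 1) → ℂ → Module.End ℂ H}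
    (hT : Exchange q P T) {a u x : ℂ} (ha : a ∈ P) (hu : u ∈ P) (hau : a ≠ u) (hxu : x ≠ u)
    (hxa : x ≠ a) (Y : Fin k → Fin k → H) :
    (x * gRat q x u * fRat q a u) • ∑ l : Fin k, T 0 l.succ a (∑ m : Fin k, T 0 m.succ u (Y l m)) -
      (a * gRat q a u * (x * gRat q x a)) •
        ∑ l : Fin k, T 0 l.succ u (∑ m : Fin k, T 0 m.succ a (Y l m)) =
      (x * gRat q x u) •
        ∑ l : Fin k, T 0 l.succ u (∑ m : Fin k, T 0 m.succ a (braid H k q a x Y l m)) := by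
  rw [mul_smul, hT.row_row ha hu hau]
  simp only [Finset.smul_sum, map_sum, ← Finset.sum_sub_distrib]
  refine Finset.sum_congr rfl fun l _ => Finset.sum_congr rfl fun m _ => ?_
  simp only [← map_smul, ← map_sub]
  congr 2
  rw [braid_apply, braid_apply, smul_add, smul_add, smul_smul, smul_smul,
    ← exchCoeff_three_term q hau hxu hxa]
  module

theorem braid_single_single (q a z : ℂ) (v : H) :
    braid H (k + 1) q a z (Pi.single 0 (Pi.single 0 v)) =
      fRat q a z • Pi.single 0 (Pi.single 0 v) := by
  funext x y
  rw [braid_apply]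
  by_cases hx : x = 0
  · by_cases hy : y = 0
    · subst hx hy
      simp [exchCoeff_self]; module
    · simp [hx, hy]
  · by_cases hy : y = 0
    · simp [hx, hy]
    · simp [hx, hy]

theorem addSite_map_apply {H' : Type*} [AddCommGroup H'] [Module ℂ H'] (φ : H →ₗ[ℂ] H') (q a u : ℂ)
    {T : Fin k → Fin k → ℂ → Module.End ℂ H} {T' : Fin k → Fin k → ℂ → Module.End ℂ H'}
    (y : Fin k → H) (h : ∀ i j s, φ (T i j u (y s)) = T' i j u (φ (y s))) (i j : Fin k) :
    (fun s => φ (addSite q T a i j u y s)) = addSite q T' a i j u (fun s => φ (y s)) := by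
  funext s
  rw [addSite_apply, addSite_apply, map_add, h]
  congr 1
  split_ifs <;> simp [h]

theorem addSite_map {H' : Type*} [AddCommGroup H'] [Module ℂ H'] (φ : H →ₗ[ℂ] H') (q a u : ℂ)
    {T : Fin k → Fin k → ℂ → Module.End ℂ H} {T' : Fin k → Fin k → ℂ → Module.End ℂ H'}
    (h : ∀ i j y, φ (T i j u y) = T' i j u (φ y)) (i j : Fin k) (y : Fin k → H) :
    (fun s => φ (addSite q T a i j u y s)) = addSite q T' a i j u (fun s => φ (y s)) :=
  addSite_map_apply φ q a u y (fun i j s => h i j (y s)) i j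

end Braid

/-! ### Moving an arbitrary site to the front. -/

section Pull

variable {H : Type*} [AddCommGroup H] [Module ℂ H] {k : ℕ}

/-- The interchange of sites that moves the site number `i` to the front. -/
def pull (H : Type*) [AddCommGroup H] [Module ℂ H] (k : ℕ) (q : ℂ) : (t : List ℂ) →
    (i : Fin t.length) →
      SiteSpace t.length k H →ₗ[ℂ] (Fin k → SiteSpace (t.eraseIdx i).length k H)
  | [], i => i.elim0
  | _ :: t, ⟨0, _⟩ => (splitSite t.length k H).toLinearMap
  | a :: t, ⟨i + 1, h⟩ =>
    let i' : Fin t.length := ⟨i, Nat.lt_of_succ_lt_succ h⟩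
    LinearMap.pi (fun x => (splitSite (t.eraseIdx i').length k H).symm.toLinearMap ∘ₗ
      LinearMap.proj x) ∘ₗ braid (SiteSpace (t.eraseIdx i').length k H) k q a (t.get i') ∘ₗ
      LinearMap.pi (fun l => pull H k q t i' ∘ₗ LinearMap.proj l) ∘ₗ
      (splitSite t.length k H).toLinearMap

theorem pull_zero (q a : ℂ) (t : List ℂ) (Y : SiteSpace (a :: t).length k H) :
    pull H k q (a :: t) 0 Y = splitSite t.length k H Y := rfl

theorem splitSite_pull_succ (q a : ℂ) (t : List ℂ) (i : Fin t.length)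
    (Y : SiteSpace (a :: t).length k H) (x : Fin k) :
    splitSite (t.eraseIdx i).length k H (pull H k q (a :: t) i.succ Y x) =
      braid (SiteSpace (t.eraseIdx i).length k H) k q a (t.get i)
        (fun l => pull H k q t i (splitSite t.length k H Y l)) x :=
  LinearEquiv.apply_symm_apply (splitSite (t.eraseIdx i).length k H)
    (braid (SiteSpace (t.eraseIdx i).length k H) k q a (t.get i)
      (fun l => pull H k q t i (splitSite t.length k H Y l)) x)

theorem rowProd_pull_succ (T : Fin (k + 1) → Fin (k + 1) → ℂ → Module.End ℂ H) (q a : ℂ)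
    (t : List ℂ) (i : Fin t.length) (Y : SiteSpace (a :: t).length k H) (x : Fin k) :
    rowProd T ((a :: t).eraseIdx i.succ) (pull H k q (a :: t) i.succ Y x) =
      ∑ l : Fin k, T 0 l.succ a (braid H k q a (t.get i) (fun l m => rowProd T (t.eraseIdx i)
        (pull H k q t i (splitSite t.length k H Y l) m)) x l) := by
  refine (rowProd_cons T a (t.eraseIdx i) (pull H k q (a :: t) i.succ Y x)).trans ?_
  refine Finset.sum_congr rfl fun l _ => ?_
  rw [splitSite_pull_succ, map_braid]

/-- Each interchange of neighbouring sites intertwines the chains by `braid_addSite`. The result is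
the chain of the other parameters with the site of the chosen one added in front. -/
theorem pull_nestedMonodromy {q : ℂ} (hq : q ≠ 0)
    (T : Fin (k + 1) → Fin (k + 1) → ℂ → Module.End ℂ H) (t : List ℂ) (ht : t.Nodup)
    (p : Fin t.length) {u : ℂ} (hu : u ∉ t) (i j : Fin k) (Y : SiteSpace t.length k H) :
    pull H k q t p (nestedMonodromy q T t i j u Y) =
      addSite q (nestedMonodromy q T (t.eraseIdx p)) (t.get p) i j u (pull H k q t p Y) := by
  induction t generalizing i j with
  | nil => exact p.elim0
  | cons a t ih =>
    simp only [List.mem_cons, not_or, List.nodup_cons] at hu ht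
    refine Fin.cases ?_ (fun p => ?_) p
    · exact splitSite_nestedMonodromy q T a t i j u Y
    · have hp : t.get p ∈ t := List.get_mem t p
      have e : ∀ x, splitSite (t.eraseIdx p).length k H
          (addSite q (nestedMonodromy q T ((a :: t).eraseIdx p.succ)) ((a :: t).get p.succ) i j u
            (pull H k q (a :: t) p.succ Y) x) =
          addSite q (addSite q (nestedMonodromy q T (t.eraseIdx p)) a) (t.get p) i j u
            (fun x => splitSite (t.eraseIdx p).length k H (pull H k q (a :: t) p.succ Y x)) x :=
        congrFun (addSite_map (splitSite (t.eraseIdx p).length k H).toLinearMap q (t.get p) u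
          (fun i j y => splitSite_nestedMonodromy q T a (t.eraseIdx p) i j u y) i j
          (pull H k q (a :: t) p.succ Y))
      funext x
      apply (splitSite (t.eraseIdx p).length k H).injective
      rw [e, splitSite_pull_succ, splitSite_nestedMonodromy]
      simp only [splitSite_pull_succ]
      have e₂ := addSite_map (pull H k q t p) q a u (fun i j y => ih ht.2 p hu.2 i j y) i j
        (splitSite t.length k H Y)
      rw [e₂, braid_addSite hq _ hu.1 (fun h => hu.2 (h ▸ hp)) (fun h => ht.1 (h ▸ hp))]

theorem fProd_cons_singleton (q a u : ℂ) (t : List ℂ) :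
    fProd q (a :: t) [u] = fRat q a u * fProd q t [u] := by simp [fProd]

/-- Each braid multiplies the product of two site vacua by f, so the parameters that precede the
chosen one contribute one factor each. -/
theorem pull_nestedVacuum (q : ℂ) (t : List ℂ) (p : Fin t.length) (v : H) :
    pull H (k + 1) q t p (nestedVacuum t.length k v) =
      fProd q (t.take p) [t.get p] •
        (Pi.single 0 (nestedVacuum (t.eraseIdx p).length k v) :
          Fin (k + 1) → SiteSpace (t.eraseIdx p).length (k + 1) H) := by
  induction t with
  | nil => exact p.elim0
  | cons a t ih =>
    refine Fin.cases ?_ (fun p => ?_) p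
    · exact (splitSite_nestedVacuum t.length k v).trans (one_smul ℂ _).symm
    · funext x
      apply (splitSite (t.eraseIdx p).length (k + 1) H).injective
      rw [splitSite_pull_succ]
      have e : (fun l => pull H (k + 1) q t p (splitSite t.length (k + 1) H
          (nestedVacuum (a :: t).length k v) l)) = fProd q (t.take p) [t.get p] •
          (Pi.single 0 (Pi.single 0 (nestedVacuum (t.eraseIdx p).length k v)) :
            Fin (k + 1) → Fin (k + 1) → SiteSpace (t.eraseIdx p).length (k + 1) H) := by
        funext l
        erw [splitSite_nestedVacuum]
        by_cases hl : l = 0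
        · subst hl
          simp only [Pi.single_eq_same, Pi.smul_apply]
          exact ih p
        · simp [hl]
      have e₃ := splitSite_nestedVacuum (t.eraseIdx p).length k v
      rw [e, map_smul, braid_single_single, Pi.smul_apply, Pi.smul_apply, smul_smul]
      have e₂ : fProd q ((a :: t).take (p.succ : Fin (t.length + 1)))
          [(a :: t).get (p.succ : Fin (t.length + 1))] =
          fProd q (t.take p) [t.get p] * fRat q a (t.get p) := by
        rw [mul_comm, ← fProd_cons_singleton]; rfl
      rw [e₂]
      refine Eq.trans ?_ (map_smul (splitSite (t.eraseIdx p).length (k + 1) H) _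
        ((Pi.single 0 (nestedVacuum ((t.eraseIdx p).length + 1) k v) :
          Fin (k + 1) → SiteSpace ((t.eraseIdx p).length + 1) (k + 1) H) x)).symm
      congr 1
      by_cases hx : x = 0
      · subst hx
        rw [Pi.single_eq_same, Pi.single_eq_same, e₃]
      · simp [hx]

/-- The commutation relations supply the factors for parameters behind x, and pulling the vacuum
supplies those in front. Together they give a coefficient that no longer depends on the position of
x. -/
theorem fProd_take_mul_drop (q : ℂ) (t : List ℂ) (p : ℕ) (x : ℂ) :
    fProd q (t.drop (p + 1)) [x] * fProd q (t.take p) [x] = fProd q (t.eraseIdx p) [x] := by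
  rw [List.eraseIdx_eq_take_drop_succ, mul_comm]
  simp [fProd]

end Pull

end UqAffine
end

noncomputable section
namespace UqAffine

/-! ### Commutation of T_{00} with a row product. -/

section RowIdentities

variable {H : Type*} [AddCommGroup H] [Module ℂ H] {k : ℕ}

/-- This is the wanted and unwanted terms computation of the algebraic Bethe ansatz. In the unwanted
terms u replaces the parameter t_i, whose site has first been pulled to the front. The induction
moves T_{00} past the head a and uses the hypothesis both at u and at a. -/
theorem Exchange.zero_rowProd {q : ℂ} {P : Set ℂ}
    {T : Fin (k + 1) → Fin (k + 1) → ℂ → Module.End ℂ H} (hT : Exchange q P T) (lam : ℂ → ℂ)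
    (t : List ℂ) (htP : ∀ x ∈ t, x ∈ P) (ht : t.Nodup) {u : ℂ} (hu : u ∈ P) (hut : u ∉ t)
    (Y : SiteSpace t.length k H) (hYu : ∀ κ, T 0 0 u (Y κ) = lam u • Y κ)
    (hY : ∀ x ∈ t, ∀ κ, T 0 0 x (Y κ) = lam x • Y κ) :
    T 0 0 u (rowProd T t Y) = (lam u * fProd q t [u]) • rowProd T t Y -
      ∑ i : Fin t.length, (lam (t.get i) * fProd q (t.drop (i + 1)) [t.get i] *
          (t.get i * gRat q (t.get i) u)) •
        ∑ l : Fin k, T 0 l.succ u (rowProd T (t.eraseIdx i) (pull H k q t i Y l)) := by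
  induction t generalizing u with
  | nil =>
    rw [rowProd_nil T Y Fin.elim0, hYu]
    simp [fProd]
  | cons a t ih =>
    simp only [List.mem_cons, not_or, List.nodup_cons, forall_eq_or_imp] at htP ht hut hY
    have hau : a ≠ u := fun h => hut.1 h.symm
    have ihu := fun l => ih htP.2 ht.2 hu hut.2 (splitSite t.length k H Y l) (fun κ => hYu _)
      (fun x hx κ => hY.2 x hx _)
    have iha := fun l => ih htP.2 ht.2 htP.1 ht.1 (splitSite t.length k H Y l) (fun κ => hY.1 _)
      (fun x hx κ => hY.2 x hx _)
    -- The unwanted term of a tail parameter in the longer row splits into the two contributions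
    -- coming from the hypothesis at u and from the hypothesis at a.
    have hsum : ∀ i : Fin t.length,
        (lam (t.get i) * fProd q (t.drop (i + 1)) [t.get i] * (t.get i * gRat q (t.get i) u)) •
          ∑ l : Fin k, T 0 l.succ u (rowProd T ((a :: t).eraseIdx i.succ)
            (pull H k q (a :: t) i.succ Y l)) =
        (lam (t.get i) * fProd q (t.drop (i + 1)) [t.get i]) •
          ((t.get i * gRat q (t.get i) u * fRat q a u) • (∑ l : Fin k, T 0 l.succ a
              (∑ m : Fin k, T 0 m.succ u (rowProd T (t.eraseIdx i)
                (pull H k q t i (splitSite t.length k H Y l) m)))) -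
            (a * gRat q a u * (t.get i * gRat q (t.get i) a)) • (∑ l : Fin k, T 0 l.succ u
              (∑ m : Fin k, T 0 m.succ a (rowProd T (t.eraseIdx i)
                (pull H k q t i (splitSite t.length k H Y l) m))))) := by
      intro i
      have hi : t.get i ∈ t := List.get_mem t i
      rw [hT.row_row_three_term htP.1 hu hau (fun h => hut.2 (h ▸ hi)) (fun h => ht.1 (h ▸ hi)),
        smul_smul]
      simp only [rowProd_pull_succ]
    rw [rowProd_cons, map_sum]
    simp only [hT.zero_row htP.1 hu hau, ihu, iha]
    erw [Fin.sum_univ_succ]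
    erw [Finset.sum_congr rfl fun i _ => hsum i]
    simp only [pull_zero, fProd_cons_singleton]
    simp only [map_sub, map_smul, map_sum, smul_sub, Finset.sum_sub_distrib, Finset.smul_sum,
      smul_smul]
    have hc : ∀ (F : Fin k → Fin t.length → Fin k → H), ∑ l, ∑ i, ∑ m, F l i m =
        ∑ i, ∑ l, ∑ m, F l i m := fun F => Finset.sum_comm
    rw [hc, hc]
    have aux : ∀ {A B C D A' B' C' D' : H}, A = A' → B = B' → C = C' → D = D' →
        A - C - (B - D) = A' - (B' + (C' - D')) := by
      rintro A B C D _ _ _ _ rfl rfl rfl rfl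
      abel
    refine aux (Finset.sum_congr rfl fun l _ => ?_) (Finset.sum_congr rfl fun l _ => ?_)
      (Finset.sum_congr rfl fun i _ => Finset.sum_congr rfl fun l _ =>
        Finset.sum_congr rfl fun m _ => ?_)
      (Finset.sum_congr rfl fun i _ => Finset.sum_congr rfl fun l _ =>
        Finset.sum_congr rfl fun m _ => ?_)
    · congr 1; ring
    · exact congrArg (· • T 0 l.succ u (rowProd T t (splitSite t.length k H Y l)))
        (show a * gRat q a u * (lam a * fProd q t [a]) =
          lam a * fProd q t [a] * (a * gRat q a u) by ring)
    · congr 1; ring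
    · congr 1; ring

/-- The row operators have nonzero column index, so the exchange part of R never feeds the component
0 of the site. -/
theorem rowProd_addSite_zero (q : ℂ) (T : Fin (k + 1) → Fin (k + 1) → ℂ → Module.End ℂ H) (z : ℂ)
    (t : List ℂ) (Y : SiteSpace t.length k H) :
    rowProd (UqAffine.addSite q T z) t
      (siteMap t.length k (LinearMap.single ℂ (fun _ : Fin (k + 1) => H) 0) Y) 0 =
      rowProd T t Y := by
  induction t with
  | nil =>
    rw [rowProd_nil T Y Fin.elim0, rowProd_nil _ _ Fin.elim0, siteMap_apply]
    simp
  | cons a t ih =>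
    rw [rowProd_cons, rowProd_cons, Finset.sum_apply]
    refine Finset.sum_congr rfl fun l _ => ?_
    rw [addSite_apply, if_neg (Fin.succ_ne_zero l).symm, add_zero]
    exact congrArg _ (ih _)

/-- The coefficients are those of the unwanted terms of `Exchange.zero_rowProd` with z in place of
u: a nonzero component arises when an entry T_{00}(x) passes the excitation to the site, and its
action on the rest of the row is given by that identity. -/
theorem Exchange.rowProd_addSite_succ {q : ℂ} {P : Set ℂ}
    {T : Fin (k + 1) → Fin (k + 1) → ℂ → Module.End ℂ H} (hT : Exchange q P T) (lam : ℂ → ℂ)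
    (t : List ℂ) (htP : ∀ x ∈ t, x ∈ P) (ht : t.Nodup) {z : ℂ} (hz : z ∉ t)
    (Y : SiteSpace t.length k H) (hY : ∀ x ∈ t, ∀ κ, T 0 0 x (Y κ) = lam x • Y κ) (j : Fin k) :
    rowProd (UqAffine.addSite q T z) t
      (siteMap t.length k (LinearMap.single ℂ (fun _ : Fin (k + 1) => H) 0) Y) j.succ =
      ∑ i : Fin t.length, (lam (t.get i) * fProd q (t.drop (i + 1)) [t.get i] *
          (t.get i * gRat q (t.get i) z)) • rowProd T (t.eraseIdx i) (pull H k q t i Y j) := by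
  induction t generalizing j with
  | nil =>
    rw [rowProd_nil _ _ Fin.elim0, siteMap_apply]
    simp
  | cons a t ih =>
    simp only [List.mem_cons, not_or, List.nodup_cons, forall_eq_or_imp] at htP ht hz hY
    have haz : a ≠ z := fun h => hz.1 h.symm
    have ih' := fun l => ih htP.2 ht.2 hz.2 (splitSite t.length k H Y l)
      (fun x hx κ => hY.2 x hx _)
    have h0 := hT.zero_rowProd lam t htP.2 ht.2 htP.1 ht.1 (splitSite t.length k H Y j)
      (fun κ => hY.1 _) (fun x hx κ => hY.2 x hx _)
    -- The pulled term of the longer row splits in three: a row operator that leaves the site alone,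
    -- an exchange within nonzero components, and the unwanted part of T_{00}(a).
    have hsum : ∀ i : Fin t.length,
        (lam (t.get i) * fProd q (t.drop (i + 1)) [t.get i] * (t.get i * gRat q (t.get i) z)) •
          rowProd T ((a :: t).eraseIdx i.succ) (pull H k q (a :: t) i.succ Y j) =
        (∑ l : Fin k, (lam (t.get i) * fProd q (t.drop (i + 1)) [t.get i] *
          (t.get i * gRat q (t.get i) z)) • T 0 l.succ a (rowProd T (t.eraseIdx i)
            (pull H k q t i (splitSite t.length k H Y l) j))) +
        ((∑ l : Fin k, exchCoeff q a z l j • (lam (t.get i) * fProd q (t.drop (i + 1)) [t.get i] *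
          (t.get i * gRat q (t.get i) z)) • T 0 l.succ a (rowProd T (t.eraseIdx i)
            (pull H k q t i (splitSite t.length k H Y j) l))) -
        ∑ l : Fin k, (a * gRat q a z) • (lam (t.get i) * fProd q (t.drop (i + 1)) [t.get i] *
          (t.get i * gRat q (t.get i) a)) • T 0 l.succ a (rowProd T (t.eraseIdx i)
            (pull H k q t i (splitSite t.length k H Y j) l))) := by
      intro i
      have hi : t.get i ∈ t := List.get_mem t i
      have h3 := fun l : Fin k => exchCoeff_three_term q haz (fun h => hz.2 (h ▸ hi))
        (fun h => ht.1 (h ▸ hi)) l j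
      rw [rowProd_pull_succ, ← Finset.sum_sub_distrib, ← Finset.sum_add_distrib, Finset.smul_sum]
      refine Finset.sum_congr rfl fun l _ => ?_
      rw [braid_apply, map_add, map_smul, smul_add, smul_smul, mul_assoc _ _ (exchCoeff _ _ _ _ _),
        ← h3]
      module
    rw [rowProd_cons, Finset.sum_apply]
    have hsplit : ∀ l, splitSite t.length k (Fin (k + 1) → H) (siteMap (a :: t).length k
        (LinearMap.single ℂ (fun _ : Fin (k + 1) => H) 0) Y) l =
        siteMap t.length k (LinearMap.single ℂ (fun _ : Fin (k + 1) => H) 0)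
          (splitSite t.length k H Y l) := fun _ => rfl
    simp only [hsplit, addSite_apply, Fin.succ_inj, Finset.sum_add_distrib, Finset.sum_ite_eq,
      Finset.mem_univ, if_true, ih']
    -- The summand c = 0 contains T_{00}(a) on the component 0 and is evaluated by `h0`; the other
    -- summands are covered by the induction hypothesis.
    rw [Fin.sum_univ_succ (fun c => exchCoeff q a z c j.succ • _)]
    erw [Fin.sum_univ_succ]
    erw [Finset.sum_congr rfl fun i _ => hsum i]
    simp only [rowProd_addSite_zero, h0, ih', exchCoeff_zero_succ, exchCoeff_succ, pull_zero]
    simp only [map_sum, map_smul, smul_sub, Finset.sum_sub_distrib, Finset.sum_add_distrib,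
      Finset.smul_sum]
    have hc : ∀ (F : Fin k → Fin t.length → H), ∑ l, ∑ i, F l i = ∑ i, ∑ l, F l i :=
      fun F => Finset.sum_comm
    rw [hc, hc]
    have aux : ∀ {A B C D A' B' C' D' : H}, A = A' → B = B' → C = C' → D = D' →
        A + (B - C + D) = B' + (A' + (D' - C')) := by
      rintro A B C D _ _ _ _ rfl rfl rfl rfl
      abel
    refine aux rfl ?_ rfl rfl
    rw [smul_smul]
    exact congrArg (· • rowProd T t (splitSite t.length k H Y j))
      (show a * gRat q a z * (lam a * fProd q t [a]) =
        lam a * fProd q t [a] * (a * gRat q a z) by ring)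

end RowIdentities

/-! ### Chains of removed parameters and the recursion over the first colour. -/

section Chain

/-- The sum over chains `x_0 ∈ t_0, x_1 ∈ t_1, …, x_{j-1} ∈ t_{j-1}` of the values of `F` at the
parameter lists without the members of the chain. -/
def chainSum (q : ℂ) {M : Type*} [AddCommGroup M] [Module ℂ M] : (N : ℕ) →
    (Fin (N + 1) → ℂ → ℂ) → ℂ → (Fin N → List ℂ) → Fin (N + 1) → ((Fin N → List ℂ) → M) → M
  | 0, _, _, t, _, F => F t
  | N + 1, lam, z, t, j, F =>
    Fin.cases (F t) (fun j => ∑ x ∈ (t 0).toFinset,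
      (lam 0 x * (x * gRat q x z) * fProd q ((t 0).erase x) [x]) •
        chainSum q N (nestedEigenvalue q lam ((t 0).erase x)) x (fun ν => t ν.succ) j
          (fun r => F (Fin.cons ((t 0).erase x) r))) j

theorem chainSum_zero (q : ℂ) {M : Type*} [AddCommGroup M] [Module ℂ M] (N : ℕ)
    (lam : Fin (N + 1) → ℂ → ℂ) (z : ℂ) (t : Fin N → List ℂ) (F : (Fin N → List ℂ) → M) :
    chainSum q N lam z t 0 F = F t := by
  cases N <;> rfl

theorem chainSum_succ (q : ℂ) {M : Type*} [AddCommGroup M] [Module ℂ M] (N : ℕ)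
    (lam : Fin (N + 2) → ℂ → ℂ) (z : ℂ) (t : Fin (N + 1) → List ℂ) (j : Fin (N + 1))
    (F : (Fin (N + 1) → List ℂ) → M) :
    chainSum q (N + 1) lam z t j.succ F = ∑ x ∈ (t 0).toFinset,
      (lam 0 x * (x * gRat q x z) * fProd q ((t 0).erase x) [x]) •
        chainSum q N (nestedEigenvalue q lam ((t 0).erase x)) x (fun ν => t ν.succ) j
          (fun r => F (Fin.cons ((t 0).erase x) r)) := rfl

theorem map_chainSum (q : ℂ) {M M' : Type*} [AddCommGroup M] [Module ℂ M] [AddCommGroup M']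
    [Module ℂ M'] (φ : M →ₗ[ℂ] M') (N : ℕ) (lam : Fin (N + 1) → ℂ → ℂ) (z : ℂ)
    (t : Fin N → List ℂ) (j : Fin (N + 1)) (F : (Fin N → List ℂ) → M) :
    φ (chainSum q N lam z t j F) = chainSum q N lam z t j (fun r => φ (F r)) := by
  induction N generalizing z with
  | zero => rfl
  | succ N ih =>
    refine Fin.cases ?_ (fun j => ?_) j
    · rw [chainSum_zero, chainSum_zero]
    · rw [chainSum_succ, chainSum_succ, map_sum]
      exact Finset.sum_congr rfl fun x _ => by rw [map_smul, ih]

theorem sum_get_eraseIdx {M : Type*} [AddCommMonoid M] (t : List ℂ) (ht : t.Nodup)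
    (G : ℂ → List ℂ → M) :
    ∑ i : Fin t.length, G (t.get i) (t.eraseIdx i) = ∑ x ∈ t.toFinset, G x (t.erase x) := by
  refine Finset.sum_bij (fun i _ => t.get i) (fun i _ => by simp)
    (fun i _ j _ h => (List.nodup_iff_injective_get.1 ht) h)
    (fun x hx => ?_) (fun i _ => ?_)
  · obtain ⟨i, hi⟩ := List.get_of_mem (List.mem_toFinset.1 hx)
    exact ⟨i, Finset.mem_univ _, hi⟩
  · congr 1
    rw [List.get_eq_getElem, ht.erase_getElem]

variable {H : Type*} [AddCommGroup H] [Module ℂ H]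

/-- A site in its first basis vector is inert for the lower block wherever the first column below
the diagonal vanishes, since the exchange part of R only reaches those entries. -/
theorem siteMap_single_nestedMonodromy {q : ℂ} {k : ℕ}
    {T : Fin (k + 2) → Fin (k + 2) → ℂ → Module.End ℂ H} (z : ℂ)
    (t : List ℂ) (i j : Fin (k + 1)) (w : ℂ) (Y : SiteSpace t.length (k + 1) H)
    (hY : ∀ κ, ∀ a : Fin (k + 1), T a.succ 0 w (Y κ) = 0) :
    siteMap t.length (k + 1) (LinearMap.single ℂ (fun _ : Fin (k + 2) => H) 0)
        (nestedMonodromy q T t i j w Y) =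
      nestedMonodromy q (addSite q T z) t i j w
        (siteMap t.length (k + 1) (LinearMap.single ℂ (fun _ : Fin (k + 2) => H) 0) Y) := by
  funext κ
  rw [siteMap_apply, nestedMonodromy_apply, nestedMonodromy_apply]
  simp only [map_sum, map_smul, siteMap_apply]
  refine Finset.sum_congr rfl fun c _ => Finset.sum_congr rfl fun κ' _ => ?_
  congr 1
  funext s
  rw [addSite_apply, Finset.sum_eq_single 0 (fun d _ hd => by simp [hd]) (by simp)]
  by_cases hs : s = 0
  · subst hs; simp [(Fin.succ_ne_zero c).symm]
  · simp [hs, hY]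

/-- The components of the Bethe vector of a chain with one additional site. -/
theorem preBethe_addSite {q : ℂ} (hq : q ≠ 0) {N : ℕ} {P : Set ℂ}
    {T : Fin (N + 1) → Fin (N + 1) → ℂ → Module.End ℂ H} (hT : Exchange q P T)
    {lam : Fin (N + 1) → ℂ → ℂ} {v : H} (hv : IsVacuum P T lam v) {t : Fin N → List ℂ}
    (ht : Separated P t) {z : ℂ} (hz : ∀ ν, z ∉ t ν) (j : Fin (N + 1)) :
    preBethe q N (addSite q T z) (Pi.single 0 v) t j =
      chainSum q N lam z t j (fun r => preBethe q N T v r) := by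
  induction N generalizing H P z with
  | zero =>
    rw [Fin.fin_one_eq_zero j]
    simp [preBethe, chainSum]
  | succ N ih =>
    set Y := preBethe q N (nestedMonodromy q T (t 0)) (nestedVacuum (t 0).length N v)
      (fun ν => t ν.succ) with hYdef
    -- The filtration by vacuum spaces serves twice: it allows the inert site to be attached to the
    -- nested Bethe vector, and it gives the action of T_{00} on the components at the first-colour
    -- parameters.
    obtain ⟨hY, hYe⟩ := preBethe_intertwine q (P := P \ {x | x ∈ t 0})
      (T := nestedMonodromy q T (t 0)) (T' := nestedMonodromy q (addSite q T z) (t 0))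
      (siteMap (t 0).length (N + 1) (LinearMap.single ℂ (fun _ : Fin (N + 2) => H) 0))
      (fun A => { carrier := {Y | ∀ κ, Y κ ∈ vacSpace P T lam A}
                  add_mem' := fun h h' κ => (vacSpace P T lam A).add_mem (h κ) (h' κ)
                  zero_mem' := fun κ => (vacSpace P T lam A).zero_mem
                  smul_mem' := fun c _ h κ => (vacSpace P T lam A).smul_mem c (h κ) })
      (fun w hw A hA i j y hy κ => by
        rw [nestedMonodromy_apply]
        exact Submodule.sum_mem _ fun c _ => Submodule.sum_mem _ fun κ' _ =>
          Submodule.smul_mem _ _ (hT.mem_vacSpace lam hw.1 hA _ _ (hy κ')))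
      (fun w hw A hA i j y hy => siteMap_single_nestedMonodromy z (t 0) i j w y
        fun κ a => (hy κ w (Set.mem_insert _ _) hw.1).2 a)
      ht.tail {x | x ∈ t 0} (fun ν x hx => ht.2.2 _ _ (Fin.succ_ne_zero ν) x hx)
      (nestedVacuum (t 0).length N v)
      (by
        intro κ
        unfold nestedVacuum
        by_cases h : κ = fun _ => 0
        · subst h; simpa using hv.mem_vacSpace _
        · simp [h])
    rw [← hYdef, siteMap_nestedVacuum] at hYe
    have hpre : preBethe q (N + 1) (addSite q T z) (Pi.single 0 v) t =
        rowProd (addSite q T z) (t 0) (siteMap (t 0).length (N + 1)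
          (LinearMap.single ℂ (fun _ : Fin (N + 2) => H) 0) Y) := by
      rw [hYe]; rfl
    rw [hpre]
    refine Fin.cases ?_ (fun j => ?_) j
    · rw [rowProd_addSite_zero, chainSum_zero]
      rfl
    · rw [hT.rowProd_addSite_succ (lam 0) (t 0) (ht.1 0) (ht.2.1 0) (hz 0) Y
        (fun x hx κ => (hY κ x hx (ht.1 0 x hx)).1), chainSum_succ, ← sum_get_eraseIdx _ (ht.2.1 0)
        (fun x l => (lam 0 x * (x * gRat q x z) * fProd q l [x]) •
        chainSum q N (nestedEigenvalue q lam l) x (fun ν => t ν.succ) j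
          (fun r => preBethe q (N + 1) T v (Fin.cons l r)))]
      refine Finset.sum_congr rfl fun i _ => ?_
      have hsub : P \ {x | x ∈ t 0} ⊆ P \ {x | x ∈ (t 0).eraseIdx i} :=
        fun x hx => ⟨hx.1, fun h => hx.2 (List.eraseIdx_subset h)⟩
      -- Pulling the site of the removed parameter to the front turns the nested Bethe vector into
      -- one with an added site, to which the induction hypothesis with one colour fewer applies.
      have hp := preBethe_map q (P := P \ {x | x ∈ t 0}) (pull H (N + 1) q (t 0) i)
        (fun w hw i' j y => pull_nestedMonodromy hq T (t 0) (ht.2.1 0) i hw.2 i' j y)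
        ht.tail (nestedVacuum (t 0).length N v)
      rw [pull_nestedVacuum, preBethe_smul q _ ht.tail] at hp
      have hi := ih (hT.nestedMonodromy hq ((t 0).eraseIdx i))
        ((hv.nestedMonodromy q ((t 0).eraseIdx i)).mono Set.sdiff_subset)
        (ht.tail.mono fun ν x hx => hsub (ht.tail.1 ν x hx)) (z := (t 0).get i)
        (fun ν h => ht.2.2 _ _ (Fin.succ_ne_zero ν) _ h (List.get_mem _ _)) j
      rw [hp, Pi.smul_apply, hi, map_smul, map_chainSum, smul_smul]
      congr 1
      rw [← fProd_take_mul_drop]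
      ring

/-- Recursion over the first colour. -/
theorem preBethe_cons_first {q : ℂ} (hq : q ≠ 0) {N : ℕ} {P : Set ℂ}
    {T : Fin (N + 2) → Fin (N + 2) → ℂ → Module.End ℂ H} (hT : Exchange q P T)
    {lam : Fin (N + 2) → ℂ → ℂ} {v : H} (hv : IsVacuum P T lam v) {z : ℂ} {l : List ℂ}
    {t : Fin N → List ℂ} (ht : Separated P (Fin.cons (z :: l) t : Fin (N + 1) → List ℂ)) :
    preBethe q (N + 1) T v (Fin.cons (z :: l) t) = ∑ j : Fin (N + 1), T 0 j.succ z
      (chainSum q N (nestedEigenvalue q lam l) z t j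
        (fun r => preBethe q (N + 1) T v (Fin.cons l r))) := by
  have htail := ht.tail
  simp only [Fin.cons_succ, Fin.cons_zero] at htail
  have hz : ∀ ν, z ∉ t ν := fun ν h =>
    ht.2.2 0 ν.succ (Fin.succ_ne_zero ν).symm z (by simp) (by simpa using h)
  -- The head parameter z is an added site in its vacuum for the nested chain of l.
  have hp := preBethe_map q (splitSite l.length (N + 1) H).toLinearMap
    (fun w _ i j y => splitSite_nestedMonodromy q T z l i j w y) htail
    (nestedVacuum (z :: l).length N v)
  have hs := splitSite_nestedVacuum l.length N v
  erw [hs] at hp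
  have hsub : P \ {x | x ∈ z :: l} ⊆ P \ {x | x ∈ l} :=
    fun x hx => ⟨hx.1, fun h => hx.2 (List.mem_cons_of_mem _ h)⟩
  have h1 : preBethe q (N + 1) T v (Fin.cons (z :: l) t) = rowProd T (z :: l)
    (preBethe q N (nestedMonodromy q T (z :: l)) (nestedVacuum (z :: l).length N v) t) := rfl
  rw [h1, rowProd_cons]
  refine Finset.sum_congr rfl fun j _ => ?_
  erw [hp]
  rw [preBethe_addSite hq (hT.nestedMonodromy hq l)
    ((hv.nestedMonodromy q l).mono Set.sdiff_subset)
    (htail.mono fun ν x hx => hsub (htail.1 ν x hx)) hz, map_chainSum]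
  rfl

end Chain
end UqAffine
end

noncomputable section
namespace UqAffine

/-! ### Independence of the enumeration of the parameters. -/

section Permutations

variable {H : Type*} [AddCommGroup H] [Module ℂ H] {k : ℕ}

/-- A linear map acting on all but the first tensor factor. -/
def tailMap {r r' : ℕ} (ρ : SiteSpace r k H →ₗ[ℂ] SiteSpace r' k H) :
    SiteSpace (r + 1) k H →ₗ[ℂ] SiteSpace (r' + 1) k H :=
  (splitSite r' k H).symm.toLinearMap ∘ₗ LinearMap.pi (fun b => ρ ∘ₗ LinearMap.proj b) ∘ₗ
    (splitSite r k H).toLinearMap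

theorem splitSite_tailMap {r r' : ℕ} (ρ : SiteSpace r k H →ₗ[ℂ] SiteSpace r' k H)
    (Y : SiteSpace (r + 1) k H) :
    splitSite r' k H (tailMap ρ Y) = fun b => ρ (splitSite r k H Y b) :=
  (splitSite r' k H).apply_symm_apply _

/-- The splitting off of the first two tensor factors. -/
def splitTwo (r k : ℕ) (H : Type*) [AddCommGroup H] [Module ℂ H] :
    SiteSpace (r + 2) k H ≃ₗ[ℂ] (Fin k → Fin k → SiteSpace r k H) :=
  (splitSite (r + 1) k H).trans (LinearEquiv.piCongrRight fun _ => splitSite r k H)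

theorem splitTwo_nestedMonodromy (q : ℂ) (T : Fin (k + 1) → Fin (k + 1) → ℂ → Module.End ℂ H)
    (a b : ℂ) (t : List ℂ) (i j : Fin k) (u : ℂ) (Y : SiteSpace (a :: b :: t).length k H) :
    splitTwo t.length k H (nestedMonodromy q T (a :: b :: t) i j u Y) =
      addSite q (addSite q (nestedMonodromy q T t) b) a i j u (splitTwo t.length k H Y) := by
  have h := addSite_map (splitSite t.length k H).toLinearMap q a u
    (fun i j y => splitSite_nestedMonodromy q T b t i j u y) i j
    (splitSite (t.length + 1) k H Y)
  refine Eq.trans ?_ h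
  funext x
  exact congrArg (splitSite t.length k H)
    (congrFun (splitSite_nestedMonodromy q T a (b :: t) i j u Y) x)

theorem splitTwo_nestedVacuum (r : ℕ) (v : H) :
    splitTwo r (k + 1) H (nestedVacuum (r + 2) k v) =
      (Pi.single 0 (Pi.single 0 (nestedVacuum r k v)) :
        Fin (k + 1) → Fin (k + 1) → SiteSpace r (k + 1) H) := by
  funext x
  change splitSite r (k + 1) H (splitSite (r + 1) (k + 1) H (nestedVacuum (r + 2) k v) x) = _
  rw [splitSite_nestedVacuum]
  by_cases hx : x = 0
  · subst hx
    rw [Pi.single_eq_same, Pi.single_eq_same, splitSite_nestedVacuum]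
  · simp [hx]

theorem rowProd_cons_cons (T : Fin (k + 1) → Fin (k + 1) → ℂ → Module.End ℂ H) (a b : ℂ)
    (t : List ℂ) (Y : SiteSpace (a :: b :: t).length k H) :
    rowProd T (a :: b :: t) Y = ∑ x : Fin k, T 0 x.succ a (∑ y : Fin k, T 0 y.succ b
      (rowProd T t (splitTwo t.length k H Y x y))) := by
  rw [rowProd_cons]
  exact Finset.sum_congr rfl fun x _ => congrArg _ (rowProd_cons T b t _)

/-- Reordering the parameters of the first colour amounts to an invertible change of the nested
monodromy matrix by `R`-matrices. -/
theorem exists_siteLink {q : ℂ} (hq : q ≠ 0) {P : Set ℂ}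
    {T : Fin (k + 2) → Fin (k + 2) → ℂ → Module.End ℂ H} (hT : Exchange q P T)
    (hf : ∀ x ∈ P, ∀ y ∈ P, x ≠ y → fRat q x y ≠ 0) {t t' : List ℂ} (h : t.Perm t')
    (htP : ∀ x ∈ t, x ∈ P) (ht : t.Nodup) :
    ∃ c : ℂ, c ≠ 0 ∧ ∃ ρ : SiteSpace t.length (k + 1) H →ₗ[ℂ] SiteSpace t'.length (k + 1) H,
      (∀ u, u ∉ t → ∀ i j Y,
        ρ (nestedMonodromy q T t i j u Y) = nestedMonodromy q T t' i j u (ρ Y)) ∧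
      (∀ v, ρ (nestedVacuum t.length k v) = c • nestedVacuum t'.length k v) ∧
      ∀ Y, rowProd T t' (ρ Y) = c • rowProd T t Y := by
  induction h with
  | nil => exact ⟨1, one_ne_zero, LinearMap.id, by simp, by simp, by simp⟩
  | @cons a t t' _ ih =>
    simp only [List.mem_cons, forall_eq_or_imp, List.nodup_cons] at htP ht
    obtain ⟨c, hc, ρ, h₁, h₂, h₃⟩ := ih htP.2 ht.2
    refine ⟨c, hc, tailMap ρ, fun u hu i j Y => ?_, fun v => ?_, fun Y => ?_⟩
    · simp only [List.mem_cons, not_or] at hu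
      apply (splitSite t'.length (k + 1) H).injective
      refine (splitSite_tailMap ρ _).trans ?_
      refine Eq.trans ?_ (splitSite_nestedMonodromy q T a t' i j u _).symm
      rw [splitSite_tailMap, ← addSite_map ρ q a u (fun i j y => h₁ u hu.2 i j y),
        splitSite_nestedMonodromy]
    · apply (splitSite t'.length (k + 1) H).injective
      refine (splitSite_tailMap ρ _).trans ?_
      refine Eq.trans ?_ (map_smul (splitSite t'.length (k + 1) H) c
        (nestedVacuum (t'.length + 1) k v)).symm
      erw [splitSite_nestedVacuum]
      rw [splitSite_nestedVacuum]
      funext b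
      by_cases hb : b = 0
      · subst hb
        simp [h₂]
      · simp [hb]
    · rw [rowProd_cons, rowProd_cons, Finset.smul_sum]
      refine Finset.sum_congr rfl fun l _ => ?_
      rw [← map_smul, ← h₃]
      exact congrArg (fun y => T 0 l.succ a (rowProd T t' y)) (congrFun (splitSite_tailMap ρ Y) l)
  | swap z a t =>
    simp only [List.mem_cons, forall_eq_or_imp, List.nodup_cons, not_or] at htP ht
    -- The same constant f(a,z) is the eigenvalue of the braid on the two site vacua and the factor
    -- in the interchange of two row entries.
    refine ⟨fRat q a z, hf a htP.1 z htP.2.1 ht.1.1, (splitTwo t.length (k + 1) H).symm.toLinearMap ∘ₗ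
      braid (SiteSpace t.length (k + 1) H) (k + 1) q a z ∘ₗ
      (splitTwo t.length (k + 1) H).toLinearMap, fun u hu i j Y => ?_, fun v => ?_, fun Y => ?_⟩
    · simp only [List.mem_cons, not_or] at hu
      apply (splitTwo t.length (k + 1) H).injective
      refine ((splitTwo t.length (k + 1) H).apply_symm_apply _).trans ?_
      refine Eq.trans ?_ (splitTwo_nestedMonodromy q T z a t i j u _).symm
      refine (congrArg (braid _ (k + 1) q a z)
        (splitTwo_nestedMonodromy q T a z t i j u Y)).trans ?_
      refine (braid_addSite hq _ hu.1 hu.2.1 ht.1.1 i j _).trans ?_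
      exact congrArg (addSite q (addSite q (nestedMonodromy q T t) a) z i j u)
        ((splitTwo t.length (k + 1) H).apply_symm_apply _).symm
    · apply (splitTwo t.length (k + 1) H).injective
      refine ((splitTwo t.length (k + 1) H).apply_symm_apply _).trans ?_
      refine Eq.trans ?_ (map_smul (splitTwo t.length (k + 1) H) (fRat q a z)
        (nestedVacuum (t.length + 2) k v)).symm
      refine (congrArg (braid _ (k + 1) q a z) (splitTwo_nestedVacuum t.length v)).trans ?_
      refine (braid_single_single ..).trans ?_
      exact congrArg (fRat q a z • ·) (splitTwo_nestedVacuum t.length v).symm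
    · rw [rowProd_cons_cons, rowProd_cons_cons, hT.row_row htP.1 htP.2.1 ht.1.1]
      refine Finset.sum_congr rfl fun x _ => congrArg _ (Finset.sum_congr rfl fun y _ =>
        congrArg _ ?_)
      rw [← map_braid]
      exact congrArg (rowProd T t) (congrFun (congrFun
        ((splitTwo t.length (k + 1) H).apply_symm_apply _) x) y)
  | @trans t₁ t₂ t₃ h₁₂ _ ih₁ ih₂ =>
    obtain ⟨c, hc, ρ, h₁, h₂, h₃⟩ := ih₁ htP ht
    obtain ⟨c', hc', ρ', h₁', h₂', h₃'⟩ := ih₂ (fun x hx => htP x (h₁₂.mem_iff.2 hx))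
      (h₁₂.nodup_iff.1 ht)
    refine ⟨c * c', mul_ne_zero hc hc', ρ' ∘ₗ ρ, fun u hu i j Y => ?_, fun v => ?_, fun Y => ?_⟩
    · rw [LinearMap.comp_apply, h₁ u hu, h₁' u (fun h => hu (h₁₂.mem_iff.2 h))]; rfl
    · rw [LinearMap.comp_apply, h₂, map_smul, h₂', smul_smul]
    · rw [LinearMap.comp_apply, h₃', h₃, smul_smul, mul_comm]

/-- Bethe vectors do not depend on the order of the parameters. -/
theorem preBethe_perm {q : ℂ} (hq : q ≠ 0) {N : ℕ} {P : Set ℂ}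
    {T : Fin (N + 1) → Fin (N + 1) → ℂ → Module.End ℂ H} (hT : Exchange q P T)
    (hf : ∀ x ∈ P, ∀ y ∈ P, x ≠ y → fRat q x y ≠ 0) (v : H) {t t' : Fin N → List ℂ}
    (ht : Separated P t) (h : ∀ ν, (t ν).Perm (t' ν)) :
    preBethe q N T v t = preBethe q N T v t' := by
  induction N generalizing H P with
  | zero => rfl
  | succ N ih =>
    obtain ⟨c, hc, ρ, h₁, h₂, h₃⟩ := exists_siteLink hq hT hf (h 0) (ht.1 0) (ht.2.1 0)
    have hset : P \ {x | x ∈ t' 0} = P \ {x | x ∈ t 0} := by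
      ext x; simp [(h 0).mem_iff]
    have e₁ := preBethe_map q (P := P \ {x | x ∈ t 0}) ρ (fun w hw i j y => h₁ w hw.2 i j y) ht.tail
      (nestedVacuum (t 0).length N v)
    rw [h₂, preBethe_smul q _ ht.tail] at e₁
    have e₂ := ih (hT.nestedMonodromy hq (t' 0)) (fun x hx y hy => hf x hx.1 y hy.1)
      (nestedVacuum (t' 0).length N v) (hset ▸ ht.tail) (fun ν => h ν.succ)
    have e₃ := h₃ (preBethe q N (nestedMonodromy q T (t 0)) (nestedVacuum (t 0).length N v)
      (fun ν => t ν.succ))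
    rw [e₁, map_smul, e₂] at e₃
    -- The constant enters once through the vacuum and once through the row product; being nonzero,
    -- it cancels.
    exact (smul_right_injective H hc e₃).symm

end Permutations

end UqAffine
end

noncomputable section
namespace UqAffine

/-! ### Stripping a parameter off the first colour. -/

section Strip

variable {H : Type*} [AddCommGroup H] [Module ℂ H] {k : ℕ}

theorem preBethe_succ (q : ℂ) {N : ℕ} (T : Fin (N + 2) → Fin (N + 2) → ℂ → Module.End ℂ H) (v : H)
    {t : Fin (N + 1) → List ℂ} {l : List ℂ} {r : Fin N → List ℂ} (h₀ : t 0 = l)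
    (h : ∀ ν, t ν.succ = r ν) :
    preBethe q (N + 1) T v t =
      rowProd T l (preBethe q N (nestedMonodromy q T l) (nestedVacuum l.length N v) r) := by
  subst h₀
  obtain rfl : (fun ν => t ν.succ) = r := funext h
  rfl

/-- Moving an added site through the parameters of the first colour. -/
theorem exists_addSiteLink {q : ℂ} (hq : q ≠ 0)
    (T : Fin (k + 2) → Fin (k + 2) → ℂ → Module.End ℂ H) {z : ℂ} {l : List ℂ} (hl : (z :: l).Nodup) :
    ∃ φ : SiteSpace l.length (k + 1) (Fin (k + 2) → H) →ₗ[ℂ]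
        (Fin (k + 1) → SiteSpace l.length (k + 1) H),
      (∀ u, u ∉ z :: l → ∀ i j Y, (∀ κ, Y κ 0 = 0) →
        φ (nestedMonodromy q (addSite q T z) l i j u Y) =
          addSite q (nestedMonodromy q T l) z i j u (φ Y)) ∧
      (∀ v, φ (nestedVacuum l.length k (Pi.single 1 v)) =
        fProd q l [z] • (Pi.single 0 (nestedVacuum l.length k v) :
          Fin (k + 1) → SiteSpace l.length (k + 1) H)) ∧
      ∀ Y, (∀ κ, Y κ 0 = 0) → rowProd (addSite q T z) l Y 0 = 0 ∧
        ∀ s : Fin (k + 1), rowProd (addSite q T z) l Y s.succ = rowProd T l (φ Y s) := by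
  induction l with
  | nil =>
    refine ⟨LinearMap.pi fun s => LinearMap.pi fun κ => LinearMap.proj s.succ ∘ₗ LinearMap.proj κ,
      fun u hu i j Y hY => ?_, fun v => ?_, fun Y hY => ⟨?_, fun s => ?_⟩⟩
    · funext s κ
      change nestedMonodromy q (addSite q T z) [] i j u Y κ s.succ = _
      rw [nestedMonodromy_nil, addSite_apply, addSite_apply]
      simp only [Fin.succ_inj]
      rw [Pi.add_apply, nestedMonodromy_nil]
      refine congrArg _ ?_
      split_ifs with h
      · rw [Fin.sum_univ_succ, hY, map_zero, smul_zero, zero_add, Finset.sum_apply]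
        refine Finset.sum_congr rfl fun c _ => ?_
        rw [Pi.smul_apply, nestedMonodromy_nil, exchCoeff_succ]
        rfl
      · rfl
    · funext s κ
      have hκ : κ = fun _ => 0 := funext fun p => p.elim0
      subst hκ
      simp only [nestedVacuum, LinearMap.pi_apply, LinearMap.comp_apply, LinearMap.proj_apply,
        Pi.single_eq_same, fProd, List.map_nil, List.prod_nil, one_smul]
      by_cases hs : s = 0
      · subst hs; simp
      · have : s.succ ≠ 1 := fun h => hs (Fin.succ_inj.1 (h.trans Fin.succ_zero_eq_one.symm))
        simp [hs, this]
    · rw [rowProd_nil _ Y Fin.elim0, hY]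
    · rw [rowProd_nil _ Y Fin.elim0, rowProd_nil _ _ Fin.elim0]
      rfl
  | cons a l ih =>
    simp only [List.nodup_cons, List.mem_cons, not_or] at hl
    obtain ⟨φ, h₁, h₂, h₃⟩ := ih (List.nodup_cons.2 ⟨hl.1.2, hl.2.2⟩)
    -- The site of z starts innermost, with its component 0 discarded, and is braided past the sites
    -- of l one at a time. Each braid contributes a factor f(a,z) on the vacuum.
    let φ' : SiteSpace (a :: l).length (k + 1) (Fin (k + 2) → H) →ₗ[ℂ]
        (Fin (k + 1) → SiteSpace (a :: l).length (k + 1) H) :=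
      LinearMap.pi (fun x => (splitSite l.length (k + 1) H).symm.toLinearMap ∘ₗ LinearMap.proj x) ∘ₗ
        braid (SiteSpace l.length (k + 1) H) (k + 1) q a z ∘ₗ
        LinearMap.pi (fun b => φ ∘ₗ LinearMap.proj b) ∘ₗ
        (splitSite l.length (k + 1) (Fin (k + 2) → H)).toLinearMap
    have hφ' : ∀ Y x, splitSite l.length (k + 1) H (φ' Y x) =
        braid (SiteSpace l.length (k + 1) H) (k + 1) q a z
          (fun b => φ (splitSite l.length (k + 1) _ Y b)) x := fun Y x =>
      (splitSite l.length (k + 1) H).apply_symm_apply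
        (braid (SiteSpace l.length (k + 1) H) (k + 1) q a z
          (fun b => φ (splitSite l.length (k + 1) _ Y b)) x)
    refine ⟨φ', fun u hu i j Y hY => ?_, fun v => ?_, fun Y hY => ?_⟩
    · simp only [List.mem_cons, not_or] at hu
      funext x
      apply (splitSite l.length (k + 1) H).injective
      refine (hφ' _ x).trans ?_
      refine Eq.trans ?_ (congrFun (addSite_map (splitSite l.length (k + 1) H).toLinearMap q z u
        (fun i j y => splitSite_nestedMonodromy q T a l i j u y) i j (φ' Y)) x).symm
      have e : (fun b => φ (splitSite l.length (k + 1) (Fin (k + 2) → H)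
          (nestedMonodromy q (addSite q T z) (a :: l) i j u Y) b)) =
          addSite q (addSite q (nestedMonodromy q T l) z) a i j u
            (fun b => φ (splitSite l.length (k + 1) (Fin (k + 2) → H) Y b)) := by
        rw [splitSite_nestedMonodromy]
        exact addSite_map_apply φ q a u _ (fun i j s => h₁ u (by simp [hu]) i j _ fun κ => hY _) i j
      rw [e, braid_addSite hq _ hu.2.1 hu.1 (fun h => hl.1.1 h.symm)]
      exact congrArg (fun y => addSite q (addSite q (nestedMonodromy q T l) a) z i j u y x)
        (funext fun x => (hφ' Y x).symm)
    · funext x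
      apply (splitSite l.length (k + 1) H).injective
      refine (hφ' _ x).trans ?_
      have e : (fun b => φ (splitSite l.length (k + 1) (Fin (k + 2) → H)
          (nestedVacuum (l.length + 1) k (Pi.single 1 v)) b)) =
          fProd q l [z] • (Pi.single 0 (Pi.single 0 (nestedVacuum l.length k v)) :
            Fin (k + 1) → Fin (k + 1) → SiteSpace l.length (k + 1) H) := by
        rw [splitSite_nestedVacuum]
        funext b
        by_cases hb : b = 0
        · subst hb; simp [h₂]
        · simp [hb]
      refine (congrArg (fun y => braid _ (k + 1) q a z y x) e).trans ?_
      rw [map_smul, braid_single_single, smul_smul, fProd_cons_singleton, mul_comm]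
      rw [Pi.smul_apply, Pi.smul_apply, map_smul]
      congr 1
      by_cases hx : x = 0
      · subst hx
        rw [Pi.single_eq_same, Pi.single_eq_same]
        exact (splitSite_nestedVacuum _ _ _).symm
      · simp [hx]
    · have h := fun b => h₃ (splitSite l.length (k + 1) _ Y b) (fun κ => hY _)
      rw [rowProd_cons]
      refine ⟨?_, fun s => ?_⟩
      · rw [Finset.sum_apply]
        refine Finset.sum_eq_zero fun b _ => ?_
        rw [addSite_apply, (h b).1, if_neg (Fin.succ_ne_zero b).symm, map_zero, add_zero]
      · rw [rowProd_cons, Finset.sum_apply]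
        simp only [addSite_apply, (h _).2, Fin.succ_inj, Finset.sum_add_distrib]
        rw [Finset.sum_ite_eq, if_pos (Finset.mem_univ _), Fin.sum_univ_succ (n := k + 1), (h s).1, map_zero,
          smul_zero, zero_add, ← Finset.sum_add_distrib]
        refine Finset.sum_congr rfl fun c _ => ?_
        rw [(h s).2, exchCoeff_succ, ← map_smul, ← map_smul, ← map_add, ← map_add]
        exact congrArg (fun y => T 0 c.succ a (rowProd T l y)) (congrFun (hφ' Y s) c).symm

/-- Stripping a parameter of the first colour off a Bethe vector. -/
theorem fProd_smul_preBethe_first {q : ℂ} (hq : q ≠ 0) {N : ℕ} {P : Set ℂ}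
    (T : Fin (N + 2) → Fin (N + 2) → ℂ → Module.End ℂ H) (v : H) {z : ℂ}
    {t t' : Fin (N + 1) → List ℂ} (ht : Separated P t') (h₀ : t' 0 = z :: t 0)
    (h : ∀ ν : Fin N, t' ν.succ = t ν.succ) :
    fProd q (t 0) [z] • preBethe q (N + 1) T v t' = ∑ k : Fin (N + 2), T 0 k z
      (preBethe q (N + 1) (addSite q T z) (Pi.single 1 v) t k) := by
  have hnd : (z :: t 0).Nodup := h₀ ▸ ht.2.1 0
  obtain ⟨φ, h₁, h₂, h₃⟩ := exists_addSiteLink hq T hnd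
  have htail := ht.tail
  simp only [h, h₀] at htail
  obtain ⟨hY, hYe⟩ := preBethe_intertwine q (P := P \ {x | x ∈ z :: t 0})
    (T := nestedMonodromy q (addSite q T z) (t 0))
    (T' := addSite q (nestedMonodromy q T (t 0)) z) φ
    -- The site starts in the second basis vector, and the nested monodromy only uses nonzero column
    -- indices, which never feed the component 0. This condition needs no reserve of points.
    (fun _ => { carrier := {Y | ∀ κ, Y κ 0 = 0}
                add_mem' := fun h h' κ => by rw [Pi.add_apply, Pi.add_apply, h, h', add_zero]
                zero_mem' := fun κ => rfl
                smul_mem' := fun c _ h κ => by rw [Pi.smul_apply, Pi.smul_apply, h, smul_zero] })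
    (fun w hw A _ i j y hy κ => by
      rw [nestedMonodromy_apply, Finset.sum_apply]
      refine Finset.sum_eq_zero fun c _ => ?_
      rw [Finset.sum_apply]
      refine Finset.sum_eq_zero fun κ' _ => ?_
      rw [Pi.smul_apply, addSite_apply, hy κ', if_neg (Fin.succ_ne_zero c).symm]
      simp)
    (fun w hw A _ i j y hy => h₁ w hw.2 i j y hy) htail ∅ (by simp)
    (nestedVacuum (t 0).length N (Pi.single 1 v))
    (by
      intro κ
      unfold nestedVacuum
      by_cases h : κ = fun _ => 0
      · subst h; simp
      · simp [h])
  obtain ⟨h₄, h₅⟩ := h₃ _ hY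
  rw [preBethe_succ q T v h₀ h, preBethe_succ q (addSite q T z) _ rfl (fun _ => rfl),
    Fin.sum_univ_succ, h₄, map_zero, zero_add]
  simp only [h₅]
  rw [hYe, h₂, preBethe_smul q _ htail, rowProd_cons, Finset.smul_sum]
  refine Finset.sum_congr rfl fun c _ => ?_
  rw [Pi.smul_apply, map_smul, map_smul]
  have hp := preBethe_map q (splitSite (t 0).length (N + 1) H).toLinearMap
    (fun w _ i j y => splitSite_nestedMonodromy q T z (t 0) i j w y) htail
    (nestedVacuum (z :: t 0).length N v)
  have hs := splitSite_nestedVacuum (t 0).length N v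
  erw [hs] at hp
  exact congrArg (fun y => fProd q (t 0) [z] • T 0 c.succ z (rowProd T (t 0) y)) (congrFun hp c)

end Strip

end UqAffine
end

noncomputable section
namespace UqAffine

/-! ### Sites added on the left, and stripping a parameter off the last colour. -/

section LeftSite

variable {H : Type*} [AddCommGroup H] [Module ℂ H] {k : ℕ}

/-- The monodromy matrix `R_{1,0}(a,u) T(u)`, acting in `H ⊗ ℂᵏ`. -/
def leftSite (q : ℂ) (T : Fin k → Fin k → ℂ → Module.End ℂ H) (a : ℂ) (i j : Fin k) (u : ℂ) :
    Module.End ℂ (Fin k → H) :=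
  LinearMap.pi fun s => T i j u ∘ₗ LinearMap.proj s +
    if s = i then ∑ c, exchCoeff q a u c i • (T c j u ∘ₗ LinearMap.proj c) else 0

theorem Separated.strip {P : Set ℂ} {N : ℕ} {t t' : Fin N → List ℂ} (ht : Separated P t')
    {μ : Fin N} {z : ℂ} (hμ : t' μ = z :: t μ) (h : ∀ ν, ν ≠ μ → t' ν = t ν) :
    Separated (P \ {z}) t := by
  have hsub : ∀ ν, (t ν).Sublist (t' ν) := fun ν => by
    by_cases e : ν = μ
    · subst e; rw [hμ]; exact List.sublist_cons_self _ _
    · rw [h ν e]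
  refine ⟨fun ν x hx => ⟨ht.1 ν x ((hsub ν).subset hx), ?_⟩, fun ν => (ht.2.1 ν).sublist (hsub ν),
    fun ν ν' hne x hx hx' => ht.2.2 ν ν' hne x ((hsub ν).subset hx) ((hsub ν').subset hx')⟩
  rintro rfl
  by_cases e : ν = μ
  · subst e
    have := ht.2.1 ν
    rw [hμ, List.nodup_cons] at this
    exact this.1 hx
  · exact ht.2.2 ν μ e x ((hsub ν).subset hx) (hμ ▸ List.mem_cons_self)

theorem leftSite_apply (q : ℂ) (T : Fin k → Fin k → ℂ → Module.End ℂ H) (a : ℂ) (i j : Fin k)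
    (u : ℂ) (y : Fin k → H) (s : Fin k) :
    leftSite q T a i j u y s = T i j u (y s) +
      if s = i then ∑ c, exchCoeff q a u c i • T c j u (y c) else 0 := by
  simp only [leftSite, LinearMap.pi_apply, LinearMap.add_apply]
  split_ifs <;> simp

/-- The reversal of the standard basis of `ℂᵏ`. -/
def revSite (k : ℕ) (H : Type*) [AddCommGroup H] [Module ℂ H] : (Fin k → H) →ₗ[ℂ] (Fin k → H) :=
  LinearMap.pi fun s => LinearMap.proj s.rev

theorem revSite_apply (y : Fin k → H) (s : Fin k) : revSite k H y s = y s.rev := rfl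

/-- The reflection turns R(a,u)T(u) into T(u)R(u,a) over q⁻¹, up to reversing the basis of the site.
-/
theorem revSite_flip_leftSite (q : ℂ) (T : Fin k → Fin k → ℂ → Module.End ℂ H) (a : ℂ)
    (i j : Fin k) (u : ℂ) (y : Fin k → H) :
    revSite k H (flip (leftSite q T a) i j u y) = addSite q⁻¹ (flip T) a i j u (revSite k H y) := by
  funext s
  rw [revSite_apply, addSite_apply, flip, leftSite_apply]
  refine congrArg _ ?_
  simp only [Fin.rev_inj]
  split_ifs with h
  · rw [← Equiv.sum_comp Fin.revPerm]
    refine Finset.sum_congr rfl fun c _ => ?_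
    rw [Fin.revPerm_apply, ← exchCoeff_inv_rev, Fin.rev_rev, Fin.rev_rev]
    rfl
  · rfl

/-- Follows from `Exchange.addSite` by conjugating with `flip`, without a second use of the
Yang–Baxter equation. -/
theorem Exchange.leftSite {q : ℂ} (hq : q ≠ 0) {P : Set ℂ}
    {T : Fin k → Fin k → ℂ → Module.End ℂ H} (h : Exchange q P T) (a : ℂ) :
    Exchange q (P \ {a}) (leftSite q T a) := by
  have h' := (Exchange.of_injective (T := UqAffine.flip (UqAffine.leftSite q T a)) (revSite k H)
    (fun y y' e => funext fun s => by simpa [revSite_apply] using congrFun e s.rev)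
    (fun i j u y => revSite_flip_leftSite q T a i j u y)
    (h.flip.addSite (inv_ne_zero hq) a)).flip
  rwa [flip_flip, inv_inv] at h'

/-- The extension of the site by a basis vector, with component zero. -/
def siteCons (r k : ℕ) (H : Type*) [AddCommGroup H] [Module ℂ H] :
    (Fin k → SiteSpace r k H) →ₗ[ℂ] SiteSpace r k (Fin (k + 1) → H) where
  toFun Z κ := Fin.cons 0 fun s => Z s κ
  map_add' Z Z' := by
    funext κ s
    refine Fin.cases ?_ (fun s => ?_) s <;> simp
  map_smul' c Z := by
    funext κ s
    refine Fin.cases ?_ (fun s => ?_) s <;> simp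

theorem siteCons_apply_zero (r : ℕ) (Z : Fin k → SiteSpace r k H) (κ : Fin r → Fin k) :
    siteCons r k H Z κ 0 = 0 := rfl

theorem siteCons_apply_succ (r : ℕ) (Z : Fin k → SiteSpace r k H) (κ : Fin r → Fin k) (s : Fin k) :
    siteCons r k H Z κ s.succ = Z s κ := rfl

/-- The nested R-matrices multiply T from the right and the new one from the left, so the two
constructions commute; row indices above 0 keep the component 0 of the left site equal to zero. -/
theorem siteCons_leftSite (q : ℂ) (T : Fin (k + 1) → Fin (k + 1) → ℂ → Module.End ℂ H) (z : ℂ)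
    (l : List ℂ) (i j : Fin k) (u : ℂ) (Z : Fin k → SiteSpace l.length k H) :
    siteCons l.length k H (leftSite q (nestedMonodromy q T l) z i j u Z) =
      nestedMonodromy q (leftSite q T z) l i j u (siteCons l.length k H Z) := by
  funext κ s
  rw [nestedMonodromy_apply]
  simp only [Finset.sum_apply, Pi.smul_apply, leftSite_apply]
  refine Fin.cases ?_ (fun s => ?_) s
  · simp [siteCons_apply_zero, (Fin.succ_ne_zero _).symm]
  · simp only [siteCons_apply_succ, leftSite_apply, Fin.succ_inj, smul_add, Finset.sum_add_distrib,
      Pi.add_apply]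
    rw [nestedMonodromy_apply]
    refine congrArg _ ?_
    split_ifs with h
    · simp only [Fin.sum_univ_succ (n := k), siteCons_apply_zero, siteCons_apply_succ, map_zero,
        smul_zero, zero_add, exchCoeff_succ, Finset.sum_apply, Pi.smul_apply,
        nestedMonodromy_apply, Finset.smul_sum]
      rw [Finset.sum_comm]
      refine Finset.sum_congr rfl fun c _ => ?_
      rw [Finset.sum_comm]
      exact Finset.sum_congr rfl fun κ' _ => Finset.sum_congr rfl fun d _ => smul_comm _ _ _
    · simp

theorem siteCons_single (r : ℕ) (i : Fin (k + 1)) (v : H) :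
    siteCons r (k + 1) H (Pi.single i (nestedVacuum r k v)) =
      nestedVacuum r k (Pi.single i.succ v) := by
  funext κ s
  unfold nestedVacuum
  refine Fin.cases ?_ (fun s => ?_) s
  · rw [siteCons_apply_zero]
    by_cases h : κ = fun _ => 0
    · subst h; simp [Fin.succ_ne_zero]
    · simp [h]
  · rw [siteCons_apply_succ]
    by_cases hs : s = i
    · subst hs
      by_cases h : κ = fun _ => 0
      · subst h; simp
      · simp [h]
    · by_cases h : κ = fun _ => 0
      · subst h; simp [hs]
      · simp [h, hs]

/-- A column at z is carried leftwards through the row. In each exchange relation between T_{c,j}(z)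
and T_{0,m}(a), the column exchange is the action of the nested site of a, and the row exchange is
the action of the left site of z. -/
theorem rowProd_leftSite {q : ℂ} {P : Set ℂ}
    {T : Fin (k + 1) → Fin (k + 1) → ℂ → Module.End ℂ H} (hT : Exchange q P T) {z : ℂ} (hz : z ∈ P)
    (l : List ℂ) (hl : ∀ x ∈ l, x ∈ P) (hzl : z ∉ l) (j : Fin k)
    (Z : Fin k → SiteSpace l.length k H) :
    rowProd T l (∑ c, nestedMonodromy q T l c j z (Z c)) =
      ∑ c, T c j.succ z (rowProd (leftSite q T z) l (siteCons l.length k H Z) c) := by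
  induction l generalizing j with
  | nil =>
    rw [rowProd_nil _ _ Fin.elim0, rowProd_nil _ _ Fin.elim0, Fin.sum_univ_succ (n := k),
      siteCons_apply_zero, map_zero, zero_add, Finset.sum_apply]
    exact Finset.sum_congr rfl fun c _ => nestedMonodromy_nil ..
  | cons a l ih =>
    simp only [List.mem_cons, forall_eq_or_imp, not_or] at hl hzl
    set X : Fin k → Fin (k + 1) → H := fun m =>
      rowProd (leftSite q T z) l (siteCons l.length k H fun c => splitSite l.length k H (Z c) m)
    have ih' : ∀ m d, rowProd T l (∑ c, nestedMonodromy q T l c d z (splitSite l.length k H (Z c) m)) =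
        ∑ c, T c d.succ z (X m c) := fun m d => ih hl.2 hzl.2 d _
    have hm : ∀ m, splitSite l.length k H (∑ c, nestedMonodromy q T (a :: l) c j z (Z c)) m =
        ∑ c, nestedMonodromy q T l c j z (splitSite l.length k H (Z c) m) +
          if m = j then ∑ d, exchCoeff q z a d j •
            ∑ c, nestedMonodromy q T l c d z (splitSite l.length k H (Z c) d) else 0 := by
      intro m
      have e := map_sum (splitSite l.length k H) (fun c => nestedMonodromy q T (a :: l) c j z (Z c))
        Finset.univ
      refine (congrFun e m).trans ?_
      rw [Finset.sum_apply, ← Finset.sum_congr rfl fun c _ =>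
        (congrFun (splitSite_nestedMonodromy q T a l c j z (Z c)) m).symm]
      simp only [addSite_apply, Finset.sum_add_distrib]
      refine congrArg _ ?_
      split_ifs with h
      · rw [Finset.sum_comm]
        simp only [Finset.smul_sum]
      · simp
    have hrow : rowProd (leftSite q T z) (a :: l) (siteCons (a :: l).length k H Z) =
        ∑ m : Fin k, leftSite q T z 0 m.succ a (X m) := rowProd_cons ..
    have hL : ∀ m, T 0 m.succ a (rowProd T l
        (splitSite l.length k H (∑ c, nestedMonodromy q T (a :: l) c j z (Z c)) m)) =
        ∑ c, T 0 m.succ a (T c j.succ z (X m c)) +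
          if m = j then ∑ d, ∑ c, exchCoeff q z a d j • T 0 j.succ a (T c d.succ z (X d c))
          else 0 := by
      intro m
      rw [hm, map_add, map_add, ih', map_sum]
      refine congrArg _ ?_
      split_ifs with h
      · subst h
        rw [map_sum, map_sum]
        refine Finset.sum_congr rfl fun d _ => ?_
        rw [map_smul, map_smul, ih', map_sum, Finset.smul_sum]
      · simp
    have hR : ∀ c, T c j.succ z ((∑ m : Fin k, leftSite q T z 0 m.succ a (X m)) c) =
        ∑ m, T c j.succ z (T 0 m.succ a (X m c)) +
          if c = 0 then ∑ m : Fin k, ∑ d, exchCoeff q z a d 0 • T 0 j.succ z (T d m.succ a (X m d))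
          else 0 := by
      intro c
      simp only [Finset.sum_apply, leftSite_apply, map_sum, map_add, Finset.sum_add_distrib]
      refine congrArg _ ?_
      split_ifs with h
      · subst h
        simp only [map_sum, map_smul]
      · simp
    rw [rowProd_cons, hrow, Finset.sum_congr rfl (fun m _ => hL m),
      Finset.sum_congr rfl (fun c _ => hR c), Finset.sum_add_distrib, Finset.sum_add_distrib,
      Finset.sum_ite_eq', Finset.sum_ite_eq', if_pos (Finset.mem_univ _),
      if_pos (Finset.mem_univ _), ← Finset.sum_add_distrib]
    refine Eq.trans ?_ (congrArg₂ (· + ·) Finset.sum_comm rfl)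
    rw [← Finset.sum_add_distrib]
    refine Finset.sum_congr rfl fun m _ => ?_
    rw [← Finset.sum_add_distrib, ← Finset.sum_add_distrib]
    refine Finset.sum_congr rfl fun c _ => ?_
    rw [hT.apply hz hl.1 hzl.1 c j.succ 0 m.succ, exchCoeff_succ]

/-- Stripping a parameter of the last colour off a Bethe vector. -/
theorem fProd_smul_preBethe_last {q : ℂ} (hq : q ≠ 0) {N : ℕ} {P : Set ℂ}
    {T : Fin (N + 2) → Fin (N + 2) → ℂ → Module.End ℂ H} (hT : Exchange q P T) (v : H) {z : ℂ}
    {t t' : Fin (N + 1) → List ℂ} (ht : Separated P t')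
    (hlast : t' (Fin.last N) = z :: t (Fin.last N))
    (h : ∀ ν : Fin N, t' ν.castSucc = t ν.castSucc) :
    fProd q [z] (t (Fin.last N)) • preBethe q (N + 1) T v t' =
      ∑ k : Fin (N + 2), T k (Fin.last (N + 1)) z (preBethe q (N + 1) (leftSite q T z)
        (Pi.single (Fin.last N).castSucc v) t k) := by
  induction N generalizing H P with
  | zero =>
    -- With a single colour each T_{01}(a) keeps the first basis vector of the left site and
    -- multiplies it by f(z,a).
    have aux : ∀ (l : List ℂ) (Y : SiteSpace l.length 1 H),
        rowProd (leftSite q T z) l (siteMap l.length 1 (LinearMap.single ℂ (fun _ : Fin 2 => H) 0) Y) =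
          fProd q [z] l • Pi.single 0 (rowProd T l Y) := by
      intro l
      induction l with
      | nil =>
        intro Y
        rw [rowProd_nil _ _ Fin.elim0, rowProd_nil _ _ Fin.elim0, siteMap_apply]
        simp [fProd]
      | cons a l ih =>
        intro Y
        have e : rowProd (leftSite q T z) (a :: l)
            (siteMap (a :: l).length 1 (LinearMap.single ℂ (fun _ : Fin 2 => H) 0) Y) =
            ∑ m : Fin 1, leftSite q T z 0 m.succ a (rowProd (leftSite q T z) l
              (siteMap l.length 1 (LinearMap.single ℂ (fun _ : Fin 2 => H) 0)
                (splitSite l.length 1 H Y m))) := rowProd_cons ..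
        rw [e, rowProd_cons, Fin.sum_univ_one, Fin.sum_univ_one, ih, map_smul, fProd_singleton_cons,
          mul_comm, mul_smul]
        congr 1
        funext s
        rw [leftSite_apply]
        fin_cases s
        · have e' : fRat q z a = 1 + exchCoeff q z a (0 : Fin 2) 0 := fRat_eq_one_add ..
          simp [e', add_smul]
        · simp
    rw [preBethe_succ q T v (r := Fin.elim0) hlast (fun ν => ν.elim0),
      preBethe_succ q (leftSite q T z) _ rfl (fun _ => rfl)]
    have e := aux (t (Fin.last 0)) (nestedVacuum (t (Fin.last 0)).length 0 v)
    rw [siteMap_nestedVacuum] at e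
    have e' : rowProd (leftSite q T z) (t 0) (nestedVacuum (t 0).length 0 (Pi.single 0 v)) =
      fProd q [z] (t 0) • Pi.single 0 (rowProd T (t 0) (nestedVacuum (t 0).length 0 v)) := e
    change _ = ∑ k : Fin 2, T k 1 z
      (rowProd (leftSite q T z) (t 0) (nestedVacuum (t 0).length 0 (Pi.single 0 v)) k)
    rw [e', rowProd_cons, Fin.sum_univ_two, Fin.sum_univ_one]
    have hs : splitSite (t 0).length 1 H (nestedVacuum (z :: t 0).length 0 v) 0 =
        nestedVacuum (t 0).length 0 v :=
      (congrFun (splitSite_nestedVacuum (t 0).length 0 v) 0).trans (Pi.single_eq_same _ _)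
    have hs' : rowProd T (t 0) (splitSite (t 0).length 1 H
      (preBethe q 0 (nestedMonodromy q T (z :: t 0)) (nestedVacuum (z :: t 0).length 0 v)
        Fin.elim0) 0) = rowProd T (t 0) (nestedVacuum (t 0).length 0 v) :=
      congrArg (rowProd T (t 0)) hs
    refine (congrArg (fun y => fProd q [z] (t 0) • T 0 1 z y) hs').trans ?_
    simp
  | succ N ih =>
    have h₀ : t' 0 = t 0 := h 0
    have htail := ht.tail
    have hzP : z ∈ P := ht.1 (Fin.last _) z (hlast ▸ List.mem_cons_self)
    have hz0 : z ∉ t 0 := h₀ ▸ ht.2.2 (Fin.last _) 0 (Fin.succ_ne_zero (Fin.last N)) z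
      (hlast ▸ List.mem_cons_self)
    have hlast' : t' (Fin.last N).succ = z :: t (Fin.last N).succ := hlast
    -- The parameter z is stripped off inside the nested chain, and `rowProd_leftSite` then brings
    -- the resulting column out of the first-colour row.
    have i₁ := ih (hT.nestedMonodromy hq (t 0)) (nestedVacuum (t 0).length (N + 1) v)
      (t := fun ν => t ν.succ) (t' := fun ν => t' ν.succ) (h₀ ▸ htail) hlast' (fun ν => h ν.succ)
    rw [preBethe_succ q T v h₀ (fun _ => rfl),
      preBethe_succ q (leftSite q T z) _ (t := t) rfl (fun _ => rfl)]
    have hl := rowProd_leftSite hT hzP (t 0) (fun x hx => ht.1 0 x (h₀ ▸ hx)) hz0 (Fin.last (N + 1))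
      (preBethe q (N + 1) (leftSite q (nestedMonodromy q T (t 0)) z)
        (Pi.single (Fin.last N).castSucc (nestedVacuum (t 0).length (N + 1) v)) (fun ν => t ν.succ))
    have hsep : Separated (P \ {x | x ∈ t 0}) (fun ν : Fin (N + 1) => t ν.succ) := by
      have hs := Separated.strip (t := fun ν => t ν.succ) htail hlast' fun ν hν =>
        Fin.lastCases (motive := fun ν => ν ≠ Fin.last N → t' ν.succ = t ν.succ)
          (fun h => (h rfl).elim) (fun ν _ => h ν.succ) ν hν
      exact hs.mono fun ν x hx => h₀ ▸ (hs.1 ν x hx).1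
    have hp := preBethe_map q (siteCons (t 0).length (N + 2) H)
      (fun w _ i j y => siteCons_leftSite q T z (t 0) i j w y) hsep
      (Pi.single (Fin.last N).castSucc (nestedVacuum (t 0).length (N + 1) v))
    rw [siteCons_single] at hp
    rw [hp] at hl
    refine Eq.trans ?_ hl
    rw [← i₁, map_smul]
    rfl

end LeftSite

end UqAffine
end

noncomputable section
namespace UqAffine

/-! ### Empty colours and the reflection symmetry. -/

section Blocks

variable {H : Type*} [AddCommGroup H] [Module ℂ H] {k : ℕ}

/-- The upper left block of a monodromy matrix. -/
def upperBlock (T : Fin (k + 1) → Fin (k + 1) → ℂ → Module.End ℂ H) (i j : Fin k) (u : ℂ) :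
    Module.End ℂ H := T i.castSucc j.castSucc u

theorem Exchange.upperBlock {q : ℂ} {P : Set ℂ}
    {T : Fin (k + 1) → Fin (k + 1) → ℂ → Module.End ℂ H} (h : Exchange q P T) :
    Exchange q P (upperBlock T) := by
  intro u hu v hv huv i j a b
  have := h u hu v hv huv i.castSucc j.castSucc a.castSucc b.castSucc
  simpa only [exchCoeff_castSucc, UqAffine.upperBlock] using this

theorem lowerBlock_flip (T : Fin (k + 1) → Fin (k + 1) → ℂ → Module.End ℂ H) :
    lowerBlock (flip T) = flip (upperBlock T) := by
  funext i j u
  simp [lowerBlock, flip, upperBlock, Fin.rev_succ]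

theorem preBethe_of_first_nil (q : ℂ) {N : ℕ} {P : Set ℂ}
    (T : Fin (N + 2) → Fin (N + 2) → ℂ → Module.End ℂ H) (v : H) {t : Fin (N + 1) → List ℂ}
    (ht : Separated P t) (h : t 0 = []) :
    preBethe q (N + 1) T v t = preBethe q N (lowerBlock T) v (fun ν => t ν.succ) := by
  rw [preBethe_succ q T v h (fun _ => rfl), rowProd_nil _ _ Fin.elim0]
  have := preBethe_map q (T := nestedMonodromy q T []) (T' := lowerBlock T)
    (LinearMap.proj (Fin.elim0 : Fin ([] : List ℂ).length → Fin (N + 1)) :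
      SiteSpace ([] : List ℂ).length (N + 1) H →ₗ[ℂ] H)
    (fun w _ i j y => nestedMonodromy_nil ..) ht.tail (nestedVacuum ([] : List ℂ).length N v)
  refine this.trans ?_
  congr 1
  have hκ : (Fin.elim0 : Fin ([] : List ℂ).length → Fin (N + 1)) = fun _ => 0 :=
    funext fun p => p.elim0
  rw [hκ]
  simp [nestedVacuum]

/-- Extension by zero to the site spaces with one more basis vector. -/
theorem exists_blockEmbedding (q : ℂ) (T : Fin (k + 3) → Fin (k + 3) → ℂ → Module.End ℂ H)
    (l : List ℂ) :
    ∃ φ : SiteSpace l.length (k + 1) H →ₗ[ℂ] SiteSpace l.length (k + 2) H,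
      (∀ u i j Y, φ (nestedMonodromy q (upperBlock T) l i j u Y) =
        upperBlock (nestedMonodromy q T l) i j u (φ Y)) ∧
      (∀ v, φ (nestedVacuum l.length k v) = nestedVacuum l.length (k + 1) v) ∧
      ∀ Y, rowProd T l (φ Y) = rowProd (upperBlock T) l Y := by
  induction l with
  | nil =>
    refine ⟨LinearMap.pi fun κ => LinearMap.proj Fin.elim0, fun u i j Y => ?_, fun v => ?_,
      fun Y => ?_⟩
    · funext κ
      change nestedMonodromy q (upperBlock T) [] i j u Y Fin.elim0 =
        nestedMonodromy q T [] i.castSucc j.castSucc u _ κ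
      rw [nestedMonodromy_nil, nestedMonodromy_nil]
      rfl
    · funext κ
      have hκ : κ = fun _ => 0 := funext fun p => p.elim0
      have hκ' : (Fin.elim0 : Fin ([] : List ℂ).length → Fin (k + 1)) = fun _ => 0 :=
        funext fun p => p.elim0
      subst hκ
      rw [LinearMap.pi_apply, hκ']
      simp [nestedVacuum]
    · rw [rowProd_nil _ _ Fin.elim0, rowProd_nil _ _ Fin.elim0]
      rfl
  | cons a l ih =>
    obtain ⟨φ, h₁, h₂, h₃⟩ := ih
    let ext : (Fin (k + 1) → SiteSpace l.length (k + 2) H) →ₗ[ℂ]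
        (Fin (k + 2) → SiteSpace l.length (k + 2) H) :=
      { toFun := fun y => Fin.snoc (α := fun _ => SiteSpace l.length (k + 2) H) y 0
        map_add' := fun y y' => by
          funext s
          refine Fin.lastCases ?_ (fun s => ?_) s <;> simp
        map_smul' := fun c y => by
          funext s
          refine Fin.lastCases ?_ (fun s => ?_) s <;> simp }
    have ext_cs : ∀ y s, ext y s.castSucc = y s := fun y s =>
      Fin.snoc_castSucc (α := fun _ => SiteSpace l.length (k + 2) H) 0 y s
    have ext_last : ∀ y, ext y (Fin.last _) = 0 := fun y =>
      Fin.snoc_last (α := fun _ => SiteSpace l.length (k + 2) H) 0 y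
    let φ' : SiteSpace (a :: l).length (k + 1) H →ₗ[ℂ] SiteSpace (a :: l).length (k + 2) H :=
      (splitSite l.length (k + 2) H).symm.toLinearMap ∘ₗ ext ∘ₗ
        LinearMap.pi (fun b => φ ∘ₗ LinearMap.proj b) ∘ₗ
        (splitSite l.length (k + 1) H).toLinearMap
    have hφ' : ∀ Y, splitSite l.length (k + 2) H (φ' Y) =
        ext (fun b => φ (splitSite l.length (k + 1) H Y b)) := fun Y =>
      (splitSite l.length (k + 2) H).apply_symm_apply
        (ext (fun b => φ (splitSite l.length (k + 1) H Y b)))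
    refine ⟨φ', fun u i j Y => ?_, fun v => ?_, fun Y => ?_⟩
    · apply (splitSite l.length (k + 2) H).injective
      refine (hφ' _).trans ?_
      refine Eq.trans ?_ (splitSite_nestedMonodromy q T a l i.castSucc j.castSucc u (φ' Y)).symm
      rw [hφ', splitSite_nestedMonodromy]
      funext s
      rw [addSite_apply]
      refine Fin.lastCases ?_ (fun s => ?_) s
      · rw [ext_last, ext_last, map_zero, if_neg (Fin.castSucc_lt_last j).ne', add_zero]
      · rw [ext_cs, ext_cs, addSite_apply, map_add, h₁]
        refine congrArg _ ?_
        simp only [Fin.castSucc_inj]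
        split_ifs with h
        · rw [Fin.sum_univ_castSucc (n := k + 1), ext_last, map_zero, smul_zero, add_zero, map_sum]
          refine Finset.sum_congr rfl fun c _ => ?_
          rw [map_smul, h₁, ext_cs, exchCoeff_castSucc]
          rfl
        · simp
    · apply (splitSite l.length (k + 2) H).injective
      refine (hφ' _).trans ?_
      refine Eq.trans ?_ (splitSite_nestedVacuum l.length (k + 1) v).symm
      funext s
      refine Fin.lastCases ?_ (fun s => ?_) s
      · rw [ext_last, Pi.single_eq_of_ne (Fin.last_pos (n := k)).ne']
      · rw [ext_cs]
        have e := congrFun (splitSite_nestedVacuum l.length k v) s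
        refine (congrArg φ e).trans ?_
        by_cases hs : s = 0
        · subst hs
          rw [Pi.single_eq_same, h₂]
          exact (Pi.single_eq_same (M := fun _ => SiteSpace l.length (k + 2) H) 0 _).symm
        · rw [Pi.single_eq_of_ne hs, Pi.single_eq_of_ne, map_zero]
          exact fun h => hs (Fin.castSucc_injective _ h)
    · rw [rowProd_cons, rowProd_cons, Fin.sum_univ_castSucc]
      have e : ∀ s, splitSite l.length (k + 2) H (φ' Y) s =
          ext (fun b => φ (splitSite l.length (k + 1) H Y b)) s := fun s => congrFun (hφ' Y) s
      simp only [e, ext_last, ext_cs, map_zero, add_zero, h₃]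
      rfl

/-- Without parameters of the last colour the last basis vector is never excited, so every nested
site can be cut down by one dimension. -/
theorem preBethe_of_last_nil (q : ℂ) {N : ℕ} {P : Set ℂ}
    (T : Fin (N + 2) → Fin (N + 2) → ℂ → Module.End ℂ H) (v : H) {t : Fin (N + 1) → List ℂ}
    (ht : Separated P t) (h : t (Fin.last N) = []) :
    preBethe q (N + 1) T v t = preBethe q N (upperBlock T) v (fun ν => t ν.castSucc) := by
  induction N generalizing H P with
  | zero =>
    rw [preBethe_of_first_nil q T v ht h]
    rfl
  | succ N ih =>
    obtain ⟨φ, h₁, h₂, h₃⟩ := exists_blockEmbedding q T (t 0)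
    have i := ih (nestedMonodromy q T (t 0)) (nestedVacuum (t 0).length (N + 1) v) ht.tail h
    have hsep : Separated (P \ {x | x ∈ t 0}) (fun ν : Fin N => t ν.succ.castSucc) :=
      ⟨fun ν => ht.tail.1 ν.castSucc, fun ν => ht.2.1 _,
        fun ν ν' hne => ht.2.2 _ _ fun e => hne (Fin.succ_injective _ (Fin.castSucc_injective _ e))⟩
    have hp := preBethe_map q (T := nestedMonodromy q (upperBlock T) (t 0)) φ
      (fun w _ i j y => h₁ w i j y) hsep (nestedVacuum (t 0).length N v)
    have hr := h₃ (preBethe q N (nestedMonodromy q (upperBlock T) (t 0))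
      (nestedVacuum (t 0).length N v) (fun ν => t ν.succ.castSucc))
    rw [hp, h₂] at hr
    exact (congrArg (rowProd T (t 0)) i).trans hr

/-- The Bethe vectors of the flipped monodromy matrix. -/
theorem preBethe_flip {q : ℂ} (hq : q ≠ 0) {N : ℕ} {P : Set ℂ}
    {T : Fin (N + 1) → Fin (N + 1) → ℂ → Module.End ℂ H} (hT : Exchange q P T)
    (hf : ∀ x ∈ P, ∀ y ∈ P, x ≠ y → fRat q x y ≠ 0) (v : H) {t : Fin N → List ℂ}
    (ht : Separated P t) :
    preBethe q N T v t = preBethe q⁻¹ N (flip T) v (fun ν => t ν.rev) := by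
  induction N generalizing H P with
  | zero => rfl
  | succ N ihN =>
    have hrev : ∀ {P : Set ℂ} {t : Fin (N + 1) → List ℂ}, Separated P t →
        Separated P (fun ν => t ν.rev) := fun h =>
      ⟨fun ν => h.1 _, fun ν => h.2.1 _, fun ν μ hne => h.2.2 _ _ fun e => hne (Fin.rev_inj.1 e)⟩
    -- Inner induction on the set of the last colour. The space, T and v are generalized, since
    -- stripping a parameter adds a site and changes the vacuum.
    obtain ⟨l, hl⟩ : ∃ l, t (Fin.last N) = l := ⟨_, rfl⟩
    induction l generalizing H P t with
    | nil =>
      rw [preBethe_of_last_nil q T v ht hl, preBethe_of_first_nil q⁻¹ (flip T) v (hrev ht)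
        (by rw [Fin.rev_zero]; exact hl), ihN hT.upperBlock hf v (t := fun ν => t ν.castSucc)
          ⟨fun ν => ht.1 _, fun ν => ht.2.1 _,
            fun ν ν' hne => ht.2.2 _ _ fun e => hne (Fin.castSucc_injective _ e)⟩, lowerBlock_flip]
      congr 1
      funext ν
      rw [Fin.rev_succ]
    | cons z l ih =>
      set r : Fin (N + 1) → List ℂ := Function.update t (Fin.last N) l with hr
      have hr₁ : r (Fin.last N) = l := Function.update_self ..
      have hr₂ : ∀ ν, ν ≠ Fin.last N → t ν = r ν := fun ν h => (Function.update_of_ne h _ _).symm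
      have hz : z ∈ P := ht.1 (Fin.last N) z (hl ▸ List.mem_cons_self)
      have hsep : Separated (P \ {z}) r := ht.strip (hr₁.symm ▸ hl) hr₂
      have e₁ := fProd_smul_preBethe_last hq hT v (t := r) ht (hr₁.symm ▸ hl)
        fun ν => hr₂ _ (Fin.castSucc_lt_last ν).ne
      have e₂ := fProd_smul_preBethe_first (inv_ne_zero hq) (flip T) v (t := fun ν => r ν.rev)
        (hrev ht) (z := z) (by simp only [Fin.rev_zero]; exact hr₁.symm ▸ hl)
        fun ν => hr₂ _ (by rw [Fin.rev_succ]; exact (Fin.castSucc_lt_last _).ne)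
      have e₃ := ih (hT.leftSite hq z) (fun x hx y hy => hf x hx.1 y hy.1)
        (Pi.single (Fin.last N).castSucc v) hsep hr₁
      have e₄ := preBethe_map q⁻¹ (revSite (N + 2) H)
        (fun w _ i j y => revSite_flip_leftSite q T z i j w y) (hrev hsep)
        (Pi.single (Fin.last N).castSucc v)
      have e₅ : revSite (N + 2) H (Pi.single (Fin.last N).castSucc v) = Pi.single 1 v := by
        funext s
        rw [revSite_apply]
        by_cases hs : s = 1
        · subst hs
          have : (1 : Fin (N + 2)).rev = (Fin.last N).castSucc := by
            rw [← Fin.succ_zero_eq_one, Fin.rev_succ, Fin.rev_zero]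
          rw [this]; simp
        · rw [Pi.single_eq_of_ne hs, Pi.single_eq_of_ne]
          intro h
          apply hs
          rw [← Fin.rev_rev s, h, Fin.rev_castSucc, Fin.rev_last, Fin.succ_zero_eq_one]
      rw [← e₃, e₅] at e₄
      -- The two strippings, from the last colour of T and from the first colour of its reflection,
      -- carry the same nonzero factor.
      have hc : fProd q⁻¹ (r (Fin.rev 0)) [z] = fProd q [z] (r (Fin.last N)) := by
        simp [fProd, fRat_inv_swap]
      have hc0 : fProd q [z] (r (Fin.last N)) ≠ 0 := by
        simp only [fProd, List.map_cons, List.map_nil, List.prod_cons, List.prod_nil, mul_one]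
        refine List.prod_ne_zero fun h => ?_
        obtain ⟨y, hy, hy'⟩ := List.mem_map.1 h
        have := hsep.1 _ y hy
        exact hf z hz y this.1 (fun e => this.2 e.symm) hy'
      rw [← e₄] at e₂
      refine smul_right_injective H hc0 (e₁.trans (Eq.trans ?_ (hc ▸ e₂).symm))
      rw [← Equiv.sum_comp Fin.revPerm]
      refine Finset.sum_congr rfl fun c _ => ?_
      rw [Fin.revPerm_apply, revSite_apply]
      simp [flip]

end Blocks

end UqAffine
end

noncomputable section
namespace UqAffine

/-! ### Chains as partitions: the recursions in explicit form. -/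

section Explicit

theorem sum_piFinset_cons {M : Type*} [AddCommMonoid M] {n : ℕ} (S : Fin (n + 1) → Finset ℂ)
    (G : (Fin (n + 1) → ℂ) → M) :
    ∑ x ∈ Fintype.piFinset S, G x =
      ∑ a ∈ S 0, ∑ y ∈ Fintype.piFinset (fun ν => S ν.succ), G (Fin.cons a y) := by
  rw [← Finset.sum_product']
  refine Finset.sum_bij' (fun x _ => (x 0, fun ν => x ν.succ)) (fun p _ => Fin.cons p.1 p.2)
    (fun x hx => ?_) (fun p hp => ?_) (fun x _ => ?_) (fun p _ => ?_) (fun x _ => ?_)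
  · rw [Fintype.mem_piFinset] at hx
    rw [Finset.mem_product, Fintype.mem_piFinset]
    exact ⟨hx 0, fun ν => hx _⟩
  · rw [Finset.mem_product, Fintype.mem_piFinset] at hp
    rw [Fintype.mem_piFinset]
    exact Fin.cases hp.1 hp.2
  · exact Fin.cons_self_tail x
  · rfl
  · exact congrArg G (Fin.cons_self_tail x).symm

theorem nestedEigenvalue_succ (q : ℂ) {k : ℕ} (lam : Fin (k + 2) → ℂ → ℂ) (t : List ℂ) (i : Fin k) :
    nestedEigenvalue q lam t i.succ = lam i.succ.succ := by
  funext u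
  simp [nestedEigenvalue]

/-- Nesting changes only the first eigenvalue, by the factor f(u, t̄) with t̄ the reduced set of the
preceding colour; this is the source of the factors with `μ.castSucc`. The point w is a dummy value
for colours beyond the chain. -/
theorem chainSum_eq (q : ℂ) {M : Type*} [AddCommGroup M] [Module ℂ M] {N : ℕ}
    (lam : Fin (N + 2) → ℂ → ℂ) (z w : ℂ) (l : List ℂ) (t : Fin N → List ℂ) (j : Fin (N + 1))
    (F : (Fin N → List ℂ) → M) :
    chainSum q N (nestedEigenvalue q lam l) z t j F =
      ∑ y ∈ Fintype.piFinset (fun ν : Fin N => if ν.succ ≤ j then (t ν).toFinset else {w}),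
        (∏ μ : Fin N, if μ.succ ≤ j then lam μ.succ.castSucc (y μ) *
          fProd q [y μ] ((Fin.cons l fun ν => (t ν).erase (y ν) : Fin (N + 1) → List ℂ) μ.castSucc) *
          gLeft q (y μ) ((Fin.cons z y : Fin (N + 1) → ℂ) μ.castSucc) *
          fProd q ((t μ).erase (y μ)) [y μ] else 1) •
        F (fun ν => if ν.succ ≤ j then (t ν).erase (y ν) else t ν) := by
  induction N generalizing z l with
  | zero =>
    rw [Fin.fin_one_eq_zero j, chainSum_zero]
    have : (Fintype.piFinset fun ν : Fin 0 => if ν.succ ≤ 0 then (t ν).toFinset else {w}) =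
        {Fin.elim0} := by
      ext y
      simp only [Fintype.mem_piFinset, Finset.mem_singleton, IsEmpty.forall_iff, true_iff]
      exact Subsingleton.elim _ _
    rw [this, Finset.sum_singleton, Finset.univ_eq_empty, Finset.prod_empty, one_smul]
    exact congrArg F (Subsingleton.elim _ _)
  | succ N ih =>
    refine Fin.cases ?_ (fun j => ?_) j
    · rw [chainSum_zero]
      have h : ∀ ν : Fin (N + 1), ¬ ν.succ ≤ 0 := fun ν => not_le.2 (Fin.succ_pos ν)
      simp only [h, if_false]
      rw [Fintype.piFinset_singleton, Finset.sum_singleton]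
      simp
    · rw [chainSum_succ, sum_piFinset_cons]
      refine Finset.sum_congr (if_pos (Fin.succ_le_succ_iff.2 (Fin.zero_le j))).symm fun x _ => ?_
      rw [ih, Finset.smul_sum]
      refine Finset.sum_congr (by simp only [Fin.succ_le_succ_iff]) fun y _ => ?_
      rw [smul_smul, Fin.prod_univ_succ]
      refine congrArg₂ (· • ·) (congrArg₂ (· * ·) ?_ ?_) (congrArg F ?_)
      · rw [if_pos (Fin.succ_le_succ_iff.2 (Fin.zero_le j))]
        simp [nestedEigenvalue, gLeft]
      · refine Finset.prod_congr rfl fun μ _ => ?_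
        simp only [Fin.succ_le_succ_iff, Fin.cons_succ]
        have e : nestedEigenvalue q lam l μ.succ.castSucc = lam μ.succ.succ.castSucc := by
          rw [← Fin.succ_castSucc, nestedEigenvalue_succ]; rfl
        rw [e]
        refine if_congr Iff.rfl ?_ rfl
        have e' : μ.succ.castSucc = μ.castSucc.succ := rfl
        rw [e', Fin.cons_succ, Fin.cons_succ]
        congr 3
        refine congrArg (fProd q [y μ]) ?_
        exact Fin.cases rfl (fun ν => rfl) μ.castSucc
      · funext ν
        refine Fin.cases ?_ (fun ν => ?_) ν
        · simp
        · simp [Fin.succ_le_succ_iff]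

end Explicit

theorem Separated.of_sublist {P : Set ℂ} {N : ℕ} {t t' : Fin N → List ℂ} (ht : Separated P t')
    (h : ∀ ν, (t ν).Sublist (t' ν)) : Separated P t :=
  ⟨fun ν x hx => ht.1 ν x ((h ν).subset hx), fun ν => (ht.2.1 ν).sublist (h ν),
    fun ν μ hne x hx hx' => ht.2.2 ν μ hne x ((h ν).subset hx) ((h μ).subset hx')⟩

theorem remaining_sublist {N : ℕ} (A : Finset (Fin N)) (s : Fin N → List ℂ) (x : Fin N → ℂ)
    (ν : Fin N) : (remaining A s x ν).Sublist (s ν) := by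
  unfold remaining
  split_ifs
  · exact List.erase_sublist
  · exact List.Sublist.refl _

variable {H : Type*} [AddCommGroup H] [Module ℂ H]

/-- Recursion over the first colour, as an explicit sum. -/
theorem preBethe_first {q : ℂ} (hq : q ≠ 0) {n : ℕ} {P : Set ℂ}
    {T : Fin (n + 2) → Fin (n + 2) → ℂ → Module.End ℂ H} (hT : Exchange q P T)
    {lam : Fin (n + 2) → ℂ → ℂ} {v : H} (hv : IsVacuum P T lam v) {z : ℂ}
    {s t : Fin (n + 1) → List ℂ} (ht : Separated P t) (h₀ : t 0 = z :: s 0)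
    (h : ∀ ν, ν ≠ 0 → t ν = s ν) :
    preBethe q (n + 1) T v t = ∑ j : Fin (n + 1), ∑ x ∈ partitions (Finset.Ioc 0 j) z s,
      (∏ μ : Fin n with μ.succ ≤ j, lam μ.succ.castSucc (x μ.succ) *
        fProd q [x μ.succ] (remaining (Finset.Ioc 0 j) s x μ.castSucc) *
        gLeft q (x μ.succ) (x μ.castSucc) *
        fProd q (remaining (Finset.Ioc 0 j) s x μ.succ) [x μ.succ]) •
      T 0 j.succ z (preBethe q (n + 1) T v (remaining (Finset.Ioc 0 j) s x)) := by
  obtain rfl : t = Fin.cons (z :: s 0) (fun ν => s ν.succ) := by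
    funext ν
    refine Fin.cases h₀ (fun ν => h _ (Fin.succ_ne_zero ν)) ν
  rw [preBethe_cons_first hq hT hv ht]
  refine Finset.sum_congr rfl fun j _ => ?_
  rw [chainSum_eq q lam z z, map_sum, partitions, sum_piFinset_cons]
  rw [if_neg (by simp), Finset.sum_singleton]
  refine Finset.sum_congr (by simp [Fin.succ_pos]) fun y _ => ?_
  rw [map_smul, Finset.prod_filter]
  have hr : ∀ ν : Fin n, remaining (Finset.Ioc 0 j) s (Fin.cons z y) ν.succ =
      if ν.succ ≤ j then (s ν.succ).erase (y ν) else s ν.succ := fun ν => by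
    simp [remaining, Fin.succ_pos]
  have hr₀ : remaining (Finset.Ioc 0 j) s (Fin.cons z y) 0 = s 0 := by simp [remaining]
  refine congrArg₂ (· • ·) (Finset.prod_congr rfl fun μ _ => ?_) (congrArg _ ?_)
  · refine ite_congr rfl (fun hμ => ?_) fun _ => rfl
    rw [Fin.cons_succ, hr, if_pos hμ]
    congr 3
    refine congrArg (fProd q [y μ]) ?_
    have hμ' : μ.castSucc ≤ j := (Fin.castSucc_lt_succ).le.trans hμ
    revert hμ'
    refine Fin.cases (fun _ => hr₀.symm) (fun ν hν => ?_) μ.castSucc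
    rw [hr, if_pos hν]; rfl
  · congr 1
    funext ν
    refine Fin.cases hr₀.symm (fun ν => (hr ν).symm) ν

/-- Recursion over the last colour, as an explicit sum. -/
theorem preBethe_last {q : ℂ} (hq : q ≠ 0) {n : ℕ} {P : Set ℂ}
    {T : Fin (n + 2) → Fin (n + 2) → ℂ → Module.End ℂ H} (hT : Exchange q P T)
    (hf : ∀ x ∈ P, ∀ y ∈ P, x ≠ y → fRat q x y ≠ 0)
    {lam : Fin (n + 2) → ℂ → ℂ} {v : H} (hv : IsVacuum P T lam v) {z : ℂ}
    {s t : Fin (n + 1) → List ℂ} (ht : Separated P t) (h₀ : t (Fin.last n) = z :: s (Fin.last n))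
    (h : ∀ ν, ν ≠ Fin.last n → t ν = s ν) :
    preBethe q (n + 1) T v t = ∑ j : Fin (n + 1), ∑ x ∈ partitions (Finset.Ico j (Fin.last n)) z s,
      (∏ μ : Fin n with j ≤ μ.castSucc, lam μ.castSucc.succ (x μ.castSucc) *
        fProd q (remaining (Finset.Ico j (Fin.last n)) s x μ.succ) [x μ.castSucc] *
        gRight q (x μ.succ) (x μ.castSucc) *
        fProd q [x μ.castSucc] (remaining (Finset.Ico j (Fin.last n)) s x μ.castSucc)) •
      T j.castSucc (Fin.last (n + 1)) z
        (preBethe q (n + 1) T v (remaining (Finset.Ico j (Fin.last n)) s x)) := by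
  have hrev : ∀ {t : Fin (n + 1) → List ℂ}, Separated P t →
        Separated P (fun ν => t ν.rev) := fun h =>
      ⟨fun ν => h.1 _, fun ν => h.2.1 _, fun ν μ hne => h.2.2 _ _ fun e => hne (Fin.rev_inj.1 e)⟩
  -- The reflection makes the last colour the first one and turns g⁽ˡ⁾ over q⁻¹ into g⁽ʳ⁾ with
  -- interchanged arguments. The Bethe vectors in the resulting sum are reflected back one by one.
  rw [preBethe_flip hq hT hf v ht, preBethe_first (inv_ne_zero hq) hT.flip hv.flip (z := z)
    (s := fun ν => s ν.rev) (hrev ht) (by rw [Fin.rev_zero]; exact h₀)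
    (fun ν hν => h _ fun e => hν (Fin.rev_inj.1 (e.trans (Fin.rev_zero _).symm)))]
  have hA : ∀ (j ν : Fin (n + 1)), ν ∈ Finset.Ioc 0 j.rev ↔ ν.rev ∈ Finset.Ico j (Fin.last n) := by
    intro j ν
    rw [Finset.mem_Ioc, Finset.mem_Ico, ← Fin.rev_lt_rev, Fin.rev_zero, ← Fin.rev_le_rev,
      Fin.rev_rev, and_comm]
  have hst : ∀ ν, (s ν).Sublist (t ν) := fun ν => by
    by_cases e : ν = Fin.last n
    · subst e; rw [h₀]; exact List.sublist_cons_self _ _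
    · rw [h ν e]
  rw [← Equiv.sum_comp Fin.revPerm]
  refine Finset.sum_congr rfl fun j _ => ?_
  rw [Fin.revPerm_apply]
  refine Finset.sum_bij' (fun x _ ν => x ν.rev) (fun x _ ν => x ν.rev) ?_ ?_ ?_ ?_ ?_
  · intro x hx
    simp only [partitions, Fintype.mem_piFinset] at hx ⊢
    intro ν
    have := hx ν.rev
    simpa only [hA, Fin.rev_rev] using this
  · intro x hx
    simp only [partitions, Fintype.mem_piFinset] at hx ⊢
    intro ν
    have := hx ν.rev
    simpa only [hA, Fin.rev_rev] using this
  · intro x _; funext ν; simp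
  · intro x _; funext ν; simp
  · intro x hx
    have hr : ∀ ν, remaining (Finset.Ioc 0 j.rev) (fun ν => s ν.rev) x ν =
        remaining (Finset.Ico j (Fin.last n)) s (fun ν => x ν.rev) ν.rev := by
      intro ν
      simp only [remaining, hA, Fin.rev_rev]
    have hsep : Separated P (remaining (Finset.Ico j (Fin.last n)) s (fun ν => x ν.rev)) := by
      exact ht.of_sublist fun ν => (remaining_sublist _ _ _ ν).trans (hst ν)
    have e := preBethe_flip hq hT hf v hsep
    rw [e]
    refine congrArg₂ (· • ·) ?_ ?_
    · rw [Finset.prod_filter, Finset.prod_filter, ← Equiv.prod_comp Fin.revPerm]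
      refine Finset.prod_congr rfl fun μ _ => ?_
      rw [Fin.revPerm_apply]
      refine if_congr ?_ ?_ rfl
      · rw [← Fin.rev_le_rev, Fin.rev_rev, Fin.rev_succ, Fin.rev_rev]
      · simp only [hr, Fin.rev_succ, Fin.rev_castSucc, Fin.rev_rev]
        simp only [fProd, List.map_cons, List.map_nil, List.prod_cons, List.prod_nil, mul_one,
          fRat_inv_swap, gLeft, gRight, gRat_inv_swap]
    · rw [← funext hr]
      simp only [flip, Fin.rev_succ, Fin.rev_rev, Fin.rev_zero]

end UqAffine
end

noncomputable section
namespace UqAffine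

/-! ### The normalization factor. -/

section Normalization

variable {H : Type*} [AddCommGroup H] [Module ℂ H]

/-- The normalization of the Bethe vectors. -/
def betheNorm (q : ℂ) {n : ℕ} (lam : Fin (n + 2) → ℂ → ℂ) (t : Fin (n + 1) → List ℂ) : ℂ :=
  (∏ ν, ((t ν).map (lam ν.succ)).prod) * ∏ μ : Fin n, fProd q (t μ.succ) (t μ.castSucc)

theorem betheVector_succ (q : ℂ) {N : ℕ} (T : Fin (N + 2) → Fin (N + 2) → ℂ → Module.End ℂ H)
    (lam : Fin (N + 2) → ℂ → ℂ) (v : H) (t : Fin (N + 1) → List ℂ) :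
    betheVector q (N + 1) T lam v t = (((t 0).map fun x => lam 1 x).prod *
      (if h : 1 < N + 1 then fProd q (t ⟨1, h⟩) (t 0) else 1))⁻¹ • rowProd T (t 0)
        (betheVector q N (nestedMonodromy q T (t 0)) (nestedEigenvalue q lam (t 0))
          (nestedVacuum (t 0).length N v) (fun ν => t ν.succ)) := by
  rw [betheVector, rowProd, LinearMap.sum_apply]
  rfl

/-- The normalization of a level never uses its first eigenvalue, which is the only one modified by
nesting. The factors of all levels therefore multiply to an expression in the original eigenvalues.
-/
theorem betheVector_eq (q : ℂ) {n : ℕ} (T : Fin (n + 2) → Fin (n + 2) → ℂ → Module.End ℂ H)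
    (lam : Fin (n + 2) → ℂ → ℂ) (v : H) (t : Fin (n + 1) → List ℂ) :
    betheVector q (n + 1) T lam v t = (betheNorm q lam t)⁻¹ • preBethe q (n + 1) T v t := by
  induction n generalizing H with
  | zero =>
    rw [betheVector_succ]
    rw [dif_neg (by omega), betheNorm, Fin.prod_univ_succ, Finset.univ_eq_empty (α := Fin 0),
      Finset.prod_empty, Finset.prod_empty, mul_one, mul_one, mul_one]
    rfl
  | succ n ih =>
    rw [betheVector_succ, ih, map_smul, smul_smul, ← mul_inv]
    refine congrArg₂ (fun (c : ℂ) (y : H) => c⁻¹ • y) ?_ rfl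
    simp only [betheNorm]
    rw [Fin.prod_univ_succ (n := n + 1), Fin.prod_univ_succ (n := n) (fun μ => fProd q (t μ.succ) _),
      dif_pos (by omega)]
    simp only [nestedEigenvalue_succ]
    have h₁ : (⟨1, by omega⟩ : Fin (n + 2)) = Fin.succ 0 := rfl
    rw [h₁]
    change (_ * fProd q (t (Fin.succ 0)) (t 0)) * (_ * _) =
      ((List.map (lam 1) (t 0)).prod * _) * (fProd q (t (Fin.succ 0)) (t 0) * _)
    simp only [Fin.castSucc_succ]
    ring

theorem fProd_perm (q : ℂ) {a a' b b' : List ℂ} (ha : a.Perm a') (hb : b.Perm b') :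
    fProd q a b = fProd q a' b' := by
  unfold fProd
  rw [(ha.map _).prod_eq]
  simp only [(hb.map _).prod_eq]

theorem fProd_cons_left (q x : ℂ) (a b : List ℂ) :
    fProd q (x :: a) b = fProd q [x] b * fProd q a b := by simp [fProd]

theorem fProd_cons_right (q x : ℂ) (a b : List ℂ) :
    fProd q a (x :: b) = fProd q a [x] * fProd q a b := by
  simp [fProd, List.prod_map_mul]

theorem fProd_ne_zero {q : ℂ} {a b : List ℂ} (h : ∀ x ∈ a, ∀ y ∈ b, fRat q x y ≠ 0) :
    fProd q a b ≠ 0 := by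
  refine List.prod_ne_zero fun h' => ?_
  obtain ⟨x, hx, h'⟩ := List.mem_map.1 h'
  obtain ⟨y, hy, h'⟩ := List.mem_map.1 (List.prod_eq_zero_iff.1 h')
  exact h x hx y hy h'

theorem betheNorm_perm (q : ℂ) {n : ℕ} (lam : Fin (n + 2) → ℂ → ℂ) {t t' : Fin (n + 1) → List ℂ}
    (h : ∀ ν, (t ν).Perm (t' ν)) : betheNorm q lam t = betheNorm q lam t' := by
  unfold betheNorm
  congr 1
  · exact Finset.prod_congr rfl fun ν _ => ((h ν).map _).prod_eq
  · exact Finset.prod_congr rfl fun ν _ => fProd_perm q (h _) (h _)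

theorem betheNorm_ne_zero {q : ℂ} {n : ℕ} {P : Set ℂ} {lam : Fin (n + 2) → ℂ → ℂ}
    {t : Fin (n + 1) → List ℂ} (hf : ∀ x ∈ P, ∀ y ∈ P, x ≠ y → fRat q x y ≠ 0)
    (ht : Separated P t) (hlam : ∀ ν, ∀ x ∈ t ν, lam ν.succ x ≠ 0) : betheNorm q lam t ≠ 0 := by
  refine mul_ne_zero (Finset.prod_ne_zero_iff.2 fun ν _ => List.prod_ne_zero fun h => ?_)
    (Finset.prod_ne_zero_iff.2 fun μ _ => fProd_ne_zero fun x hx y hy =>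
      hf x (ht.1 _ x hx) y (ht.1 _ y hy) ?_)
  · obtain ⟨x, hx, h⟩ := List.mem_map.1 h
    exact hlam ν x hx h
  · rintro rfl
    exact ht.2.2 _ _ (Fin.castSucc_lt_succ).ne' x hx hy

variable {q : ℂ} {n : ℕ} (lam : Fin (n + 2) → ℂ → ℂ) {A : Finset (Fin (n + 1))}
  {t r : Fin (n + 1) → List ℂ} {x : Fin (n + 1) → ℂ}

theorem betheNorm_extend_aux (hA : ∀ ν ∈ A, (t ν).Perm (x ν :: r ν)) (hA' : ∀ ν ∉ A, t ν = r ν) :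
    ∏ ν, ((t ν).map (lam ν.succ)).prod =
      (∏ ν, ((r ν).map (lam ν.succ)).prod) * ∏ ν, if ν ∈ A then lam ν.succ (x ν) else 1 := by
  rw [← Finset.prod_mul_distrib]
  refine Finset.prod_congr rfl fun ν _ => ?_
  split_ifs with h
  · rw [((hA ν h).map _).prod_eq, List.map_cons, List.prod_cons, mul_comm]
  · rw [hA' ν h, mul_one]

/-- The normalization after the insertion of one parameter into some of the sets. -/
theorem betheNorm_extend (hA : ∀ ν ∈ A, (t ν).Perm (x ν :: r ν)) (hA' : ∀ ν ∉ A, t ν = r ν) :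
    betheNorm q lam t = betheNorm q lam r * (∏ ν, if ν ∈ A then lam ν.succ (x ν) else 1) *
      (∏ μ : Fin n, if μ.castSucc ∈ A then fProd q (t μ.succ) [x μ.castSucc] else 1) *
      ∏ μ : Fin n, if μ.succ ∈ A then fProd q [x μ.succ] (r μ.castSucc) else 1 := by
  have h : ∏ μ : Fin n, fProd q (t μ.succ) (t μ.castSucc) =
      (∏ μ : Fin n, fProd q (r μ.succ) (r μ.castSucc)) *
      (∏ μ : Fin n, if μ.castSucc ∈ A then fProd q (t μ.succ) [x μ.castSucc] else 1) *
      ∏ μ : Fin n, if μ.succ ∈ A then fProd q [x μ.succ] (r μ.castSucc) else 1 := by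
    rw [← Finset.prod_mul_distrib, ← Finset.prod_mul_distrib]
    refine Finset.prod_congr rfl fun μ _ => ?_
    have e₁ : fProd q (t μ.succ) (t μ.castSucc) = fProd q (t μ.succ) (r μ.castSucc) *
        if μ.castSucc ∈ A then fProd q (t μ.succ) [x μ.castSucc] else 1 := by
      split_ifs with h
      · rw [fProd_perm q (.refl _) (hA _ h), fProd_cons_right, mul_comm]
      · rw [hA' _ h, mul_one]
    have e₂ : fProd q (t μ.succ) (r μ.castSucc) = fProd q (r μ.succ) (r μ.castSucc) *
        if μ.succ ∈ A then fProd q [x μ.succ] (r μ.castSucc) else 1 := by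
      split_ifs with h
      · rw [fProd_perm q (hA _ h) (.refl _), fProd_cons_left, mul_comm]
      · rw [hA' _ h, mul_one]
    rw [e₁, e₂]
    ring
  rw [betheNorm, betheNorm, betheNorm_extend_aux lam hA hA', h]
  ring

/-- The counterpart of `betheNorm_extend` for the last colour: the mixed factor f(x_{μ+1}, x_μ) is
now counted with the full set t_μ, as the denominators of the second recursion require. -/
theorem betheNorm_extend' (hA : ∀ ν ∈ A, (t ν).Perm (x ν :: r ν)) (hA' : ∀ ν ∉ A, t ν = r ν) :
    betheNorm q lam t = betheNorm q lam r * (∏ ν, if ν ∈ A then lam ν.succ (x ν) else 1) *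
      (∏ μ : Fin n, if μ.succ ∈ A then fProd q [x μ.succ] (t μ.castSucc) else 1) *
      ∏ μ : Fin n, if μ.castSucc ∈ A then fProd q (r μ.succ) [x μ.castSucc] else 1 := by
  have h : ∏ μ : Fin n, fProd q (t μ.succ) (t μ.castSucc) =
      (∏ μ : Fin n, fProd q (r μ.succ) (r μ.castSucc)) *
      (∏ μ : Fin n, if μ.succ ∈ A then fProd q [x μ.succ] (t μ.castSucc) else 1) *
      ∏ μ : Fin n, if μ.castSucc ∈ A then fProd q (r μ.succ) [x μ.castSucc] else 1 := by
    rw [← Finset.prod_mul_distrib, ← Finset.prod_mul_distrib]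
    refine Finset.prod_congr rfl fun μ _ => ?_
    have e₁ : fProd q (t μ.succ) (t μ.castSucc) = fProd q (r μ.succ) (t μ.castSucc) *
        if μ.succ ∈ A then fProd q [x μ.succ] (t μ.castSucc) else 1 := by
      split_ifs with h
      · rw [fProd_perm q (hA _ h) (.refl _), fProd_cons_left, mul_comm]
      · rw [hA' _ h, mul_one]
    have e₂ : fProd q (r μ.succ) (t μ.castSucc) = fProd q (r μ.succ) (r μ.castSucc) *
        if μ.castSucc ∈ A then fProd q (r μ.succ) [x μ.castSucc] else 1 := by
      split_ifs with h
      · rw [fProd_perm q (.refl _) (hA _ h), fProd_cons_right, mul_comm]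
      · rw [hA' _ h, mul_one]
    rw [e₁, e₂]
    ring
  rw [betheNorm, betheNorm, betheNorm_extend_aux lam hA hA', h]
  ring

end Normalization

/-! ### Recursions for normalized Bethe vectors. -/

section Recursions

variable {H : Type*} [AddCommGroup H] [Module ℂ H]

/-- Dividing by the ratio of norms turns each eigenvalue of the unnormalized recursion into α,
cancels the factors f(x, reduced set), and leaves the products f(full set, x) in the denominator. -/
theorem betheVector_first {q : ℂ} (hq : q ≠ 0) {n : ℕ} {P : Set ℂ}
    {T : Fin (n + 2) → Fin (n + 2) → ℂ → Module.End ℂ H} (hT : Exchange q P T)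
    (hf : ∀ x ∈ P, ∀ y ∈ P, x ≠ y → fRat q x y ≠ 0)
    {lam : Fin (n + 2) → ℂ → ℂ} {v : H} (hv : IsVacuum P T lam v) {z : ℂ}
    {s t : Fin (n + 1) → List ℂ} (ht : Separated P t) (h₀ : t 0 = z :: s 0)
    (h : ∀ ν, ν ≠ 0 → t ν = s ν) (hlam : ∀ ν, ∀ x ∈ t ν, lam ν.succ x ≠ 0) :
    betheVector q (n + 1) T lam v t =
      ∑ j : Fin (n + 1), ∑ x ∈ partitions (Finset.Ioc 0 j) z s,
        ((lam 1 z)⁻¹ * ((∏ μ : Fin n with μ.succ ≤ j, alpha lam μ.succ (x μ.succ) *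
            gLeft q (x μ.succ) (x μ.castSucc) *
            fProd q (remaining (Finset.Ioc 0 j) s x μ.succ) [x μ.succ]) /
          ∏ μ : Fin n with μ.castSucc ≤ j, fProd q (s μ.succ) [x μ.castSucc])) •
        T 0 j.succ z (betheVector q (n + 1) T lam v (remaining (Finset.Ioc 0 j) s x)) := by
  rw [betheVector_eq, preBethe_first hq hT hv ht h₀ h, Finset.smul_sum]
  refine Finset.sum_congr rfl fun j _ => ?_
  rw [Finset.smul_sum]
  refine Finset.sum_congr rfl fun x hx => ?_
  have hst : ∀ ν, (s ν).Sublist (t ν) := fun ν => by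
    by_cases e : ν = 0
    · subst e; rw [h₀]; exact List.sublist_cons_self _ _
    · rw [h ν e]
  have hrt := fun ν => (remaining_sublist (Finset.Ioc 0 j) s x ν).trans (hst ν)
  simp only [partitions, Fintype.mem_piFinset] at hx
  have hx₀ : x 0 = z := by simpa using hx 0
  -- For the norms z counts as the parameter removed from colour 0, so the relevant colours are 0,
  -- …, j, although the partitions only run over 1, …, j.
  have hA : ∀ ν ∈ Finset.Iic j, (t ν).Perm (x ν :: remaining (Finset.Ioc 0 j) s x ν) := by
    intro ν hν
    rw [Finset.mem_Iic] at hν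
    by_cases e : ν = 0
    · subst e; rw [h₀, hx₀]; simp [remaining]
    · have hm : ν ∈ Finset.Ioc 0 j := Finset.mem_Ioc.2 ⟨Fin.pos_iff_ne_zero.2 e, hν⟩
      have hxν := hx ν
      rw [if_pos hm, List.mem_toFinset] at hxν
      rw [h ν e, remaining, if_pos hm]
      exact List.perm_cons_erase hxν
  have hA' : ∀ ν ∉ Finset.Iic j, t ν = remaining (Finset.Ioc 0 j) s x ν := by
    intro ν hν
    have e : ν ≠ 0 := by rintro rfl; exact hν (Finset.mem_Iic.2 (Fin.zero_le j))
    rw [h ν e, remaining, if_neg fun h => hν (Finset.mem_Iic.2 (Finset.mem_Ioc.1 h).2)]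
  have hn := betheNorm_extend (q := q) lam hA hA'
  have hn0 := betheNorm_ne_zero hf ht hlam
  rw [betheVector_eq, map_smul, smul_smul, smul_smul, hn]
  rw [hn] at hn0
  rw [Fin.prod_univ_succ (fun ν => if ν ∈ Finset.Iic j then lam ν.succ (x ν) else 1)] at hn0 ⊢
  simp only [Finset.mem_Iic, Fin.zero_le, if_true, hx₀, h _ (Fin.succ_ne_zero _), mul_ne_zero_iff,
    Finset.prod_filter] at hn0 ⊢
  refine congrArg (· • _) ?_
  have e₁ : (∏ μ : Fin n, if μ.succ ≤ j then lam μ.succ.castSucc (x μ.succ) *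
        fProd q [x μ.succ] (remaining (Finset.Ioc 0 j) s x μ.castSucc) *
        gLeft q (x μ.succ) (x μ.castSucc) *
        fProd q (remaining (Finset.Ioc 0 j) s x μ.succ) [x μ.succ] else 1) =
      (∏ μ : Fin n, if μ.succ ≤ j then alpha lam μ.succ (x μ.succ) *
        gLeft q (x μ.succ) (x μ.castSucc) *
        fProd q (remaining (Finset.Ioc 0 j) s x μ.succ) [x μ.succ] else 1) *
      (∏ μ : Fin n, if μ.succ ≤ j then lam μ.succ.succ (x μ.succ) else 1) *
      ∏ μ : Fin n, if μ.succ ≤ j then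
        fProd q [x μ.succ] (remaining (Finset.Ioc 0 j) s x μ.castSucc) else 1 := by
    rw [← Finset.prod_mul_distrib, ← Finset.prod_mul_distrib]
    refine Finset.prod_congr rfl fun μ _ => ?_
    split_ifs with hμ
    · have := Finset.prod_ne_zero_iff.1 hn0.1.1.2.2 μ (Finset.mem_univ _)
      rw [if_pos hμ] at this
      rw [alpha]
      field_simp
    · simp
  rw [e₁]
  obtain ⟨⟨⟨h₁, h₂, h₃⟩, h₄⟩, h₅⟩ := hn0
  rw [Fin.succ_zero_eq_one] at h₂ ⊢
  generalize (∏ μ : Fin n, if μ.succ ≤ j then lam μ.succ.succ (x μ.succ) else 1) = a at *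
  generalize (∏ μ : Fin n, if μ.succ ≤ j then
        fProd q [x μ.succ] (remaining (Finset.Ioc 0 j) s x μ.castSucc) else 1) = b at *
  generalize (∏ μ : Fin n, if μ.castSucc ≤ j then fProd q (s μ.succ) [x μ.castSucc] else 1) = c at *
  field_simp

/-- Here the eigenvalues in the unnormalized recursion are the very ones in the norm, so they cancel
completely and no α remains. -/
theorem betheVector_last {q : ℂ} (hq : q ≠ 0) {n : ℕ} {P : Set ℂ}
    {T : Fin (n + 2) → Fin (n + 2) → ℂ → Module.End ℂ H} (hT : Exchange q P T)
    (hf : ∀ x ∈ P, ∀ y ∈ P, x ≠ y → fRat q x y ≠ 0)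
    {lam : Fin (n + 2) → ℂ → ℂ} {v : H} (hv : IsVacuum P T lam v) {z : ℂ}
    {s t : Fin (n + 1) → List ℂ} (ht : Separated P t) (h₀ : t (Fin.last n) = z :: s (Fin.last n))
    (h : ∀ ν, ν ≠ Fin.last n → t ν = s ν) (hlam : ∀ ν, ∀ x ∈ t ν, lam ν.succ x ≠ 0) :
    betheVector q (n + 1) T lam v t =
      ∑ j : Fin (n + 1), ∑ x ∈ partitions (Finset.Ico j (Fin.last n)) z s,
        ((lam (Fin.last (n + 1)) z)⁻¹ * ((∏ μ : Fin n with j ≤ μ.castSucc,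
            gRight q (x μ.succ) (x μ.castSucc) *
            fProd q [x μ.castSucc] (remaining (Finset.Ico j (Fin.last n)) s x μ.castSucc)) /
          ∏ μ : Fin n with j ≤ μ.succ, fProd q [x μ.succ] (s μ.castSucc))) •
        T j.castSucc (Fin.last (n + 1)) z
          (betheVector q (n + 1) T lam v (remaining (Finset.Ico j (Fin.last n)) s x)) := by
  rw [betheVector_eq, preBethe_last hq hT hf hv ht h₀ h, Finset.smul_sum]
  refine Finset.sum_congr rfl fun j _ => ?_
  rw [Finset.smul_sum]
  refine Finset.sum_congr rfl fun x hx => ?_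
  simp only [partitions, Fintype.mem_piFinset] at hx
  have hx₀ : x (Fin.last n) = z := by simpa using hx (Fin.last n)
  have hA : ∀ ν ∈ Finset.Ici j,
      (t ν).Perm (x ν :: remaining (Finset.Ico j (Fin.last n)) s x ν) := by
    intro ν hν
    rw [Finset.mem_Ici] at hν
    by_cases e : ν = Fin.last n
    · subst e; rw [h₀, hx₀]; simp [remaining]
    · have hm : ν ∈ Finset.Ico j (Fin.last n) := Finset.mem_Ico.2 ⟨hν, Fin.lt_last_iff_ne_last.2 e⟩
      have hxν := hx ν
      rw [if_pos hm, List.mem_toFinset] at hxν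
      rw [h ν e, remaining, if_pos hm]
      exact List.perm_cons_erase hxν
  have hA' : ∀ ν ∉ Finset.Ici j, t ν = remaining (Finset.Ico j (Fin.last n)) s x ν := by
    intro ν hν
    have e : ν ≠ Fin.last n := by rintro rfl; exact hν (Finset.mem_Ici.2 (Fin.le_last j))
    rw [h ν e, remaining, if_neg fun h => hν (Finset.mem_Ici.2 (Finset.mem_Ico.1 h).1)]
  have hn := betheNorm_extend' (q := q) lam hA hA'
  have hn0 := betheNorm_ne_zero hf ht hlam
  rw [betheVector_eq, map_smul, smul_smul, smul_smul, hn]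
  rw [hn] at hn0
  rw [Fin.prod_univ_castSucc (fun ν => if ν ∈ Finset.Ici j then lam ν.succ (x ν) else 1)] at hn0 ⊢
  simp only [Finset.mem_Ici, Fin.le_last, if_true, hx₀, h _ (Fin.castSucc_lt_last _).ne,
    mul_ne_zero_iff, Finset.prod_filter, Fin.succ_last] at hn0 ⊢
  refine congrArg (· • _) ?_
  have e₁ : (∏ μ : Fin n, if j ≤ μ.castSucc then lam μ.castSucc.succ (x μ.castSucc) *
        fProd q (remaining (Finset.Ico j (Fin.last n)) s x μ.succ) [x μ.castSucc] *
        gRight q (x μ.succ) (x μ.castSucc) *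
        fProd q [x μ.castSucc] (remaining (Finset.Ico j (Fin.last n)) s x μ.castSucc) else 1) =
      (∏ μ : Fin n, if j ≤ μ.castSucc then gRight q (x μ.succ) (x μ.castSucc) *
        fProd q [x μ.castSucc] (remaining (Finset.Ico j (Fin.last n)) s x μ.castSucc) else 1) *
      (∏ μ : Fin n, if j ≤ μ.castSucc then lam μ.castSucc.succ (x μ.castSucc) else 1) *
      ∏ μ : Fin n, if j ≤ μ.castSucc then
        fProd q (remaining (Finset.Ico j (Fin.last n)) s x μ.succ) [x μ.castSucc] else 1 := by
    rw [← Finset.prod_mul_distrib, ← Finset.prod_mul_distrib]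
    refine Finset.prod_congr rfl fun μ _ => ?_
    split_ifs with hμ
    · ring
    · simp
  rw [e₁]
  obtain ⟨⟨⟨h₁, h₂, h₃⟩, h₄⟩, h₅⟩ := hn0
  generalize (∏ μ : Fin n, if j ≤ μ.castSucc then lam μ.castSucc.succ (x μ.castSucc) else 1) = a at *
  generalize (∏ μ : Fin n, if j ≤ μ.castSucc then
    fProd q (remaining (Finset.Ico j (Fin.last n)) s x μ.succ) [x μ.castSucc] else 1) = b at *
  generalize (∏ μ : Fin n, if j ≤ μ.succ then fProd q [x μ.succ] (s μ.castSucc) else 1) = c at *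
  field_simp

theorem betheVector_perm {q : ℂ} (hq : q ≠ 0) {n : ℕ} {P : Set ℂ}
    {T : Fin (n + 2) → Fin (n + 2) → ℂ → Module.End ℂ H} (hT : Exchange q P T)
    (hf : ∀ x ∈ P, ∀ y ∈ P, x ≠ y → fRat q x y ≠ 0) (lam : Fin (n + 2) → ℂ → ℂ) (v : H)
    {t t' : Fin (n + 1) → List ℂ} (ht : Separated P t) (h : ∀ ν, (t ν).Perm (t' ν)) :
    betheVector q (n + 1) T lam v t = betheVector q (n + 1) T lam v t' := by
  rw [betheVector_eq, betheVector_eq, betheNorm_perm q lam h, preBethe_perm hq hT hf v ht h]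

end Recursions

end UqAffine
end

noncomputable section
namespace UqAffine

/-! ### Passage to functionals and inverse parameters. -/

section Duality

theorem fRat_inv_inv (q : ℂ) {u v : ℂ} (hu : u ≠ 0) (hv : v ≠ 0) :
    fRat q⁻¹ u⁻¹ v⁻¹ = fRat q u v := by
  unfold fRat
  by_cases h : u = v
  · simp [h]
  have h₁ : u - v ≠ 0 := sub_ne_zero.2 h
  have h₂ : u⁻¹ - v⁻¹ = -(u - v) * (u⁻¹ * v⁻¹) := by field_simp; ring
  have h₃ : q⁻¹ * u⁻¹ - q⁻¹⁻¹ * v⁻¹ = -(q * u - q⁻¹ * v) * (u⁻¹ * v⁻¹) := by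
    rw [inv_inv]; field_simp; ring
  rw [h₂, h₃, mul_div_mul_right _ _ (mul_ne_zero (inv_ne_zero hu) (inv_ne_zero hv)), neg_div_neg_eq]

theorem gLeft_inv_inv (q : ℂ) {u v : ℂ} (hu : u ≠ 0) (hv : v ≠ 0) :
    gLeft q⁻¹ u⁻¹ v⁻¹ = gRight q u v := by
  unfold gLeft gRight gRat
  by_cases h : u = v
  · simp [h]
  have h₁ : u - v ≠ 0 := sub_ne_zero.2 h
  have h₂ : u⁻¹ - v⁻¹ = -(u - v) * (u⁻¹ * v⁻¹) := by field_simp; ring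
  rw [h₂, inv_inv]
  field_simp
  ring

theorem gRight_inv_inv (q : ℂ) {u v : ℂ} (hu : u ≠ 0) (hv : v ≠ 0) :
    gRight q⁻¹ u⁻¹ v⁻¹ = gLeft q u v := by
  have := gLeft_inv_inv q⁻¹ (inv_ne_zero hu) (inv_ne_zero hv)
  rw [inv_inv, inv_inv, inv_inv] at this
  exact this.symm

theorem exchCoeff_inv_inv (q : ℂ) {u v : ℂ} (hu : u ≠ 0) (hv : v ≠ 0) {m : ℕ} (i k : Fin m) :
    exchCoeff q⁻¹ u⁻¹ v⁻¹ i k = exchCoeff q u v k i := by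
  rcases lt_trichotomy i k with h | rfl | h
  · rw [exchCoeff_of_lt _ _ _ h, exchCoeff_of_gt _ _ _ h]
    exact gLeft_inv_inv q hu hv
  · rw [exchCoeff_self, exchCoeff_self, fRat_inv_inv q hu hv]
  · rw [exchCoeff_of_gt _ _ _ h, exchCoeff_of_lt _ _ _ h]
    exact gRight_inv_inv q hu hv

theorem fProd_map_inv (q : ℂ) {a b : List ℂ} (ha : ∀ x ∈ a, x ≠ 0) (hb : ∀ x ∈ b, x ≠ 0) :
    fProd q⁻¹ (a.map fun x => x⁻¹) (b.map fun x => x⁻¹) = fProd q a b := by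
  unfold fProd
  rw [List.map_map]
  refine congrArg List.prod (List.map_congr_left fun x hx => ?_)
  rw [Function.comp_apply, List.map_map]
  refine congrArg List.prod (List.map_congr_left fun y hy => ?_)
  exact fRat_inv_inv q (ha x hx) (hb y hy)

variable {H : Type*} [AddCommGroup H] [Module ℂ H]

/-- The transposed monodromy matrix `T_{ba}(u⁻¹)`, acting on functionals. -/
def dualMonodromy {m : ℕ} (T : Fin m → Fin m → ℂ → Module.End ℂ H) (a b : Fin m) (u : ℂ) :
    Module.End ℂ (Module.Dual ℂ H) := (T b a u⁻¹).dualMap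

/-- Transposition reverses products and thereby interchanges the two sides of the relation, with
rows and columns swapped. Inverting q and both parameters transposes the exchange coefficients to
match. -/
theorem Exchange.dualMonodromy {q : ℂ} {D P : Set ℂ} {m : ℕ}
    {T : Fin m → Fin m → ℂ → Module.End ℂ H} (h : Exchange q D T)
    (hP : ∀ u ∈ P, u⁻¹ ∈ D ∧ u ≠ 0) : Exchange q⁻¹ P (dualMonodromy T) := by
  intro u hu v hv huv i j a b
  have e := h u⁻¹ (hP u hu).1 v⁻¹ (hP v hv).1 (fun e => huv (inv_injective e)) j i b a
  have hu0 := inv_ne_zero (hP u hu).2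
  have hv0 := inv_ne_zero (hP v hv).2
  rw [← exchCoeff_inv_inv q hu0 hv0, ← exchCoeff_inv_inv q hu0 hv0, inv_inv, inv_inv] at e
  refine LinearMap.ext fun φ => LinearMap.ext fun y => ?_
  have e' := congrArg φ (LinearMap.congr_fun e.symm y)
  simpa [UqAffine.dualMonodromy] using e'

/-- A functional annihilated by the entries above the diagonal is, for the transposed matrix, a
vector annihilated by those below it. -/
theorem IsDualPseudovacuum.isVacuum {D P : Set ℂ} {m : ℕ}
    {T : Fin m → Fin m → ℂ → Module.End ℂ H} {lam : Fin m → ℂ → ℂ} {dvac : Module.Dual ℂ H}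
    (h : IsDualPseudovacuum D T lam dvac) (hP : ∀ u ∈ P, u⁻¹ ∈ D) :
    IsVacuum P (dualMonodromy T) (fun i u => lam i u⁻¹) dvac :=
  fun u hu => ⟨fun i => (h _ (hP u hu)).1 i, fun i j hij => (h _ (hP u hu)).2 j i hij⟩

theorem Generic.ne_zero {q : ℂ} {D : Set ℂ} {N : ℕ} {z : ℂ} {s : Fin N → List ℂ}
    (h : Generic q D z s) {x : ℂ} (hx : x ∈ z :: (List.ofFn s).flatten) : x ≠ 0 := (h.1 x hx).2

theorem mem_flatten_ofFn {N : ℕ} (z : ℂ) {s : Fin N → List ℂ} {ν : Fin N} {x : ℂ} (hx : x ∈ s ν) :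
    x ∈ z :: (List.ofFn s).flatten :=
  List.mem_cons_of_mem _ (List.mem_flatten.2 ⟨s ν, (List.mem_ofFn' _ _).2 ⟨ν, rfl⟩, hx⟩)

theorem Generic.separated {q : ℂ} {D : Set ℂ} {N : ℕ} {z : ℂ} {s t : Fin N → List ℂ}
    (h : Generic q D z s) {μ : Fin N} (hμ : t μ = z :: s μ) (hν : ∀ ν, ν ≠ μ → t ν = s ν) :
    Separated {u | u⁻¹ ∈ z :: (List.ofFn s).flatten} (fun ν => (t ν).map fun x => x⁻¹) := by
  have hnd : (z :: (List.ofFn s).flatten).Nodup := h.2.imp fun h => h.1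
  obtain ⟨hz, hfl⟩ := List.nodup_cons.1 hnd
  obtain ⟨h₁, h₂⟩ := List.nodup_flatten.1 hfl
  have hzs : ∀ ν, z ∉ s ν := fun ν hzν =>
    hz (List.mem_flatten.2 ⟨s ν, (List.mem_ofFn' _ _).2 ⟨ν, rfl⟩, hzν⟩)
  have hs : ∀ ν, (s ν).Nodup := fun ν => h₁ _ ((List.mem_ofFn' _ _).2 ⟨ν, rfl⟩)
  have hd : ∀ ν ν', ν < ν' → (s ν).Disjoint (s ν') := List.pairwise_ofFn.1 h₂
  have hd' : ∀ ν ν', ν ≠ ν' → (s ν).Disjoint (s ν') := fun ν ν' hne =>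
    hne.lt_or_gt.elim (hd ν ν') fun h => (hd ν' ν h).symm
  have ht : ∀ ν x, x ∈ t ν → (ν = μ ∧ x = z) ∨ x ∈ s ν := fun ν x hx => by
    by_cases e : ν = μ
    · subst e
      rw [hμ, List.mem_cons] at hx
      exact hx.imp (fun h => ⟨rfl, h⟩) id
    · exact Or.inr (hν ν e ▸ hx)
  refine ⟨fun ν x hx => ?_, fun ν => ?_, fun ν ν' hne x hx hx' => ?_⟩
  · obtain ⟨y, hy, rfl⟩ := List.mem_map.1 hx
    change y⁻¹⁻¹ ∈ z :: (List.ofFn s).flatten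
    rw [inv_inv]
    rcases ht ν y hy with ⟨_, rfl⟩ | h
    · exact List.mem_cons_self
    · exact mem_flatten_ofFn z h
  · refine List.Nodup.map inv_injective ?_
    by_cases e : ν = μ
    · subst e
      rw [hμ]
      exact List.nodup_cons.2 ⟨hzs ν, hs ν⟩
    · rw [hν ν e]; exact hs ν
  · obtain ⟨y, hy, rfl⟩ := List.mem_map.1 hx
    obtain ⟨y', hy', e⟩ := List.mem_map.1 hx'
    obtain rfl := inv_injective e
    rcases ht ν y' hy with ⟨e₁, rfl⟩ | h₁ <;> rcases ht ν' y' hy' with ⟨e₂, e₃⟩ | h₂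
    · exact hne (e₁.trans e₂.symm)
    · exact hzs _ h₂
    · exact hzs _ (e₃ ▸ h₁)
    · exact hd' ν ν' hne h₁ h₂

theorem Generic.fRat_ne_zero {q : ℂ} {D : Set ℂ} {N : ℕ} {z : ℂ} {s : Fin N → List ℂ}
    (h : Generic q D z s) (x : ℂ) (hx : x ∈ {u | u⁻¹ ∈ z :: (List.ofFn s).flatten}) (y : ℂ)
    (hy : y ∈ {u | u⁻¹ ∈ z :: (List.ofFn s).flatten}) (hxy : x ≠ y) : fRat q⁻¹ x y ≠ 0 := by
  rw [← inv_inv x, ← inv_inv y, fRat_inv_inv q (h.ne_zero hx) (h.ne_zero hy)]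
  have hne : x⁻¹ ≠ y⁻¹ := fun e => hxy (inv_injective e)
  have : Std.Symm fun a b : ℂ => a ≠ b ∧ q * a ≠ q⁻¹ * b ∧ q * b ≠ q⁻¹ * a :=
    ⟨fun a b hab => ⟨hab.1.symm, hab.2.2, hab.2.1⟩⟩
  have := h.2.forall hx hy hne
  exact div_ne_zero (sub_ne_zero.2 this.2.1) (sub_ne_zero.2 hne)

theorem dualBetheVector_eq (q : ℂ) {N : ℕ} (T : Fin (N + 1) → Fin (N + 1) → ℂ → Module.End ℂ H)
    (lam : Fin (N + 1) → ℂ → ℂ) (dvac : Module.Dual ℂ H) (s : Fin N → List ℂ) :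
    dualBetheVector q T lam dvac s = betheVector q⁻¹ N (dualMonodromy T)
      (fun i u => lam i u⁻¹) dvac (fun ν => (s ν).map fun x => x⁻¹) := rfl

theorem remaining_map_inv {N : ℕ} (A : Finset (Fin N)) (s : Fin N → List ℂ) (x : Fin N → ℂ) :
    remaining A (fun ν => (s ν).map fun x => x⁻¹) (fun ν => (x ν)⁻¹) =
      fun ν => (remaining A s x ν).map fun x => x⁻¹ := by
  funext ν
  unfold remaining
  split_ifs
  · rw [List.map_erase inv_injective]
  · rfl

theorem sum_partitions_map_inv {M : Type*} [AddCommMonoid M] {N : ℕ} (A : Finset (Fin N)) (z : ℂ)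
    (s : Fin N → List ℂ) (G : (Fin N → ℂ) → M) :
    ∑ x ∈ partitions A z⁻¹ (fun ν => (s ν).map fun x => x⁻¹), G x =
      ∑ x ∈ partitions A z s, G (fun ν => (x ν)⁻¹) := by
  refine Finset.sum_bij' (fun x _ ν => (x ν)⁻¹) (fun x _ ν => (x ν)⁻¹) ?_ ?_ ?_ ?_ ?_
  · intro x hx
    simp only [partitions, Fintype.mem_piFinset] at hx ⊢
    intro ν
    have := hx ν
    split_ifs at this ⊢
    · rw [List.mem_toFinset, List.mem_map] at this
      obtain ⟨y, hy, e⟩ := this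
      rw [← e, inv_inv, List.mem_toFinset]
      exact hy
    · rw [Finset.mem_singleton] at this ⊢
      rw [this, inv_inv]
  · intro x hx
    simp only [partitions, Fintype.mem_piFinset] at hx ⊢
    intro ν
    have := hx ν
    split_ifs at this ⊢
    · rw [List.mem_toFinset] at this ⊢
      exact List.mem_map_of_mem this
    · rw [Finset.mem_singleton] at this ⊢
      rw [this]
  · intro x _; funext ν; simp
  · intro x _; funext ν; simp
  · intro x _; simp

theorem Generic.partitions_ne_zero {q : ℂ} {D : Set ℂ} {N : ℕ} {z : ℂ} {s : Fin N → List ℂ}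
    (h : Generic q D z s) {A : Finset (Fin N)} {x : Fin N → ℂ} (hx : x ∈ partitions A z s)
    (ν : Fin N) : x ν ≠ 0 := by
  have := (Fintype.mem_piFinset.1 hx) ν
  split_ifs at this
  · exact h.ne_zero (mem_flatten_ofFn z (List.mem_toFinset.1 this))
  · rw [Finset.mem_singleton] at this
    exact this ▸ h.ne_zero List.mem_cons_self

end Duality

end UqAffine
end

/-! ### The recursions for dual Bethe vectors. -/

open UqAffine
/-- Recursions for the dual Bethe vectors with `N = n + 1` colours, `m = n + 2`. The sets of Bethe
parameters are listed in an arbitrary order. -/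
theorem mainTheorem9 (n : ℕ) {H : Type*} [AddCommGroup H] [Module ℂ H] (q : ℂ) (hq : q ≠ 0)
    (D : Set ℂ) (T : Fin (n + 2) → Fin (n + 2) → ℂ → Module.End ℂ H) (lam : Fin (n + 2) → ℂ → ℂ)
    (dvac : Module.Dual ℂ H) (hT : RTTRelation q D T) (hvac : IsDualPseudovacuum D T lam dvac)
    (z : ℂ) (s : Fin (n + 1) → List ℂ) (hgen : Generic q D z s)
    (hlam : ∀ ν, ∀ x ∈ s ν, lam ν.succ x ≠ 0) :
    (lam 1 z ≠ 0 →
      ∀ w : Fin (n + 1) → List ℂ, (∀ ν, (w ν).Perm (if ν = 0 then z :: s ν else s ν)) →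
        dualBetheVector q T lam dvac w =
          ∑ j : Fin (n + 1), ∑ x ∈ partitions (Finset.Ioc 0 j) z s,
            ((lam 1 z)⁻¹ * coeffFirst q lam j s (remaining (Finset.Ioc 0 j) s x) x) •
              (dualBetheVector q T lam dvac (remaining (Finset.Ioc 0 j) s x) ∘ₗ T j.succ 0 z)) ∧
    (lam (Fin.last (n + 1)) z ≠ 0 →
      ∀ w : Fin (n + 1) → List ℂ,
        (∀ ν, (w ν).Perm (if ν = Fin.last n then z :: s ν else s ν)) →
        dualBetheVector q T lam dvac w =
          ∑ j : Fin (n + 1), ∑ x ∈ partitions (Finset.Ico j (Fin.last n)) z s,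
            ((lam (Fin.last (n + 1)) z)⁻¹ *
                coeffSecond q j s (remaining (Finset.Ico j (Fin.last n)) s x) x) •
              (dualBetheVector q T lam dvac (remaining (Finset.Ico j (Fin.last n)) s x) ∘ₗ
                T (Fin.last (n + 1)) j.castSucc z)) := by
  -- All arguments run on the finite set of reciprocals of z and of the Bethe parameters. There
  -- genericity keeps f nonzero at distinct points and the inverse points lie in D.
  have hP : ∀ u ∈ {u | u⁻¹ ∈ z :: (List.ofFn s).flatten}, u⁻¹ ∈ D ∧ u ≠ 0 := fun u hu =>
    ⟨(hgen.1 _ hu).1, fun e => hgen.ne_zero hu (by rw [e, inv_zero])⟩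
  have hT' := ((rttRelation_iff_exchange q D T).1 hT).dualMonodromy hP
  have hv' := hvac.isVacuum fun u hu => (hP u hu).1
  have hs0 : ∀ ν, ∀ x ∈ s ν, x ≠ 0 := fun ν x hx => hgen.ne_zero (mem_flatten_ofFn z hx)
  have hr0 : ∀ A x ν, ∀ y ∈ remaining A s x ν, y ≠ 0 := fun A x ν y hy =>
    hs0 ν y ((remaining_sublist A s x ν).subset hy)
  have hlam' : ∀ μ : Fin (n + 1), lam μ.succ z ≠ 0 → ∀ ν,
      ∀ x ∈ (if ν = μ then z :: s ν else s ν).map fun x => x⁻¹, lam ν.succ x⁻¹ ≠ 0 := by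
    intro μ hμ ν x hx
    obtain ⟨y, hy, rfl⟩ := List.mem_map.1 hx
    rw [inv_inv]
    split_ifs at hy with h
    · rcases List.mem_cons.1 hy with rfl | hy
      · exact h ▸ hμ
      · exact hlam ν y hy
    · exact hlam ν y hy
  refine ⟨fun hz w hw => ?_, fun hz w hw => ?_⟩
  · have hsep := hgen.separated (t := fun ν => if ν = 0 then z :: s ν else s ν) (μ := 0)
      (if_pos rfl) (fun ν hν => if_neg hν)
    -- The given enumeration w is first replaced by the one with z at the head of its set.
    rw [dualBetheVector_eq, ← betheVector_perm (inv_ne_zero hq) hT' hgen.fRat_ne_zero _ _ hsep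
        fun ν => (hw ν).symm.map _,
      betheVector_first (inv_ne_zero hq) hT' hgen.fRat_ne_zero hv'
        (s := fun ν => (s ν).map fun x => x⁻¹) (z := z⁻¹) hsep (by simp)
        (fun ν hν => by simp only [if_neg hν]) (hlam' 0 hz)]
    refine Finset.sum_congr rfl fun j _ => ?_
    rw [sum_partitions_map_inv]
    refine Finset.sum_congr rfl fun x hx => ?_
    have hx0 := hgen.partitions_ne_zero hx
    rw [remaining_map_inv, inv_inv, ← dualBetheVector_eq]
    refine congrArg₂ (· • ·) ?_ ?_
    · rw [coeffFirst]
      refine congrArg _ (congrArg₂ (· / ·) (Finset.prod_congr rfl fun μ _ => ?_)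
        (Finset.prod_congr rfl fun μ _ => ?_))
      · rw [gLeft_inv_inv q (hx0 _) (hx0 _), ← fProd_map_inv q (hr0 _ x μ.succ)
          (b := [x μ.succ]) (by simpa using hx0 _), alpha, alpha, inv_inv]
        rfl
      · rw [← fProd_map_inv q (hs0 _) (b := [x μ.castSucc]) (by simpa using hx0 _)]
        rfl
    · rw [dualMonodromy, inv_inv]
      rfl
  · have hsep := hgen.separated (t := fun ν => if ν = Fin.last n then z :: s ν else s ν)
      (μ := Fin.last n) (if_pos rfl) (fun ν hν => if_neg hν)
    rw [dualBetheVector_eq, ← betheVector_perm (inv_ne_zero hq) hT' hgen.fRat_ne_zero _ _ hsep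
        fun ν => (hw ν).symm.map _,
      betheVector_last (inv_ne_zero hq) hT' hgen.fRat_ne_zero hv'
        (s := fun ν => (s ν).map fun x => x⁻¹) (z := z⁻¹) hsep (by simp)
        (fun ν hν => by simp only [if_neg hν]) (hlam' (Fin.last n) hz)]
    refine Finset.sum_congr rfl fun j _ => ?_
    rw [sum_partitions_map_inv]
    refine Finset.sum_congr rfl fun x hx => ?_
    have hx0 := hgen.partitions_ne_zero hx
    rw [remaining_map_inv, inv_inv, ← dualBetheVector_eq]
    refine congrArg₂ (· • ·) ?_ ?_
    · rw [coeffSecond]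
      refine congrArg _ (congrArg₂ (· / ·) (Finset.prod_congr rfl fun μ _ => ?_)
        (Finset.prod_congr rfl fun μ _ => ?_))
      · rw [gRight_inv_inv q (hx0 _) (hx0 _), ← fProd_map_inv q (a := [x μ.castSucc])
          (by simpa using hx0 _) (hr0 _ x μ.castSucc)]
        rfl
      · rw [← fProd_map_inv q (a := [x μ.succ]) (by simpa using hx0 _) (hs0 _)]
        rfl
    · rw [dualMonodromy, inv_inv]
      rfl
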